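/- **Setting.** Fix $M\ge 1$, $\eta\in\mathbb C$ and inhomogeneities $\xi_1,\dots,\xi_M\in\mathbb C$ such that $\operatorname{sh}(\xi_j-\xi_k+\eta)\ne 0$ for all $j,k$ (so that $T(\xi_j)$ below is defined; $j=k$ gives $\operatorname{sh}\eta\ne0$). Let $c_j^\dagger,c_j$ be the canonical fermion operators on the Fock space of $M$ sites with vacuum $|\Omega\rangle$, $n_j=c_j^\dagger c_j$, and let $a$ be one further (auxiliary) fermionic mode. For two modes put $$R_{12}(u)=1-n_1-n_2+\frac{\operatorname{sh}u}{\operatorname{sh}(u+\eta)}(n_1+n_2-2n_1n_2)+\frac{\operatorname{sh}\eta}{\operatorname{sh}(u+\eta)}(c_1^\dagger c_2+c_2^\dagger c_1),$$ and let $B(u),C(u)$ be the operators defined by $$T(u)=R_{aM}(u-\xi_M)\cdots R_{a1}(u-\xi_1)=A(u)(1-n_a)+B(u)c_a+c_a^\dagger C(u)+D(u)n_a .$$ Put $$f(u,v)=\frac{\operatorname{sh}(u-v+\eta)}{\operatorname{sh}(u-v)},\quad t(u,v)=\frac{\operatorname{sh}\eta}{\operatorname{sh}(u-v)\operatorname{sh}(u-v+\eta)},\quad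 d(u)=\prod_{m=1}^M f(u,\xi_m)^{-1},\quad \phi^N_m(\{\lambda\})=\prod_{j=1}^N\prod_{k=1}^m f(\lambda_j,\xi_k).$$ A family $\lambda_1,\dots,\lambda_N$ is a solution of the Bethe ansatz equations if, all denominators being nonzero, $$(-1)^{N+1}=d(\lambda_j)\prod_{k\ne j}\frac{f(\lambda_j,\lambda_k)}{f(\lambda_k,\lambda_j)}\qquad(1\le j\le N).$$ Let $1\le m\le M$ and $N\ge0$. **Proposition.** (a) Let $\{\lambda_k\}_{k=1}^N$ and $\{\mu_j\}_{j=1}^{N+1}$ be solutions of the Bethe ansatz equations (for $N$ and $N+1$ particles), and let $$F_N^-=\langle\Omega|\prod_{j=1}^{N+1}C(\mu_j)\,c_m^\dagger\prod_{k=1}^NB(\lambda_k)|\Omega\rangle,\qquad F_N^+=\langle\Omega|\prod_{k=1}^NC(\lambda_k)\,c_m\prod_{j=1}^{N+1}B(\mu_j)|\Omega\rangle .$$ If $\operatorname{sh}(\mu_j-\lambda_k)\ne0$ for all $j,k$, then $$F_N^-=(-1)^{\frac{N(N+1)}2}\,\frac{\phi^{N+1}_{m-1}(\{\mu\})}{\phi^N_{m-1}(\{\lambda\})}\,\frac{\prod_{j=1}^{N+1}\operatorname{sh}(\mu_j-\xi_m+\eta)}{\prod_{k=1}^N\operatorname{sh}(\lambda_k-\xi_m+\eta)}\,\frac{\det_{N+1}H^-}{\prod_{j<k}^{N+1}\operatorname{sh}(\mu_k-\mu_j)\prod_{\alpha<\beta}^N\operatorname{sh}(\lambda_\alpha-\lambda_\beta)},$$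 where $H^-_{j,N+1}=t(\mu_j,\xi_m)$ and, for $k\le N$, $$H^-_{jk}=\frac{\operatorname{sh}\eta}{\operatorname{sh}(\mu_j-\lambda_k)}\Big[\prod_{a\ne j}^{N+1}\operatorname{sh}(\mu_a-\lambda_k+\eta)-(-1)^Nd(\lambda_k)\prod_{a\ne j}^{N+1}\operatorname{sh}(\mu_a-\lambda_k-\eta)\Big].$$ In all cases $$F_N^+=\frac{\phi^N_m(\{\lambda\})\,\phi^N_{m-1}(\{\lambda\})}{\phi^{N+1}_{m-1}(\{\mu\})\,\phi^{N+1}_m(\{\mu\})}\,F_N^- .$$ (b) Let $\{\lambda_k\}_{k=1}^N$ and $\{\mu_j\}_{j=1}^N$ be solutions of the Bethe ansatz equations with $\operatorname{sh}(\mu_j-\lambda_k)\ne0$ for all $j,k$. Then $$\langle\Omega|\prod_{j=1}^NC(\mu_j)\,(1-2n_m)\prod_{k=1}^NB(\lambda_k)|\Omega\rangle=(-1)^{\frac{N(N-1)}2}\frac{\phi^N_{m-1}(\{\mu\})}{\phi^N_{m-1}(\{\lambda\})}\prod_{j=1}^N\frac{\operatorname{sh}(\mu_j-\xi_m+\eta)}{\operatorname{sh}(\lambda_j-\xi_m+\eta)}\,\frac{\det_N(H-2P)}{\prod_{j<k}^N\operatorname{sh}(\lambda_j-\lambda_k)\operatorname{sh}(\mu_k-\mu_j)},$$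 where $$H_{jk}=\frac{\operatorname{sh}\eta}{\operatorname{sh}(\mu_j-\lambda_k)}\Big[\prod_{a\ne j}\operatorname{sh}(\mu_a-\lambda_k+\eta)-(-1)^{N+1}d(\lambda_k)\prod_{a\ne j}\operatorname{sh}(\mu_a-\lambda_k-\eta)\Big],$$ $$P_{jk}=t(\mu_j,\xi_m)\prod_{a=1}^N\operatorname{sh}(\lambda_a-\lambda_k+\eta),$$ and $P$ has rank one if $N\ge1$. -/

import Mathlib

open scoped BigOperators Matrix

noncomputable section

namespace SpinlessFermion

/-- Occupation-number configurations of `L` fermionic modes; they index the basis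
`(c_0†)^{n 0} (c_1†)^{n 1} ⋯ |Ω⟩` of the Fock space. -/
abbrev Occ (L : ℕ) : Type := Fin L → Bool

/-- Operators on the Fock space of `L` modes, as matrices in the occupation-number basis. -/
abbrev FockOp (L : ℕ) : Type := Matrix (Occ L) (Occ L) ℂ

/-- The annihilation operator `c_j`: it sends the basis vector `|n⟩` with `n j = 1` to
`(-1)^{n 0 + ⋯ + n (j-1)}` times the basis vector in which mode `j` is emptied,
and it kills `|n⟩` if `n j = 0`. -/
def ann {L : ℕ} (j : Fin L) : FockOp L :=
  Matrix.of fun n' n =>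
    if n j = true ∧ n' = Function.update n j false then
      (-1 : ℂ) ^ (Finset.univ.filter fun i : Fin L => i < j ∧ n i = true).card
    else 0

/-- The creation operator `c_j†`, the adjoint of `c_j`. -/
def cre {L : ℕ} (j : Fin L) : FockOp L := (ann j)ᴴ

/-- The number operator `n_j = c_j† c_j`. -/
def num {L : ℕ} (j : Fin L) : FockOp L := cre j * ann j

/-- The vacuum expectation value `⟨Ω| X |Ω⟩`. -/
def vev {L : ℕ} (X : FockOp L) : ℂ := X (fun _ => false) (fun _ => false)

/-- The fermionic `R`-operator `R_{ij}(u)` acting on the modes `i` and `j`. -/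
def Rop {L : ℕ} (η : ℂ) (i j : Fin L) (u : ℂ) : FockOp L :=
  1 - num i - num j
    + (Complex.sinh u / Complex.sinh (u + η)) • (num i + num j - (2 : ℂ) • (num i * num j))
    + (Complex.sinh η / Complex.sinh (u + η)) • (cre i * ann j + cre j * ann i)

/-- The `L`-operator `L_m(u) = R_{am}(u - ξ_m)`. It acts on `M + 1` modes: mode `0` is the
auxiliary mode `a`, and the mode `m.succ` is the lattice site `m`. -/
def Lop {M : ℕ} (η : ℂ) (ξ : Fin M → ℂ) (m : Fin M) (u : ℂ) : FockOp (M + 1) :=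
  Rop η 0 m.succ (u - ξ m)

/-- The monodromy operator `T(u) = L_M(u) ⋯ L_2(u) L_1(u)`. -/
def monodromy {M : ℕ} (η : ℂ) (ξ : Fin M → ℂ) (u : ℂ) : FockOp (M + 1) :=
  (List.ofFn fun m : Fin M => Lop η ξ m u).reverse.prod

/-- The block `_a⟨p| X |q⟩_a` of an operator with respect to the auxiliary mode, where
`|0⟩_a ⊗ |n⟩ = |n⟩` and `|1⟩_a ⊗ |n⟩ = c_a† |n⟩`. The auxiliary mode comes first in the ordering
of the modes, so no sign appears: in
`T = A (1 - n_a) + B c_a + c_a† C + D n_a` the operators `A`, `B`, `C`, `D` are the blocks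
with `(p, q) = (0, 0)`, `(0, 1)`, `(1, 0)`, `(1, 1)`. -/
def auxBlock {M : ℕ} (X : FockOp (M + 1)) (p q : Bool) : FockOp M :=
  Matrix.of fun n' n => X (Fin.cons p n') (Fin.cons q n)

/-- The operator `B(u)`. -/
def opB {M : ℕ} (η : ℂ) (ξ : Fin M → ℂ) (u : ℂ) : FockOp M :=
  auxBlock (monodromy η ξ u) false true

/-- The operator `C(u)`. -/
def opC {M : ℕ} (η : ℂ) (ξ : Fin M → ℂ) (u : ℂ) : FockOp M :=
  auxBlock (monodromy η ξ u) true false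

/-- `∏_j B(v_j)`. -/
def prodB {M N : ℕ} (η : ℂ) (ξ : Fin M → ℂ) (v : Fin N → ℂ) : FockOp M :=
  (List.ofFn fun j => opB η ξ (v j)).prod

/-- `∏_j C(v_j)`. -/
def prodC {M N : ℕ} (η : ℂ) (ξ : Fin M → ℂ) (v : Fin N → ℂ) : FockOp M :=
  (List.ofFn fun j => opC η ξ (v j)).prod

/-- `f(u, v) = sh(u - v + η) / sh(u - v)`. -/
def f (η u v : ℂ) : ℂ := Complex.sinh (u - v + η) / Complex.sinh (u - v)

/-- `t(u, v) = sh η / (sh(u - v) sh(u - v + η))`. -/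
def t (η u v : ℂ) : ℂ :=
  Complex.sinh η / (Complex.sinh (u - v) * Complex.sinh (u - v + η))

/-- `d(u) = ∏_m f(u, ξ_m)⁻¹`, the vacuum eigenvalue of `D` up to sign (that of `A` is
`a(u) = 1`). -/
def d {M : ℕ} (η : ℂ) (ξ : Fin M → ℂ) (u : ℂ) : ℂ := ∏ m, (f η u (ξ m))⁻¹

/-- The Bethe ansatz equations for `N` particles:
`(-1)^{N+1} = d(v_j) ∏_{k ≠ j} f(v_j, v_k) / f(v_k, v_j)` for all `j`.
A vanishing denominator makes the right side `0` in Lean, so it never gives a solution; see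
`IsBetheSolution.regular`. -/
def IsBetheSolution {M N : ℕ} (η : ℂ) (ξ : Fin M → ℂ) (v : Fin N → ℂ) : Prop :=
  ∀ j, (-1 : ℂ) ^ (N + 1) =
    d η ξ (v j) * ∏ k ∈ Finset.univ.erase j, (f η (v j) (v k) / f η (v k) (v j))

/-- Every denominator in the Bethe ansatz equations is nonzero at a solution. -/
theorem IsBetheSolution.regular {M N : ℕ} {η : ℂ} {ξ : Fin M → ℂ} {v : Fin N → ℂ}
    (h : IsBetheSolution η ξ v) (j : Fin N) :
    (∀ m, Complex.sinh (v j - ξ m) ≠ 0 ∧ Complex.sinh (v j - ξ m + η) ≠ 0) ∧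
    ∀ k, k ≠ j → Complex.sinh (v j - v k) ≠ 0 ∧ Complex.sinh (v j - v k + η) ≠ 0 := by
  have h0 : d η ξ (v j) * ∏ k ∈ Finset.univ.erase j, (f η (v j) (v k) / f η (v k) (v j)) ≠ 0 := by
    rw [← h j]
    exact pow_ne_zero _ (by norm_num)
  have hd := left_ne_zero_of_mul h0
  have hp := right_ne_zero_of_mul h0
  unfold d at hd
  rw [Finset.prod_ne_zero_iff] at hd hp
  refine ⟨fun m => ?_, fun k hk => ?_⟩
  · have := hd m (Finset.mem_univ m)
    simp only [f, ne_eq, inv_eq_zero, div_eq_zero_iff, not_or] at this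
    exact ⟨this.2, this.1⟩
  · have := hp k (Finset.mem_erase.2 ⟨hk, Finset.mem_univ k⟩)
    simp only [f, ne_eq, div_eq_zero_iff, not_or] at this
    exact ⟨this.1.2, this.1.1⟩

/-- `φ_r(v) = ∏_j ∏_{k=1}^{r} f(v_j, ξ_k)`: the product runs over the first `r` sites. -/
def phi {M N : ℕ} (η : ℂ) (ξ : Fin M → ℂ) (r : ℕ) (v : Fin N → ℂ) : ℂ :=
  ∏ j, ∏ k ∈ Finset.univ.filter (fun k : Fin M => (k : ℕ) < r), f η (v j) (ξ k)

/-- `F_N^-(m|{μ}|{λ}) = ⟨Ω| ∏_{j=1}^{N+1} C(μ_j) c_m† ∏_{k=1}^N B(λ_k) |Ω⟩`. -/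
def Fminus {M N : ℕ} (η : ℂ) (ξ : Fin M → ℂ) (m : Fin M) (mu : Fin (N + 1) → ℂ)
    (lam : Fin N → ℂ) : ℂ :=
  vev (prodC η ξ mu * cre m * prodB η ξ lam)

/-- `F_N^+(m|{λ}|{μ}) = ⟨Ω| ∏_{k=1}^N C(λ_k) c_m ∏_{j=1}^{N+1} B(μ_j) |Ω⟩`. -/
def Fplus {M N : ℕ} (η : ℂ) (ξ : Fin M → ℂ) (m : Fin M) (lam : Fin N → ℂ)
    (mu : Fin (N + 1) → ℂ) : ℂ :=
  vev (prodC η ξ lam * ann m * prodB η ξ mu)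

/-- `F_N^z(m|{μ}|{λ}) = ⟨Ω| ∏_{j=1}^N C(μ_j) (1 - 2 n_m) ∏_{k=1}^N B(λ_k) |Ω⟩`. -/
def Fz {M N : ℕ} (η : ℂ) (ξ : Fin M → ℂ) (m : Fin M) (mu lam : Fin N → ℂ) : ℂ :=
  vev (prodC η ξ mu * (1 - (2 : ℂ) • num m) * prodB η ξ lam)

/-- The `(N+1) × (N+1)` matrix `H^-(m|{μ}|{λ})`; the last column is `t(μ_j, ξ_m)`. -/
def Hminus {M N : ℕ} (η : ℂ) (ξ : Fin M → ℂ) (m : Fin M) (mu : Fin (N + 1) → ℂ)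
    (lam : Fin N → ℂ) : Matrix (Fin (N + 1)) (Fin (N + 1)) ℂ :=
  Matrix.of fun j =>
    Fin.snoc (α := fun _ => ℂ)
      (fun k : Fin N =>
        Complex.sinh η / Complex.sinh (mu j - lam k) *
          ((∏ a ∈ Finset.univ.erase j, Complex.sinh (mu a - lam k + η))
            - (-1 : ℂ) ^ N * d η ξ (lam k) *
              ∏ a ∈ Finset.univ.erase j, Complex.sinh (mu a - lam k - η)))
      (t η (mu j) (ξ m))

/-- The `N × N` matrix `H({μ}|{λ})`. -/
def Hz {M N : ℕ} (η : ℂ) (ξ : Fin M → ℂ) (mu lam : Fin N → ℂ) : Matrix (Fin N) (Fin N) ℂ :=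
  Matrix.of fun j k =>
    Complex.sinh η / Complex.sinh (mu j - lam k) *
      ((∏ a ∈ Finset.univ.erase j, Complex.sinh (mu a - lam k + η))
        - (-1 : ℂ) ^ (N + 1) * d η ξ (lam k) *
          ∏ a ∈ Finset.univ.erase j, Complex.sinh (mu a - lam k - η))

/-- The `N × N` matrix `P(m|{μ}|{λ})`. -/
def Pz {M N : ℕ} (η : ℂ) (ξ : Fin M → ℂ) (m : Fin M) (mu lam : Fin N → ℂ) :
    Matrix (Fin N) (Fin N) ℂ :=
  Matrix.of fun j k => t η (mu j) (ξ m) * ∏ a, Complex.sinh (lam a - lam k + η)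

end SpinlessFermion

end

open scoped BigOperators Matrix

noncomputable section

namespace SpinlessFermion

/-! ### Trigonometric partial fractions -/

/-! Every form factor is reduced to scalar products of Bethe vectors, one of them on shell, and
these are determinants by Slavnov's formula.

From fermions to the six-vertex chain. After a Jordan–Wigner transformation (`fermT_eq`) the
fermionic monodromy matrix is that of the six-vertex chain, up to normalization and the total parity
in front of the row `C`, `D`. On `N` particles the fermionic `A - D` therefore acts as the
six-vertex `A + κ D` with `κ = (-1)^(N+1)`, which explains the sign in the Bethe equations. The
parities in a product of operators `C` produce the sign `(-1)^(N(N-1)/2)`.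

Inverse problem. `R_{am}(0)` is the graded permutation of the auxiliary mode with the site `m`.
Hence `A - D` at the inhomogeneity of the site that is the rightmost factor moves this site to the
left end (`fermV_mul`), and up to products of such transfer matrices the operators `1 - n_m`,
`c_m†`, `c_m`, `-n_m` are `A`, `B`, `C`, `D` at `ξ m` (`fermV_mul_fermT`). Bethe vectors are
eigenvectors of these products with eigenvalues `phi`. So `F⁻` is the scalar product of the on-shell
`μ` with the tuple `(λ, ξ_m)`. `F⁺` contains the same number because scalar products are symmetric
in their two tuples. For `1 - 2 n_m` one needs `A - κ D = (A + κ D) - 2 κ D`. The first part is an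
eigenvalue, the second a sum over `k` of scalar products with `λ_k` replaced by `ξ_m`; this sum of
determinants with one replaced column is the expansion of a rank-one perturbation.

Slavnov's formula. An off-shell scalar product is linear in each pair `(a p, d p)` of vacuum
eigenvalues at its arguments, with coefficients independent of the representation
(`exists_universal_scal`). There are enough representations to separate all monomials
(`exists_rep`), so identities proved in representations hold for arbitrary functions `a` and `d`
(`WeightPoly.eq_zero`). Evaluating `⟨μ| A(v) + κ D(v) |u⟩` on both sides at a point with `a v = 1`,
`d v = 0` relates the scalar product at `u` to those with one `u_k` replaced by `v`
(`universalScal_onShell`). The determinant obeys the same relation, by a residue sum and Cramer's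
rule (`slavnov_relation`). The difference of the two solves a homogeneous system. Taking `v` close
to the points `μ_i`, where `∏ f(μ_j, v)` has poles, makes the system invertible, and reduces
everything to arguments at which `d` vanishes; there both sides satisfy one recursion
(`slavnov_recursion`). Genericity assumptions are removed by continuity. -/

theorem sinh_sub_eq_exp (x y : ℂ) :
    Complex.sinh (x - y) =
      (Complex.exp (2 * x) - Complex.exp (2 * y)) * (Complex.exp (-x) * Complex.exp (-y) / 2) := by
  have h1 : Complex.exp (2 * x) = Complex.exp x * Complex.exp x := by rw [← Complex.exp_add]; ring_nf
  have h2 : Complex.exp (2 * y) = Complex.exp y * Complex.exp y := by rw [← Complex.exp_add]; ring_nf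
  have h3 : Complex.exp (x - y) = Complex.exp x * Complex.exp (-y) := by
    rw [← Complex.exp_add]; ring_nf
  have h4 : Complex.exp (-(x - y)) = Complex.exp y * Complex.exp (-x) := by
    rw [← Complex.exp_add]; ring_nf
  have hx : Complex.exp x * Complex.exp (-x) = 1 := by rw [← Complex.exp_add]; simp
  have hy : Complex.exp y * Complex.exp (-y) = 1 := by rw [← Complex.exp_add]; simp
  rw [Complex.sinh, h1, h2, h3, h4]
  linear_combination (-Complex.exp x * Complex.exp (-y) / 2) * hx
    + (Complex.exp y * Complex.exp (-x) / 2) * hy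

/-- The sum of the residues of `∏ sh(z - w_q) / ∏ sh(z - x_i)` vanishes if there are two more
factors in the denominator than in the numerator. -/
theorem sum_sinh_residues {ι κ : Type*} [Fintype ι] [DecidableEq ι] (x : ι → ℂ)
    (hx : ∀ i j, i ≠ j → Complex.sinh (x i - x j) ≠ 0) (Q : Finset κ) (w : κ → ℂ)
    (hQ : Q.card + 2 = Fintype.card ι) :
    ∑ i, (∏ q ∈ Q, Complex.sinh (x i - w q)) /
      ∏ j ∈ Finset.univ.erase i, Complex.sinh (x i - x j) = 0 := by
  set X : ι → ℂ := fun i => Complex.exp (2 * x i) with hX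
  have hinj : Set.InjOn X (Finset.univ : Finset ι) := by
    intro i _ j _ hij
    by_contra hne
    apply hx i j hne
    rw [sinh_sub_eq_exp]
    have : Complex.exp (2 * x i) = Complex.exp (2 * x j) := hij
    rw [this]; ring
  set P : Polynomial ℂ := ∏ q ∈ Q, (Polynomial.X - Polynomial.C (Complex.exp (2 * w q))) with hP
  have hmonic : P.Monic := Polynomial.monic_prod_of_monic _ _ fun q _ => Polynomial.monic_X_sub_C _
  have hdeg : P.natDegree = Q.card := by
    rw [hP, Polynomial.natDegree_prod_of_monic _ _ fun q _ => Polynomial.monic_X_sub_C _]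
    simp
  -- In the variables `X i = exp (2 x i)`, the sum of `P(X_i) / ∏ (X_i - X_j)` is the coefficient of
  -- `P` of degree `card ι - 1`. It vanishes since `P` has degree `card ι - 2`.
  have hsum := Lagrange.coeff_eq_sum hinj (P := P) (by
    rw [Polynomial.degree_eq_natDegree hmonic.ne_zero, hdeg, Finset.card_univ]
    exact_mod_cast (by omega))
  rw [Polynomial.coeff_eq_zero_of_natDegree_lt (by
    rw [hdeg, Finset.card_univ]; omega)] at hsum
  set W := ∏ q ∈ Q, Complex.exp (-w q) with hW
  set E := ∏ j, Complex.exp (-x j) with hE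
  have hE0 : E ≠ 0 := Finset.prod_ne_zero_iff.2 fun j _ => Complex.exp_ne_zero _
  -- The exponential prefactor of the `i`-th term is `2 W / E` for every `i`: with exactly two
  -- factors fewer in the numerator, the powers of `exp (-x i)` left over complete `E`.
  rw [← mul_zero (2 * W / E), hsum, Finset.mul_sum]
  refine Finset.sum_congr rfl fun i _ => ?_
  have hEi : E = Complex.exp (-x i) * ∏ j ∈ Finset.univ.erase i, Complex.exp (-x j) :=
    (Finset.mul_prod_erase _ _ (Finset.mem_univ i)).symm
  have hnum : ∏ q ∈ Q, Complex.sinh (x i - w q) =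
      P.eval (X i) * ((Complex.exp (-x i) / 2) ^ Q.card * W) := by
    rw [hP, Polynomial.eval_prod, hW, ← Finset.prod_const, ← Finset.prod_mul_distrib,
      ← Finset.prod_mul_distrib]
    refine Finset.prod_congr rfl fun q _ => ?_
    rw [sinh_sub_eq_exp]
    simp only [Polynomial.eval_sub, Polynomial.eval_X, Polynomial.eval_C, hX]
    ring
  have hden : ∏ j ∈ Finset.univ.erase i, Complex.sinh (x i - x j) =
      (∏ j ∈ Finset.univ.erase i, (X i - X j)) *
        ((Complex.exp (-x i) / 2) ^ (Q.card + 1) *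
          ∏ j ∈ Finset.univ.erase i, Complex.exp (-x j)) := by
    have hc : Q.card + 1 = (Finset.univ.erase i).card := by
      rw [Finset.card_erase_of_mem (Finset.mem_univ i), Finset.card_univ]; omega
    rw [hc, ← Finset.prod_const, ← Finset.prod_mul_distrib, ← Finset.prod_mul_distrib]
    refine Finset.prod_congr rfl fun j _ => ?_
    rw [sinh_sub_eq_exp]
    ring
  have h0 : ∏ j ∈ Finset.univ.erase i, (X i - X j) ≠ 0 := by
    refine Finset.prod_ne_zero_iff.2 fun j hj => sub_ne_zero.2 fun h => ?_
    exact (Finset.ne_of_mem_erase hj) (hinj (Finset.mem_coe.2 (Finset.mem_univ j))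
      (Finset.mem_coe.2 (Finset.mem_univ i)) h.symm)
  have h1 : ∏ j ∈ Finset.univ.erase i, Complex.exp (-x j) ≠ 0 :=
    Finset.prod_ne_zero_iff.2 fun j _ => Complex.exp_ne_zero _
  have h2 := Complex.exp_ne_zero (-x i)
  rw [hnum, hden, hEi, pow_succ]
  field_simp

/-- Partial fractions with one distinguished pole. -/
theorem sum_sinh_residues_one {N : ℕ} (μ : Fin N → ℂ) (y : ℂ)
    (hμ : ∀ i j, i ≠ j → Complex.sinh (μ i - μ j) ≠ 0)
    (hy : ∀ i, Complex.sinh (μ i - y) ≠ 0)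
    {κ : Type*} (Q : Finset κ) (w : κ → ℂ) (hQ : Q.card + 1 = N) :
    ∑ j, (∏ q ∈ Q, Complex.sinh (μ j - w q)) /
        ((∏ a ∈ Finset.univ.erase j, Complex.sinh (μ j - μ a)) * Complex.sinh (μ j - y)) =
      -((∏ q ∈ Q, Complex.sinh (y - w q)) / ∏ a, Complex.sinh (y - μ a)) := by
  have hy' : ∀ i, Complex.sinh (y - μ i) ≠ 0 := fun i => by
    rw [← neg_sub, Complex.sinh_neg]; exact neg_ne_zero.2 (hy i)
  -- The pole `y` is adjoined to the nodes as the value at `none`.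
  have h := sum_sinh_residues (fun o : Option (Fin N) => o.elim y μ) (by
    rintro (_ | i) (_ | j) hij
    · exact absurd rfl hij
    · exact hy' j
    · exact hy i
    · exact hμ i j fun h => hij (by rw [h])) Q w (by simp; omega)
  rw [Fintype.sum_option] at h
  have hn : (Finset.univ : Finset (Option (Fin N))).erase none =
      Finset.univ.map Function.Embedding.some := by
    ext o; cases o <;> simp
  have hs : ∀ i : Fin N, (Finset.univ : Finset (Option (Fin N))).erase (some i) =
      insert none ((Finset.univ.erase i).map Function.Embedding.some) := by
    intro i; ext o; cases o <;> simp
  simp only [hn, hs, Finset.prod_map, Option.elim] at h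
  rw [eq_neg_iff_add_eq_zero, add_comm, ← h]
  congr 1
  refine Finset.sum_congr rfl fun i _ => ?_
  rw [Finset.prod_insert (by simp), Finset.prod_map]
  simp only [Function.Embedding.some_apply]
  rw [mul_comm]

/-- Partial fractions with two distinguished poles. -/
theorem sum_sinh_residues_two {N : ℕ} (μ : Fin N → ℂ) (y z : ℂ)
    (hμ : ∀ i j, i ≠ j → Complex.sinh (μ i - μ j) ≠ 0)
    (hy : ∀ i, Complex.sinh (μ i - y) ≠ 0) (hz : ∀ i, Complex.sinh (μ i - z) ≠ 0)
    (hyz : Complex.sinh (y - z) ≠ 0)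
    {κ : Type*} (Q : Finset κ) (w : κ → ℂ) (hQ : Q.card = N) :
    ∑ j, (∏ q ∈ Q, Complex.sinh (μ j - w q)) /
        ((∏ a ∈ Finset.univ.erase j, Complex.sinh (μ j - μ a)) *
          (Complex.sinh (μ j - y) * Complex.sinh (μ j - z))) =
      -((∏ q ∈ Q, Complex.sinh (y - w q)) /
          ((∏ a, Complex.sinh (y - μ a)) * Complex.sinh (y - z))
        + (∏ q ∈ Q, Complex.sinh (z - w q)) /
          ((∏ a, Complex.sinh (z - μ a)) * Complex.sinh (z - y))) := by
  have hflip : ∀ a b : ℂ, Complex.sinh (a - b) ≠ 0 → Complex.sinh (b - a) ≠ 0 := fun a b h => by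
    rw [← neg_sub, Complex.sinh_neg]; exact neg_ne_zero.2 h
  have h := sum_sinh_residues
    (fun o : Option (Option (Fin N)) => o.elim y fun o' => o'.elim z μ) (by
    rintro (_ | _ | i) (_ | _ | j) hij
    · exact absurd rfl hij
    · exact hyz
    · exact hflip _ _ (hy j)
    · exact hflip _ _ hyz
    · exact absurd rfl hij
    · exact hflip _ _ (hz j)
    · exact hy i
    · exact hz i
    · exact hμ i j fun h => hij (by rw [h])) Q w (by simp; omega)
  rw [Fintype.sum_option, Fintype.sum_option] at h
  have hn : (Finset.univ : Finset (Option (Option (Fin N)))).erase none =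
      insert (some none) (Finset.univ.map
        (Function.Embedding.some.trans Function.Embedding.some)) := by
    ext o; rcases o with _ | _ | o <;> simp
  have hn' : (Finset.univ : Finset (Option (Option (Fin N)))).erase (some none) =
      insert none (Finset.univ.map
        (Function.Embedding.some.trans Function.Embedding.some)) := by
    ext o; rcases o with _ | _ | o <;> simp
  have hs : ∀ i : Fin N, (Finset.univ : Finset (Option (Option (Fin N)))).erase (some (some i)) =
      insert none (insert (some none) ((Finset.univ.erase i).map
        (Function.Embedding.some.trans Function.Embedding.some))) := by
    intro i; ext o; rcases o with _ | _ | o <;> simp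
  simp only [hn, hn', hs] at h
  rw [Finset.prod_insert (by simp), Finset.prod_insert (by simp)] at h
  simp only [Finset.prod_map] at h
  rw [eq_neg_iff_add_eq_zero, add_comm, ← h, add_assoc]
  congr 1
  · simp [mul_comm]
  congr 1
  · simp [mul_comm]
  refine Finset.sum_congr rfl fun i _ => ?_
  rw [Finset.prod_insert (by simp), Finset.prod_insert (by simp), Finset.prod_map]
  simp
  ring

/-! ### The Slavnov matrix -/

/-- The entry of the Slavnov matrix with row parameter `μ j` and column parameter `u`, where `a`
and `d` are the vacuum eigenvalues at `u` and `κ` is the twist. -/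
def slavnovEntry (η κ : ℂ) {N : ℕ} (μ : Fin N → ℂ) (u a d : ℂ) (j : Fin N) : ℂ :=
  Complex.sinh η / Complex.sinh (μ j - u) *
    (a * ∏ l ∈ Finset.univ.erase j, Complex.sinh (μ l - u + η)
      - κ * d * ∏ l ∈ Finset.univ.erase j, Complex.sinh (μ l - u - η))

/-- The coefficients of the linear relation between the rows of the Slavnov matrix. -/
def slavnovWeight {N : ℕ} (μ u : Fin N → ℂ) (j : Fin N) : ℂ :=
  (∏ l, Complex.sinh (μ j - u l)) / ∏ a ∈ Finset.univ.erase j, Complex.sinh (μ j - μ a)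

theorem sinh_sub_comm (x y : ℂ) : Complex.sinh (x - y) = -Complex.sinh (y - x) := by
  rw [← neg_sub, Complex.sinh_neg]

theorem prod_sinh_neg {ι : Type*} (s : Finset ι) (x : ι → ℂ) :
    ∏ i ∈ s, Complex.sinh (-x i) = (-1) ^ s.card * ∏ i ∈ s, Complex.sinh (x i) := by
  simp only [Complex.sinh_neg, Finset.prod_neg]

/-- After division by `∏ sinh (μ l - u k + η)` the left side is the sum of the residues at the `μ j`
of a function whose only other pole is `u k - η`. The factor `sinh (μ j - u k)` of the weight
cancels, so the numerator runs over `l ≠ k`. -/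
theorem sum_slavnovWeight_shift {N : ℕ} (η : ℂ) (μ u : Fin N → ℂ)
    (hμ : ∀ i j, i ≠ j → Complex.sinh (μ i - μ j) ≠ 0)
    (hu : ∀ i j, Complex.sinh (μ i - u j) ≠ 0) (k : Fin N)
    (hη : ∀ i, Complex.sinh (μ i - u k + η) ≠ 0) :
    ∑ j, slavnovWeight μ u j / Complex.sinh (μ j - u k) *
        ∏ l ∈ Finset.univ.erase j, Complex.sinh (μ l - u k + η) =
      ∏ l ∈ Finset.univ.erase k, Complex.sinh (u l - u k + η) := by
  have hN : (Finset.univ.erase k).card + 1 = N := by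
    rw [Finset.card_erase_add_one (Finset.mem_univ k)]; simp
  have h := sum_sinh_residues_one μ (u k - η) hμ
    (fun i => by rw [show μ i - (u k - η) = μ i - u k + η by ring]; exact hη i)
    (Finset.univ.erase k) u hN
  have hA0 : ∏ a, Complex.sinh (μ a - u k + η) ≠ 0 := Finset.prod_ne_zero_iff.2 fun a _ => hη a
  have hr : (∏ q ∈ Finset.univ.erase k, Complex.sinh (u k - η - u q)) /
      ∏ a, Complex.sinh (u k - η - μ a) =
      -((∏ l ∈ Finset.univ.erase k, Complex.sinh (u l - u k + η)) /
        ∏ a, Complex.sinh (μ a - u k + η)) := by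
    have e1 : ∀ q, u k - η - u q = -(u q - u k + η) := fun q => by ring
    have e2 : ∀ q, u k - η - μ q = -(μ q - u k + η) := fun q => by ring
    simp only [e1, e2, prod_sinh_neg]
    have hc : (Finset.univ : Finset (Fin N)).card = (Finset.univ.erase k).card + 1 := by
      rw [hN]; simp
    rw [hc, pow_succ]
    have : ((-1 : ℂ)) ^ (Finset.univ.erase k).card ≠ 0 := pow_ne_zero _ (by norm_num)
    field_simp
  rw [hr, neg_neg] at h
  rw [eq_div_iff hA0, Finset.sum_mul] at h
  rw [← h]
  refine Finset.sum_congr rfl fun j _ => ?_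
  rw [slavnovWeight, ← Finset.mul_prod_erase Finset.univ (fun l => Complex.sinh (μ j - u l))
    (Finset.mem_univ k), ← Finset.mul_prod_erase Finset.univ
    (fun l => Complex.sinh (μ l - u k + η)) (Finset.mem_univ j),
    show μ j - (u k - η) = μ j - u k + η by ring]
  have h1 := hu j k
  have h2 := hη j
  have h3 : ∏ a ∈ Finset.univ.erase j, Complex.sinh (μ j - μ a) ≠ 0 :=
    Finset.prod_ne_zero_iff.2 fun a ha => hμ j a (Finset.ne_of_mem_erase ha).symm
  field_simp

/-- The shift identity applied with `η` and with `-η`. Up to `sinh η` and a common denominator, the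
value is the difference of the two sides of the Bethe equation for `u k`, so it vanishes when `u` is
on shell. -/
theorem sum_slavnovWeight_mul_entry {N : ℕ} (η κ : ℂ) (μ u : Fin N → ℂ)
    (hμ : ∀ i j, i ≠ j → Complex.sinh (μ i - μ j) ≠ 0)
    (hu : ∀ i j, Complex.sinh (μ i - u j) ≠ 0) (k : Fin N)
    (hη : ∀ i, Complex.sinh (μ i - u k + η) ≠ 0)
    (hη' : ∀ i, Complex.sinh (μ i - u k - η) ≠ 0) (a d : ℂ) :
    ∑ j, slavnovWeight μ u j * slavnovEntry η κ μ (u k) a d j =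
      Complex.sinh η * (a * ∏ l ∈ Finset.univ.erase k, Complex.sinh (u l - u k + η)
        - κ * d * ∏ l ∈ Finset.univ.erase k, Complex.sinh (u l - u k - η)) := by
  have h1 := sum_slavnovWeight_shift η μ u hμ hu k hη
  have h2 := sum_slavnovWeight_shift (-η) μ u hμ hu k hη'
  simp only [← sub_eq_add_neg] at h2
  rw [← h1, ← h2, Finset.mul_sum, Finset.mul_sum, ← Finset.sum_sub_distrib, Finset.mul_sum]
  refine Finset.sum_congr rfl fun j _ => ?_
  rw [slavnovEntry]
  ring

/-- Here `v` is not one of the `u l`, so nothing cancels and two further poles `v` and `v - η`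
contribute. Divided by `∏ sinh (u l - v)`, the value becomes `∏ f(u_l, v) - ∏ f(μ_a, v)`, the
difference of two transfer-matrix eigenvalues. -/
theorem sum_slavnovWeight_mul_entry_new {N : ℕ} (η κ : ℂ) (μ u : Fin N → ℂ) (v : ℂ)
    (hη0 : Complex.sinh η ≠ 0)
    (hμ : ∀ i j, i ≠ j → Complex.sinh (μ i - μ j) ≠ 0)
    (hv : ∀ i, Complex.sinh (μ i - v) ≠ 0)
    (hη : ∀ i, Complex.sinh (μ i - v + η) ≠ 0) :
    ∑ j, slavnovWeight μ u j * slavnovEntry η κ μ v 1 0 j =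
      ∏ l, Complex.sinh (u l - v + η) - (∏ l, Complex.sinh (u l - v)) * ∏ a, f η (μ a) v := by
  have h := sum_sinh_residues_two μ v (v - η) hμ hv
    (fun i => by rw [show μ i - (v - η) = μ i - v + η by ring]; exact hη i)
    (by rwa [sub_sub_cancel]) Finset.univ u (by simp)
  have hA0 : ∏ a, Complex.sinh (μ a - v + η) ≠ 0 := Finset.prod_ne_zero_iff.2 fun a _ => hη a
  have hB0 : ∏ a, Complex.sinh (μ a - v) ≠ 0 := Finset.prod_ne_zero_iff.2 fun a _ => hv a
  have e1 : ∀ q, v - u q = -(u q - v) := fun q => by ring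
  have e2 : ∀ q, v - μ q = -(μ q - v) := fun q => by ring
  have e3 : ∀ q, v - η - u q = -(u q - v + η) := fun q => by ring
  have e4 : ∀ q, v - η - μ q = -(μ q - v + η) := fun q => by ring
  have e5 : v - η - v = -η := by ring
  have e6 : v - (v - η) = η := by ring
  have e7 : ∀ q, μ q - (v - η) = μ q - v + η := fun q => by ring
  simp only [e1, e2, e3, e4, e5, e6, e7, Complex.sinh_neg, Finset.prod_neg] at h
  have hone : ((-1 : ℂ)) ^ (Finset.univ : Finset (Fin N)).card ≠ 0 := pow_ne_zero _ (by norm_num)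
  have h' : ∑ j, (∏ q, Complex.sinh (μ j - u q)) /
        ((∏ a ∈ Finset.univ.erase j, Complex.sinh (μ j - μ a)) *
          (Complex.sinh (μ j - v) * Complex.sinh (μ j - v + η)))
        * (Complex.sinh η * ∏ a, Complex.sinh (μ a - v + η)) =
      ∏ l, Complex.sinh (u l - v + η) - (∏ l, Complex.sinh (u l - v)) * ∏ a, f η (μ a) v := by
    rw [← Finset.sum_mul, h]
    simp only [f, Finset.prod_div_distrib]
    field_simp
    ring
  rw [← h']
  refine Finset.sum_congr rfl fun j _ => ?_
  rw [slavnovWeight, slavnovEntry, ← Finset.mul_prod_erase Finset.univ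
    (fun l => Complex.sinh (μ l - v + η)) (Finset.mem_univ j)]
  have h1 := hv j
  have h2 := hη j
  have h3 : ∏ a ∈ Finset.univ.erase j, Complex.sinh (μ j - μ a) ≠ 0 :=
    Finset.prod_ne_zero_iff.2 fun a ha => hμ j a (Finset.ne_of_mem_erase ha).symm
  field_simp
  ring

/-! ### Representations of the Yang--Baxter algebra with a vacuum -/

/-- `g(u, v) = sh η / sh(u - v)`. -/
def g (η u v : ℂ) : ℂ := Complex.sinh η / Complex.sinh (u - v)

/-- A representation of the six-vertex Yang--Baxter algebra with a vacuum vector `Ω` and a dual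
vacuum vector `ω`. Only the exchange relations needed below are recorded. -/
structure YBRep (η : ℂ) where
  ι : Type
  [fintype : Fintype ι]
  [decidableEq : DecidableEq ι]
  A : ℂ → Matrix ι ι ℂ
  B : ℂ → Matrix ι ι ℂ
  C : ℂ → Matrix ι ι ℂ
  D : ℂ → Matrix ι ι ℂ
  a : ℂ → ℂ
  d : ℂ → ℂ
  Ω : ι → ℂ
  ω : ι → ℂ
  comm_B : ∀ u v, Commute (B u) (B v)
  comm_C : ∀ u v, Commute (C u) (C v)
  rel_AB : ∀ u v, Complex.sinh (u - v) • (A v * B u) =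
    Complex.sinh (u - v + η) • (B u * A v) - Complex.sinh η • (B v * A u)
  rel_DB : ∀ u v, Complex.sinh (u - v) • (D u * B v) =
    Complex.sinh (u - v + η) • (B v * D u) - Complex.sinh η • (B u * D v)
  rel_CA : ∀ u v, Complex.sinh (u - v) • (C u * A v) =
    Complex.sinh (u - v + η) • (A v * C u) - Complex.sinh η • (A u * C v)
  rel_CD : ∀ u v, Complex.sinh (u - v) • (C v * D u) =
    Complex.sinh (u - v + η) • (D u * C v) - Complex.sinh η • (D v * C u)
  rel_CB : ∀ u v, Complex.sinh (u - v) • (C u * B v - B v * C u) =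
    Complex.sinh η • (A v * D u - A u * D v)
  rel_CB' : ∀ u v, Complex.sinh (u - v) • (C u * B v - B v * C u) =
    Complex.sinh η • (D u * A v - D v * A u)
  A_vac : ∀ u, A u *ᵥ Ω = a u • Ω
  D_vac : ∀ u, D u *ᵥ Ω = d u • Ω
  C_vac : ∀ u, C u *ᵥ Ω = 0
  vac_A : ∀ u, ω ᵥ* A u = a u • ω
  vac_D : ∀ u, ω ᵥ* D u = d u • ω
  vac_B : ∀ u, ω ᵥ* B u = 0
  norm_vac : ω ⬝ᵥ Ω = 1

attribute [instance] YBRep.fintype YBRep.decidableEq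

/-- The points of `s` are distinct modulo `iπ`. -/
def Distinct (s : Finset ℂ) : Prop := ∀ x ∈ s, ∀ y ∈ s, x ≠ y → Complex.sinh (x - y) ≠ 0

theorem Distinct.mono {s t : Finset ℂ} (ht : Distinct t) (h : s ⊆ t) : Distinct s :=
  fun x hx y hy => ht x (h hx) y (h hy)

/-- Consistency of the exchange relations: in moving `A(v)` through `B(x)` and the rest, the
replacement of `k` by `v` arises directly and through the intermediate point `x`; this identity
merges the two contributions. `g_mul_f_sub'` does the same for `D`. -/
theorem g_mul_f_sub {η x k v : ℂ} (hxk : Complex.sinh (x - k) ≠ 0)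
    (hxv : Complex.sinh (x - v) ≠ 0) (hkv : Complex.sinh (k - v) ≠ 0) :
    g η k v * (f η x k - f η x v) = -(g η x v * g η k x) := by
  have hkx : Complex.sinh (k - x) ≠ 0 := by
    rw [sinh_sub_comm]; exact neg_ne_zero.2 hxk
  have e1 : k - x = -(x - k) := by ring
  have e2 : k - v = x - v - (x - k) := by ring
  rw [e2] at hkv
  unfold g f
  rw [e1, e2, Complex.sinh_neg]
  field_simp
  simp only [Complex.sinh_add, Complex.sinh_sub]
  ring

theorem g_mul_f_sub' {η x k v : ℂ} (hxk : Complex.sinh (x - k) ≠ 0)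
    (hxv : Complex.sinh (x - v) ≠ 0) (hkv : Complex.sinh (k - v) ≠ 0) :
    g η v k * (f η k x - f η v x) = -(g η v x * g η x k) := by
  have hvk : Complex.sinh (v - k) ≠ 0 := by rw [sinh_sub_comm]; exact neg_ne_zero.2 hkv
  have hvx : Complex.sinh (v - x) ≠ 0 := by rw [sinh_sub_comm]; exact neg_ne_zero.2 hxv
  have e1 : k - x = -(x - k) := by ring
  have e : v - k = (v - x) + (x - k) := by ring
  unfold g f
  rw [e1, Complex.sinh_neg]
  rw [e] at hvk ⊢
  generalize v - x = p at *
  generalize x - k = q at *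
  have h : Complex.sinh (-q + η) * Complex.sinh p + Complex.sinh q * Complex.sinh (p + η) =
      Complex.sinh η * Complex.sinh (p + q) := by
    simp only [Complex.sinh_add, Complex.sinh_neg, Complex.cosh_neg]
    ring
  field_simp
  linear_combination (-Complex.sinh η) * h

theorem sinh_add_mul_sinh_add (x y z : ℂ) : Complex.sinh (x + z) * Complex.sinh (y + z) =
    Complex.sinh x * Complex.sinh y + Complex.sinh z * Complex.sinh (x + y + z) := by
  simp only [Complex.sinh_add, Complex.cosh_add]
  linear_combination (Complex.sinh x * Complex.sinh y) * (Complex.cosh_sq_sub_sinh_sq z)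

/-- Merges the two contributions to the term without `B(k)` in the action of `C(v)`: one from `C`
passing `B(x)`, one from the commutator. -/
theorem g_add_g_mul {η x k v : ℂ} (hxk : Complex.sinh (x - k) ≠ 0)
    (hvx : Complex.sinh (v - x) ≠ 0) (hvk : Complex.sinh (v - k) ≠ 0) :
    g η v k + g η v x * f η v k * g η x k = g η v k * (f η v x * f η x k) := by
  have e : v - k = (v - x) + (x - k) := by ring
  unfold g f
  rw [e] at hvk ⊢
  generalize v - x = p at *
  generalize x - k = q at *
  have h := sinh_add_mul_sinh_add p q η
  field_simp
  linear_combination (-Complex.sinh η) * h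

/-! ### Action of the monodromy entries on off-shell Bethe vectors. -/

section Action

variable {n : Type} [Fintype n] [DecidableEq n]

/-- `∏_{u ∈ s} B(u)` for a commuting family. -/
def finProd (B : ℂ → Matrix n n ℂ) (hB : ∀ u v, Commute (B u) (B v)) (s : Finset ℂ) :
    Matrix n n ℂ :=
  s.noncommProd B fun _ _ _ _ _ => hB _ _

theorem finProd_empty (B : ℂ → Matrix n n ℂ) (hB : ∀ u v, Commute (B u) (B v)) :
    finProd B hB ∅ = 1 := Finset.noncommProd_empty _ _

theorem finProd_insert (B : ℂ → Matrix n n ℂ) (hB : ∀ u v, Commute (B u) (B v)) {u : ℂ}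
    {s : Finset ℂ} (hu : u ∉ s) : finProd B hB (insert u s) = B u * finProd B hB s :=
  Finset.noncommProd_insert_of_notMem _ _ _ _ hu

theorem finProd_insert' (B : ℂ → Matrix n n ℂ) (hB : ∀ u v, Commute (B u) (B v)) {u : ℂ}
    {s : Finset ℂ} (hu : u ∉ s) : finProd B hB (insert u s) = finProd B hB s * B u :=
  Finset.noncommProd_insert_of_notMem' _ _ _ _ hu

/-- The action of a diagonal element of the monodromy matrix on an off-shell Bethe vector. -/
theorem diag_action (B X : ℂ → Matrix n n ℂ) (hB : ∀ u v, Commute (B u) (B v)) (Ω : n → ℂ)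
    (e : ℂ → ℂ) (he : ∀ u, X u *ᵥ Ω = e u • Ω) (F G : ℂ → ℂ → ℂ)
    (hrel : ∀ u v, Complex.sinh (u - v) ≠ 0 →
      X v * B u = F u v • (B u * X v) - G u v • (B v * X u))
    (hid : ∀ x k v, Complex.sinh (x - k) ≠ 0 → Complex.sinh (x - v) ≠ 0 →
      Complex.sinh (k - v) ≠ 0 → G k v * (F x k - F x v) = -(G x v * G k x)) :
    ∀ (s : Finset ℂ) (v : ℂ), v ∉ s → Distinct (insert v s) →
      X v *ᵥ (finProd B hB s *ᵥ Ω) =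
        (e v * ∏ l ∈ s, F l v) • (finProd B hB s *ᵥ Ω) +
          ∑ k ∈ s, (e k * (-G k v * ∏ l ∈ s.erase k, F l k)) •
            (finProd B hB (insert v (s.erase k)) *ᵥ Ω) := by
  intro s
  induction s using Finset.induction_on with
  | empty =>
    intro v _ _
    simp [finProd_empty, he]
  | insert x s hx ih =>
    intro v hv hd
    have hvx : v ≠ x := fun h => hv (h ▸ Finset.mem_insert_self _ _)
    have hvs : v ∉ s := fun h => hv (Finset.mem_insert_of_mem h)
    have hxv0 : Complex.sinh (x - v) ≠ 0 := hd x (by simp) v (by simp) hvx.symm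
    have h1 := ih v hvs (hd.mono (Finset.insert_subset_insert _ (Finset.subset_insert _ _)))
    have h2 := ih x hx (hd.mono (Finset.subset_insert _ _))
    rw [finProd_insert B hB hx, Matrix.mulVec_mulVec, ← Matrix.mul_assoc, hrel x v hxv0,
      Matrix.sub_mul, Matrix.sub_mulVec, Matrix.smul_mul, Matrix.smul_mul, Matrix.smul_mulVec,
      Matrix.smul_mulVec, Matrix.mul_assoc, Matrix.mul_assoc, ← Matrix.mulVec_mulVec,
      ← Matrix.mulVec_mulVec, ← Matrix.mulVec_mulVec, ← Matrix.mulVec_mulVec, h1, h2,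
      Finset.prod_insert hx, Finset.sum_insert hx, Finset.erase_insert hx]
    simp only [Matrix.mulVec_add, Matrix.mulVec_smul, Matrix.mulVec_sum, Matrix.mulVec_mulVec]
    rw [← finProd_insert B hB hx, ← finProd_insert B hB hvs]
    have e1 : ∀ k ∈ s, B x * finProd B hB (insert v (s.erase k)) =
        finProd B hB (insert v ((insert x s).erase k)) := fun k hk => by
      have hkx : k ≠ x := fun h => hx (h ▸ hk)
      rw [← finProd_insert B hB (by simp [hvx.symm, hx]), Finset.erase_insert_of_ne hkx.symm,
        Finset.insert_comm]
    have e2 : ∀ k ∈ s, B v * finProd B hB (insert x (s.erase k)) =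
        finProd B hB (insert v ((insert x s).erase k)) := fun k hk => by
      have hkx : k ≠ x := fun h => hx (h ▸ hk)
      rw [← finProd_insert B hB (by simp [hvx, hvs]), Finset.erase_insert_of_ne hkx.symm]
    have e3 : ∀ k ∈ s, ∏ l ∈ (insert x s).erase k, F l k = F x k * ∏ l ∈ s.erase k, F l k :=
      fun k hk => by
      have hkx : k ≠ x := fun h => hx (h ▸ hk)
      rw [Finset.erase_insert_of_ne hkx.symm, Finset.prod_insert (by simp [hx])]
    have e1' : ∑ k ∈ s, (e k * (-G k v * ∏ l ∈ s.erase k, F l k)) •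
          (B x * finProd B hB (insert v (s.erase k))) *ᵥ Ω =
        ∑ k ∈ s, (e k * (-G k v * ∏ l ∈ s.erase k, F l k)) •
          finProd B hB (insert v ((insert x s).erase k)) *ᵥ Ω :=
      Finset.sum_congr rfl fun k hk => by rw [e1 k hk]
    have e2' : ∑ k ∈ s, (e k * (-G k x * ∏ l ∈ s.erase k, F l k)) •
          (B v * finProd B hB (insert x (s.erase k))) *ᵥ Ω =
        ∑ k ∈ s, (e k * (-G k x * ∏ l ∈ s.erase k, F l k)) •
          finProd B hB (insert v ((insert x s).erase k)) *ᵥ Ω :=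
      Finset.sum_congr rfl fun k hk => by rw [e2 k hk]
    have e3' : ∑ k ∈ s, (e k * (-G k v * ∏ l ∈ (insert x s).erase k, F l k)) •
          finProd B hB (insert v ((insert x s).erase k)) *ᵥ Ω =
        ∑ k ∈ s, (e k * (-G k v * (F x k * ∏ l ∈ s.erase k, F l k))) •
          finProd B hB (insert v ((insert x s).erase k)) *ᵥ Ω :=
      Finset.sum_congr rfl fun k hk => by rw [e3 k hk]
    rw [e1', e2', e3']
    -- The coefficient of the vector with `k` replaced by `v` is collected here: `A(v)` passed
    -- `B(x)` and was then exchanged with `k`, or it was exchanged with `x` and the resulting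
    -- operator at `x` with `k`.
    have e4 : ∑ k ∈ s, (e k * (-G k v * (F x k * ∏ l ∈ s.erase k, F l k))) •
          finProd B hB (insert v ((insert x s).erase k)) *ᵥ Ω =
        F x v • ∑ k ∈ s, (e k * (-G k v * ∏ l ∈ s.erase k, F l k)) •
          finProd B hB (insert v ((insert x s).erase k)) *ᵥ Ω -
        G x v • ∑ k ∈ s, (e k * (-G k x * ∏ l ∈ s.erase k, F l k)) •
          finProd B hB (insert v ((insert x s).erase k)) *ᵥ Ω := by
      rw [Finset.smul_sum, Finset.smul_sum, ← Finset.sum_sub_distrib]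
      refine Finset.sum_congr rfl fun k hk => ?_
      rw [smul_smul, smul_smul, ← sub_smul]
      congr 1
      have hkx : k ≠ x := fun h => hx (h ▸ hk)
      have hkv : k ≠ v := fun h => hvs (h ▸ hk)
      have := hid x k v (hd x (by simp) k (by simp [hk]) hkx.symm) hxv0
        (hd k (by simp [hk]) v (by simp) hkv)
      linear_combination (-e k * ∏ l ∈ s.erase k, F l k) * this
    rw [e4]
    module

end Action

namespace YBRep

variable {η : ℂ} (ρ : YBRep η)

/-- The off-shell Bethe vector `∏_{u ∈ s} B(u) Ω`. -/
def bethe (s : Finset ℂ) : ρ.ι → ℂ := finProd ρ.B ρ.comm_B s *ᵥ ρ.Ω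

theorem bethe_empty : ρ.bethe ∅ = ρ.Ω := by simp [bethe, finProd_empty]

theorem bethe_insert {u : ℂ} {s : Finset ℂ} (hu : u ∉ s) :
    ρ.bethe (insert u s) = ρ.B u *ᵥ ρ.bethe s := by
  rw [bethe, bethe, finProd_insert _ _ hu, Matrix.mulVec_mulVec]

/-- The representation with `B` and `C` exchanged by transposition. -/
def transpose : YBRep η where
  ι := ρ.ι
  A u := (ρ.A u)ᵀ
  B u := (ρ.C u)ᵀ
  C u := (ρ.B u)ᵀ
  D u := (ρ.D u)ᵀ
  a := ρ.a
  d := ρ.d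
  Ω := ρ.ω
  ω := ρ.Ω
  comm_B u v := by
    rw [commute_iff_eq, ← Matrix.transpose_mul, ← Matrix.transpose_mul, (ρ.comm_C v u).eq]
  comm_C u v := by
    rw [commute_iff_eq, ← Matrix.transpose_mul, ← Matrix.transpose_mul, (ρ.comm_B v u).eq]
  rel_AB u v := by
    have := congrArg Matrix.transpose (ρ.rel_CA u v)
    simpa [Matrix.transpose_mul] using this
  rel_DB u v := by
    have := congrArg Matrix.transpose (ρ.rel_CD u v)
    simpa [Matrix.transpose_mul] using this
  rel_CA u v := by
    have := congrArg Matrix.transpose (ρ.rel_AB u v)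
    simpa [Matrix.transpose_mul] using this
  rel_CD u v := by
    have := congrArg Matrix.transpose (ρ.rel_DB u v)
    simpa [Matrix.transpose_mul] using this
  -- Transposition reverses products and turns one form of the `C`, `B` relation into the other; for
  -- this reason the structure records both.
  rel_CB u v := by
    have := congrArg Matrix.transpose (ρ.rel_CB' v u)
    simp only [Matrix.transpose_smul, Matrix.transpose_sub, Matrix.transpose_mul] at this
    rw [sinh_sub_comm, neg_smul, this, ← smul_neg, neg_sub]
  rel_CB' u v := by
    have := congrArg Matrix.transpose (ρ.rel_CB v u)
    simp only [Matrix.transpose_smul, Matrix.transpose_sub, Matrix.transpose_mul] at this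
    rw [sinh_sub_comm, neg_smul, this, ← smul_neg, neg_sub]
  A_vac u := by rw [Matrix.mulVec_transpose, ρ.vac_A]
  D_vac u := by rw [Matrix.mulVec_transpose, ρ.vac_D]
  C_vac u := by rw [Matrix.mulVec_transpose, ρ.vac_B]
  vac_A u := by rw [Matrix.vecMul_transpose, ρ.A_vac]
  vac_D u := by rw [Matrix.vecMul_transpose, ρ.D_vac]
  vac_B u := by rw [Matrix.vecMul_transpose, ρ.C_vac]
  norm_vac := by rw [dotProduct_comm, ρ.norm_vac]

/-- The dual off-shell Bethe vector `ω ∏_{u ∈ t} C(u)`. -/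
def dual (t : Finset ℂ) : ρ.ι → ℂ := ρ.ω ᵥ* finProd ρ.C ρ.comm_C t

theorem dual_empty : ρ.dual ∅ = ρ.ω := by simp [dual, finProd_empty]

theorem dual_insert {u : ℂ} {t : Finset ℂ} (hu : u ∉ t) :
    ρ.dual (insert u t) = ρ.dual t ᵥ* ρ.C u := by
  rw [dual, dual, Matrix.vecMul_vecMul, finProd_insert' _ _ hu]

theorem transpose_bethe (t : Finset ℂ) : ρ.transpose.bethe t = ρ.dual t := by
  induction t using Finset.induction_on with
  | empty => rw [bethe_empty, dual_empty]; rfl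
  | insert x t hx ih =>
    rw [bethe_insert _ hx, dual_insert _ hx, ih]
    exact Matrix.mulVec_transpose _ _

theorem transpose_dual (t : Finset ℂ) : ρ.transpose.dual t = ρ.bethe t :=
  (ρ.transpose.transpose_bethe t).symm

/-- The off-shell scalar product `ω ∏_{t} C(p) ∏_{s} B(q) Ω`. -/
def scal (t s : Finset ℂ) : ℂ := ρ.dual t ⬝ᵥ ρ.bethe s

theorem scal_transpose (t s : Finset ℂ) : ρ.transpose.scal t s = ρ.scal s t := by
  rw [scal, scal, transpose_dual, transpose_bethe]
  exact dotProduct_comm (ρ.bethe t) (ρ.dual s)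

theorem smul_cancel {m : Type} {x y z : Matrix m m ℂ} {α β γ : ℂ} (hα : α ≠ 0)
    (h : α • x = β • y - γ • z) : x = (β / α) • y - (γ / α) • z := by
  have := congrArg (fun w => α⁻¹ • w) h
  simp only [smul_sub, smul_smul, inv_mul_cancel₀ hα, one_smul] at this
  rw [this, div_eq_inv_mul, div_eq_inv_mul]

/-- The general action `diag_action` with `F = f`, `G = g`; oddness of `sinh` turns `-g(k, v)` into
`g(v, k)`. For `D` the exchange relation is used with its two arguments interchanged, so `f` and `g`
appear with swapped arguments. -/
theorem A_bethe {s : Finset ℂ} {v : ℂ} (hv : v ∉ s) (hd : Distinct (insert v s)) :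
    ρ.A v *ᵥ ρ.bethe s = (ρ.a v * ∏ l ∈ s, f η l v) • ρ.bethe s +
      ∑ k ∈ s, (ρ.a k * (g η v k * ∏ l ∈ s.erase k, f η l k)) •
        ρ.bethe (insert v (s.erase k)) := by
  have := diag_action ρ.B ρ.A ρ.comm_B ρ.Ω ρ.a ρ.A_vac (f η) (g η)
    (fun u v h => smul_cancel h (ρ.rel_AB u v)) (fun x k v h1 h2 h3 => g_mul_f_sub h1 h2 h3)
    s v hv hd
  rw [bethe, this]
  congr 1
  refine Finset.sum_congr rfl fun k _ => ?_
  rw [bethe]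
  congr 3
  rw [g, g, sinh_sub_comm, div_neg, neg_neg]

theorem D_bethe {s : Finset ℂ} {v : ℂ} (hv : v ∉ s) (hd : Distinct (insert v s)) :
    ρ.D v *ᵥ ρ.bethe s = (ρ.d v * ∏ l ∈ s, f η v l) • ρ.bethe s +
      ∑ k ∈ s, (ρ.d k * (g η k v * ∏ l ∈ s.erase k, f η k l)) •
        ρ.bethe (insert v (s.erase k)) := by
  have := diag_action ρ.B ρ.D ρ.comm_B ρ.Ω ρ.d ρ.D_vac (fun x y => f η y x) (fun x y => g η y x)
    (fun u v h => smul_cancel (by rw [sinh_sub_comm]; exact neg_ne_zero.2 h) (ρ.rel_DB v u))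
    (fun x k v h1 h2 h3 => g_mul_f_sub' h1 h2 h3)
    s v hv hd
  rw [bethe, this]
  congr 1
  refine Finset.sum_congr rfl fun k _ => ?_
  rw [bethe]
  congr 3
  rw [g, g, sinh_sub_comm, div_neg, neg_neg]

theorem C_mul_B {u v : ℂ} (h : Complex.sinh (u - v) ≠ 0) :
    ρ.C u * ρ.B v = ρ.B v * ρ.C u + g η u v • (ρ.A v * ρ.D u - ρ.A u * ρ.D v) := by
  have := congrArg (fun w => (Complex.sinh (u - v))⁻¹ • w) (ρ.rel_CB u v)
  simp only [smul_smul, inv_mul_cancel₀ h, one_smul] at this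
  rw [g, div_eq_inv_mul, ← this]
  abel

/-- The action of `C` on an off-shell Bethe vector all of whose parameters are zeros of `d`. -/
theorem C_bethe_of_d_eq_zero {s : Finset ℂ} {v : ℂ} (hv : v ∉ s) (hd : Distinct (insert v s))
    (h0 : ∀ x ∈ s, ρ.d x = 0) :
    ρ.C v *ᵥ ρ.bethe s = ∑ k ∈ s,
      (ρ.d v * ρ.a k * (g η v k * ∏ l ∈ s.erase k, f η v l * f η l k)) • ρ.bethe (s.erase k) := by
  induction s using Finset.induction_on with
  | empty => simp [bethe_empty, ρ.C_vac]
  | insert x s hx ih =>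
    have hvx : v ≠ x := fun h => hv (h ▸ Finset.mem_insert_self _ _)
    have hvs : v ∉ s := fun h => hv (Finset.mem_insert_of_mem h)
    have hxv0 : Complex.sinh (v - x) ≠ 0 := hd v (by simp) x (by simp) hvx
    have hd1 := hd.mono (Finset.insert_subset_insert v (Finset.subset_insert x s))
    have hd2 := hd.mono (Finset.subset_insert v (insert x s))
    have h0' : ∀ y ∈ s, ρ.d y = 0 := fun y hy => h0 y (Finset.mem_insert_of_mem hy)
    -- Every exchange term of `D` carries a factor `d` at a point of `s`, so only the diagonal term
    -- survives; for `D x` this one vanishes as well.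
    have hDv : ρ.D v *ᵥ ρ.bethe s = (ρ.d v * ∏ l ∈ s, f η v l) • ρ.bethe s := by
      rw [ρ.D_bethe hvs hd1, Finset.sum_eq_zero, add_zero]
      intro k hk
      rw [h0' k hk, zero_mul, zero_smul]
    have hDx : ρ.D x *ᵥ ρ.bethe s = 0 := by
      rw [ρ.D_bethe hx hd2, Finset.sum_eq_zero, add_zero, h0 x (by simp), zero_mul, zero_smul]
      intro k hk
      rw [h0' k hk, zero_mul, zero_smul]
    rw [ρ.bethe_insert hx, Matrix.mulVec_mulVec, ρ.C_mul_B hxv0, Matrix.add_mulVec,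
      ← Matrix.mulVec_mulVec, ih hvs hd1 h0', Matrix.smul_mulVec, Matrix.sub_mulVec,
      ← Matrix.mulVec_mulVec, ← Matrix.mulVec_mulVec, hDx, hDv, Matrix.mulVec_zero, sub_zero,
      Matrix.mulVec_smul, ρ.A_bethe hx hd2, Finset.sum_insert hx, Finset.erase_insert hx,
      Matrix.mulVec_sum, smul_add, smul_add, ← add_assoc, add_comm (∑ k ∈ s, _), add_assoc]
    congr 1
    · rw [smul_smul, smul_smul, Finset.prod_mul_distrib]
      congr 1
      ring
    rw [Finset.smul_sum, Finset.smul_sum, ← Finset.sum_add_distrib]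
    refine Finset.sum_congr rfl fun k hk => ?_
    have hkx : k ≠ x := fun h => hx (h ▸ hk)
    have hkv : v ≠ k := fun h => hvs (h ▸ hk)
    rw [Matrix.mulVec_smul, ← ρ.bethe_insert (by simp [hx]), Finset.erase_insert_of_ne hkx.symm,
      smul_smul, smul_smul, ← add_smul, Finset.prod_insert (by simp [hx]),
      ← Finset.mul_prod_erase s (fun l => f η v l) hk]
    congr 1
    have h1 := g_add_g_mul (η := η) (hd x (by simp) k (by simp [hk]) hkx.symm) hxv0
      (hd v (by simp) k (by simp [hk]) hkv)
    rw [Finset.prod_mul_distrib]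
    linear_combination (ρ.d v * ρ.a k * (∏ l ∈ s.erase k, f η v l) *
      ∏ l ∈ s.erase k, f η l k) * h1

end YBRep

/-! ### The exchange relation `R₁₂ T₁ T₂ = T₂ T₁ R₁₂` -/

section RTT

variable {𝒜 ℬ : Type*} [Ring 𝒜]

/-- `T ⊗ 1`. -/
def tensorOne (T : Matrix Bool Bool 𝒜) : Matrix (Bool × Bool) (Bool × Bool) 𝒜 :=
  Matrix.blockDiagonal fun _ => T

/-- `1 ⊗ T`. -/
def oneTensor (T : Matrix Bool Bool 𝒜) : Matrix (Bool × Bool) (Bool × Bool) 𝒜 :=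
  (tensorOne T).submatrix Prod.swap Prod.swap

theorem tensorOne_mul (S T : Matrix Bool Bool 𝒜) :
    tensorOne (S * T) = tensorOne S * tensorOne T :=
  Matrix.blockDiagonal_mul _ _

theorem oneTensor_mul (S T : Matrix Bool Bool 𝒜) :
    oneTensor (S * T) = oneTensor S * oneTensor T := by
  rw [oneTensor, tensorOne_mul]
  exact Matrix.submatrix_mul _ _ _ Prod.swap _ Prod.swap_bijective

theorem tensorOne_mul_oneTensor_apply (S T : Matrix Bool Bool 𝒜) (i j k l : Bool) :
    (tensorOne S * oneTensor T) (i, j) (k, l) = S i k * T j l := by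
  simp [Matrix.mul_apply, Fintype.sum_prod_type, tensorOne, oneTensor, Matrix.blockDiagonal_apply]

theorem oneTensor_mul_tensorOne_apply (S T : Matrix Bool Bool 𝒜) (i j k l : Bool) :
    (oneTensor T * tensorOne S) (i, j) (k, l) = T j l * S i k := by
  simp [Matrix.mul_apply, Fintype.sum_prod_type, tensorOne, oneTensor, Matrix.blockDiagonal_apply]

theorem tensorOne_comm_oneTensor {S T : Matrix Bool Bool 𝒜}
    (h : ∀ i j k l, Commute (S i j) (T k l)) :
    tensorOne S * oneTensor T = oneTensor T * tensorOne S := by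
  ext ⟨i, j⟩ ⟨k, l⟩ : 2
  rw [tensorOne_mul_oneTensor_apply, oneTensor_mul_tensorOne_apply, (h _ _ _ _).eq]

variable [Algebra ℂ 𝒜] [Ring ℬ] [Algebra ℂ ℬ]

/-- The six-vertex `R`-matrix. -/
def sixVertexR (η w : ℂ) : Matrix (Bool × Bool) (Bool × Bool) ℂ :=
  Matrix.of fun i k =>
    if i = k then (if i.1 = i.2 then Complex.sinh (w + η) else Complex.sinh w)
    else if i = k.swap then Complex.sinh η else 0

/-- The exchange relation for a monodromy matrix. -/
def RTT (η : ℂ) (T : ℂ → Matrix Bool Bool 𝒜) : Prop :=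
  ∀ u v, (sixVertexR η (u - v)).map (algebraMap ℂ 𝒜) * (tensorOne (T u) * oneTensor (T v)) =
    oneTensor (T v) * tensorOne (T u) * (sixVertexR η (u - v)).map (algebraMap ℂ 𝒜)

/-- The comultiplication of the Yang–Baxter algebra: since entries of `S` and `T` commute, the inner
factors can be interchanged, and `R` then passes the `S` pair and the `T` pair separately. -/
theorem RTT.mul {η : ℂ} {S T : ℂ → Matrix Bool Bool 𝒜} (hS : RTT η S) (hT : RTT η T)
    (h : ∀ u v i j k l, Commute (S u i j) (T v k l)) : RTT η fun u => S u * T u := by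
  intro u v
  set R := (sixVertexR η (u - v)).map (algebraMap ℂ 𝒜)
  have h1 := tensorOne_comm_oneTensor (S := T u) (T := S v) fun i j k l => (h v u k l i j).symm
  have h2 := tensorOne_comm_oneTensor (S := S u) (T := T v) fun i j k l => h u v i j k l
  calc R * (tensorOne (S u * T u) * oneTensor (S v * T v))
      = R * (tensorOne (S u) * (tensorOne (T u) * oneTensor (S v)) * oneTensor (T v)) := by
        rw [tensorOne_mul, oneTensor_mul]; simp only [Matrix.mul_assoc]
    _ = R * (tensorOne (S u) * oneTensor (S v)) * (tensorOne (T u) * oneTensor (T v)) := by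
        rw [h1]; simp only [Matrix.mul_assoc]
    _ = oneTensor (S v) * tensorOne (S u) * (R * (tensorOne (T u) * oneTensor (T v))) := by
        rw [hS u v]; simp only [Matrix.mul_assoc]; rfl
    _ = oneTensor (S v) * (tensorOne (S u) * oneTensor (T v)) * tensorOne (T u) * R := by
        rw [hT u v]; simp only [Matrix.mul_assoc]; rfl
    _ = oneTensor (S v * T v) * tensorOne (S u * T u) * R := by
        rw [h2, tensorOne_mul, oneTensor_mul]; simp only [Matrix.mul_assoc]

theorem RTT.map {η : ℂ} {T : ℂ → Matrix Bool Bool 𝒜} (hT : RTT η T) (φ : 𝒜 →ₐ[ℂ] ℬ) :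
    RTT η fun u => (T u).map φ := by
  intro u v
  have h1 : ∀ X : Matrix Bool Bool 𝒜, tensorOne (X.map φ) = (tensorOne X).map φ := fun X => by
    ext ⟨i, j⟩ ⟨k, l⟩
    simp only [tensorOne, Matrix.blockDiagonal_apply, Matrix.map_apply]
    split_ifs <;> simp
  have h2 : ∀ X : Matrix Bool Bool 𝒜, oneTensor (X.map φ) = (oneTensor X).map φ := fun X => by
    rw [oneTensor, h1]; rfl
  have h3 : (sixVertexR η (u - v)).map (algebraMap ℂ ℬ) =
      ((sixVertexR η (u - v)).map (algebraMap ℂ 𝒜)).map φ := by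
    ext i j; simp
  have := congrArg (fun X => X.map φ) (hT u v)
  simp only [Matrix.map_mul] at this
  rw [h1, h2, h3, this]

theorem RTT.one {η : ℂ} : RTT η fun _ => (1 : Matrix Bool Bool 𝒜) := by
  intro u v
  have h1 : tensorOne (1 : Matrix Bool Bool 𝒜) = 1 := Matrix.blockDiagonal_one
  have h2 : oneTensor (1 : Matrix Bool Bool 𝒜) = 1 := by
    rw [oneTensor, h1]; exact Matrix.submatrix_one _ Prod.swap_injective
  rw [h1, h2]; simp

section Relations

variable {η : ℂ} {T : ℂ → Matrix Bool Bool 𝒜}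

theorem RTT.entry (hT : RTT η T) (u v : ℂ) (i j k l : Bool) :
    ∑ p, ∑ q, sixVertexR η (u - v) (i, j) (p, q) • (T u p k * T v q l) =
      ∑ p, ∑ q, sixVertexR η (u - v) (p, q) (k, l) • (T v j q * T u i p) := by
  have := congrFun (congrFun (hT u v) (i, j)) (k, l)
  rw [Matrix.mul_apply, Matrix.mul_apply, Fintype.sum_prod_type, Fintype.sum_prod_type] at this
  simpa only [tensorOne_mul_oneTensor_apply, oneTensor_mul_tensorOne_apply, Matrix.map_apply,
    ← Algebra.commutes, ← Algebra.smul_def] using this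

theorem RTT.BB (hT : RTT η T) (u v : ℂ) : Complex.sinh (u - v + η) • (T u false true * T v false true) =
    Complex.sinh (u - v + η) • (T v false true * T u false true) := by
  simpa [sixVertexR] using hT.entry u v false false true true

theorem RTT.CC (hT : RTT η T) (u v : ℂ) : Complex.sinh (u - v + η) • (T u true false * T v true false) =
    Complex.sinh (u - v + η) • (T v true false * T u true false) := by
  simpa [sixVertexR] using hT.entry u v true true false false

theorem RTT.AB (hT : RTT η T) (u v : ℂ) : Complex.sinh (u - v) • (T v false false * T u false true) =
    Complex.sinh (u - v + η) • (T u false true * T v false false) -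
      Complex.sinh η • (T v false true * T u false false) := by
  have := hT.entry u v false false true false
  simp [sixVertexR] at this
  rw [this]; abel

theorem RTT.DB (hT : RTT η T) (u v : ℂ) : Complex.sinh (u - v) • (T u true true * T v false true) =
    Complex.sinh (u - v + η) • (T v false true * T u true true) -
      Complex.sinh η • (T u false true * T v true true) := by
  have := hT.entry u v true false true true
  simp [sixVertexR] at this
  rw [← this]; abel

theorem RTT.CA (hT : RTT η T) (u v : ℂ) : Complex.sinh (u - v) • (T u true false * T v false false) =
    Complex.sinh (u - v + η) • (T v false false * T u true false) -
      Complex.sinh η • (T u false false * T v true false) := by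
  have := hT.entry u v true false false false
  simp [sixVertexR] at this
  rw [← this]; abel

theorem RTT.CD (hT : RTT η T) (u v : ℂ) : Complex.sinh (u - v) • (T v true false * T u true true) =
    Complex.sinh (u - v + η) • (T u true true * T v true false) -
      Complex.sinh η • (T v true true * T u true false) := by
  have := hT.entry u v true true true false
  simp [sixVertexR] at this
  rw [this]; abel

theorem RTT.CB (hT : RTT η T) (u v : ℂ) :
    Complex.sinh (u - v) • (T u true false * T v false true - T v false true * T u true false) =
      Complex.sinh η • (T v false false * T u true true - T u false false * T v true true) := by
  have := hT.entry u v true false false true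
  simp [sixVertexR] at this
  linear_combination (norm := module) this

theorem RTT.CB' (hT : RTT η T) (u v : ℂ) :
    Complex.sinh (u - v) • (T u true false * T v false true - T v false true * T u true false) =
      Complex.sinh η • (T u true true * T v false false - T v true true * T u false false) := by
  -- The second form comes from the entry with opposite indices, read with `u` and `v` interchanged;
  -- `sinh (v - u)` supplies the sign.
  have := hT.entry v u false true true false
  simp [sixVertexR] at this
  rw [← neg_sub u v, Complex.sinh_neg] at this
  linear_combination (norm := module) this

end Relations

end RTT

/-! ### Operators acting on one site -/

/-- The operator acting as `X` on the mode `j` and as the identity on the other modes, without any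
sign. -/
def site {L : ℕ} (j : Fin L) (X : Matrix Bool Bool ℂ) : FockOp L :=
  Matrix.of fun n' n => if ∀ i, i ≠ j → n' i = n i then X (n' j) (n j) else 0

theorem site_mul_apply {L : ℕ} (j : Fin L) (X : Matrix Bool Bool ℂ) (Y : FockOp L)
    (n' n : Occ L) :
    (site j X * Y) n' n = ∑ b, X (n' j) b * Y (Function.update n' j b) n := by
  rw [Matrix.mul_apply]
  have hinj : Function.Injective fun b : Bool => (Function.update n' j b : Occ L) :=
    Function.update_injective n' j
  rw [← Finset.sum_subset (Finset.subset_univ (Finset.univ.image fun b => Function.update n' j b)),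
    Finset.sum_image fun x _ y _ h => hinj h]
  · refine Finset.sum_congr rfl fun b _ => ?_
    simp only [site, Matrix.of_apply, Function.update_self]
    rw [if_pos fun i hi => by rw [Function.update_of_ne hi]]
  · intro k _ hk
    simp only [site, Matrix.of_apply]
    rw [if_neg, zero_mul]
    intro h
    apply hk
    simp only [Finset.mem_image, Finset.mem_univ, true_and]
    refine ⟨k j, ?_⟩
    ext i
    by_cases hi : i = j
    · subst hi; simp
    · simp [Function.update_of_ne hi, h i hi]

theorem site_mul {L : ℕ} (j : Fin L) (X Y : Matrix Bool Bool ℂ) :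
    site j (X * Y) = site j X * site j Y := by
  ext n' n
  rw [site_mul_apply]
  simp only [site, Matrix.of_apply, Matrix.mul_apply]
  split_ifs with h
  · refine Finset.sum_congr rfl fun b _ => ?_
    rw [if_pos fun i hi => by rw [Function.update_of_ne hi]; exact h i hi]
    simp
  · symm
    refine Finset.sum_eq_zero fun b _ => ?_
    rw [if_neg, mul_zero]
    intro h'
    exact h fun i hi => by rw [← h' i hi, Function.update_of_ne hi]

theorem site_comm {L : ℕ} {i j : Fin L} (hij : i ≠ j) (X Y : Matrix Bool Bool ℂ) :
    Commute (site i X) (site j Y) := by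
  rw [commute_iff_eq]
  ext n' n
  rw [site_mul_apply, site_mul_apply]
  rw [Finset.sum_eq_single (n i), Finset.sum_eq_single (n j)]
  · simp only [site, Matrix.of_apply, Function.update_of_ne hij.symm, Function.update_of_ne hij]
    have : (∀ k, k ≠ j → Function.update n' i (n i) k = n k) ↔
        ∀ k, k ≠ i → Function.update n' j (n j) k = n k := by
      constructor
      · intro h k hk
        by_cases hkj : k = j
        · subst hkj; simp
        · rw [Function.update_of_ne hkj, ← h k hkj, Function.update_of_ne hk]
      · intro h k hk
        by_cases hki : k = i
        · subst hki; simp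
        · rw [Function.update_of_ne hki, ← h k hki, Function.update_of_ne hk]
    by_cases h : ∀ k, k ≠ j → Function.update n' i (n i) k = n k
    · rw [if_pos h, if_pos (this.1 h), mul_comm]
    · rw [if_neg h, if_neg fun h' => h (this.2 h'), mul_zero, mul_zero]
  · intro b _ hb
    simp only [site, Matrix.of_apply]
    rw [if_neg, mul_zero]
    intro h
    apply hb
    have := h j hij.symm
    simpa using this
  · simp
  · intro b _ hb
    simp only [site, Matrix.of_apply]
    rw [if_neg, mul_zero]
    intro h
    apply hb
    have := h i hij
    simpa using this
  · simp

/-- `site` as an algebra homomorphism. -/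
def siteHom {L : ℕ} (j : Fin L) : Matrix Bool Bool ℂ →ₐ[ℂ] FockOp L where
  toFun := site j
  map_one' := by
    ext n' n
    simp only [site, Matrix.of_apply, Matrix.one_apply]
    by_cases h : n' = n
    · subst h; simp
    · rw [if_neg h]
      split_ifs with h1 h2
      · refine absurd (funext fun i => ?_) h
        by_cases hi : i = j
        · rw [hi, h2]
        · exact h1 i hi
      · rfl
      · rfl
  map_mul' := site_mul j
  map_zero' := by ext n' n; simp [site]
  map_add' X Y := by
    ext n' n
    simp only [site, Matrix.of_apply, Matrix.add_apply]
    split_ifs <;> simp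
  commutes' c := by
    ext n' n
    simp only [site, Matrix.of_apply, Matrix.algebraMap_matrix_apply]
    by_cases h : n' = n
    · subst h; simp
    · rw [if_neg h]
      split_ifs with h1 h2
      · refine absurd (funext fun i => ?_) h
        by_cases hi : i = j
        · rw [hi, h2]
        · exact h1 i hi
      · rfl
      · rfl

@[simp] theorem siteHom_apply {L : ℕ} (j : Fin L) (X : Matrix Bool Bool ℂ) :
    siteHom j X = site j X := rfl

/-- The vacuum vector. -/
def vac (L : ℕ) : Occ L → ℂ := Pi.single (fun _ => false) 1

theorem site_mulVec_vac {L : ℕ} (j : Fin L) (X : Matrix Bool Bool ℂ) (hX : X true false = 0) :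
    site j X *ᵥ vac L = X false false • vac L := by
  ext n
  rw [vac, Matrix.mulVec_single_one, Matrix.col_apply, Pi.smul_apply, site, Matrix.of_apply]
  by_cases h : n = fun _ => false
  · subst h; simp
  · rw [Pi.single_eq_of_ne h, smul_zero]
    split_ifs with h1
    · cases hn : n j
      · refine absurd (funext fun i => ?_) h
        by_cases hi : i = j
        · rw [hi, hn]
        · exact h1 i hi
      · exact hX
    · rfl

theorem vac_vecMul_site {L : ℕ} (j : Fin L) (X : Matrix Bool Bool ℂ) (hX : X false true = 0) :
    vac L ᵥ* site j X = X false false • vac L := by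
  ext n
  rw [vac, Matrix.single_one_vecMul, Matrix.row_apply, Pi.smul_apply, site, Matrix.of_apply]
  by_cases h : n = fun _ => false
  · subst h; simp
  · rw [Pi.single_eq_of_ne h, smul_zero]
    split_ifs with h1
    · cases hn : n j
      · refine absurd (funext fun i => ?_) h
        by_cases hi : i = j
        · rw [hi, hn]
        · exact (h1 i hi).symm
      · exact hX
    · rfl

/-! ### The inhomogeneous six-vertex chain -/

/-- The polynomial `L`-matrix of the six-vertex model, a matrix in the auxiliary space with entries
acting on the quantum space. -/
def sixVertexL (η w : ℂ) : Matrix Bool Bool (Matrix Bool Bool ℂ) :=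
  Matrix.of fun i j => Matrix.of fun k l => sixVertexR η w (i, k) (j, l)

theorem sinh_exchange (x y z : ℂ) : Complex.sinh x * Complex.sinh (y + z) =
    Complex.sinh (x - y) * Complex.sinh z + Complex.sinh y * Complex.sinh (x + z) := by
  simp only [Complex.sinh_add, Complex.sinh_sub]
  ring

-- The Yang–Baxter equation for the six-vertex weights. Entry by entry it is either trivial or
-- `±sinh η` times one of the three quadratic identities `k1`, `k2`, `k3`, all consequences of the
-- addition theorem.
set_option maxHeartbeats 1000000 in
theorem sixVertexL_RTT (η ξ : ℂ) : RTT η fun u => sixVertexL η (u - ξ) := by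
  intro u v
  beta_reduce
  have e : u - v = (u - ξ) - (v - ξ) := by ring
  rw [e]
  generalize u - ξ = x
  generalize v - ξ = y
  ext ⟨i, j⟩ ⟨k, l⟩ p q
  have hL : ((sixVertexR η (x - y)).map (algebraMap ℂ (Matrix Bool Bool ℂ)) *
      (tensorOne (sixVertexL η x) * oneTensor (sixVertexL η y))) (i, j) (k, l) p q =
      ∑ a, ∑ b, ∑ r, sixVertexR η (x - y) (i, j) (a, b) *
        (sixVertexR η x (a, p) (k, r) * sixVertexR η y (b, r) (l, q)) := by
    rw [Matrix.mul_apply, Fintype.sum_prod_type]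
    simp only [tensorOne_mul_oneTensor_apply, Matrix.map_apply, ← Algebra.smul_def]
    simp only [Matrix.sum_apply, Matrix.smul_apply, Matrix.mul_apply, smul_eq_mul, Finset.mul_sum]
    rfl
  have hR : (oneTensor (sixVertexL η y) * tensorOne (sixVertexL η x) *
      (sixVertexR η (x - y)).map (algebraMap ℂ (Matrix Bool Bool ℂ))) (i, j) (k, l) p q =
      ∑ a, ∑ b, ∑ r, sixVertexR η (x - y) (a, b) (k, l) *
        (sixVertexR η y (j, p) (b, r) * sixVertexR η x (i, r) (a, q)) := by
    rw [Matrix.mul_apply, Fintype.sum_prod_type]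
    simp only [oneTensor_mul_tensorOne_apply, Matrix.map_apply, ← Algebra.commutes,
      ← Algebra.smul_def]
    simp only [Matrix.sum_apply, Matrix.smul_apply, Matrix.mul_apply, smul_eq_mul, Finset.mul_sum]
    rfl
  rw [hL, hR]
  clear hL hR
  have k1 : Complex.sinh (x - y + η) * Complex.sinh x =
      Complex.sinh η * Complex.sinh y + Complex.sinh (x - y) * Complex.sinh (x + η) := by
    have := sinh_exchange x (x - y) η
    rw [sub_sub_cancel] at this
    linear_combination this
  have k2 : Complex.sinh (x - y + η) * Complex.sinh (y + η) =
      Complex.sinh (x - y) * Complex.sinh y + Complex.sinh η * Complex.sinh (x + η) := by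
    rw [sinh_add_mul_sinh_add, sub_add_cancel]
  have k3 := sinh_exchange x y η
  cases i <;> cases j <;> cases k <;> cases l <;> cases p <;> cases q <;>
    simp [sixVertexR] <;>
    first
    | done
    | linear_combination Complex.sinh η * k1
    | linear_combination Complex.sinh η * k2
    | linear_combination Complex.sinh η * k3
    | linear_combination (-Complex.sinh η) * k1
    | linear_combination (-Complex.sinh η) * k2
    | linear_combination (-Complex.sinh η) * k3
    | (left; ring1)

/-- The polynomial `L`-operator at the site `m`. -/
def chainL {M : ℕ} (η : ℂ) (ξ : Fin M → ℂ) (u : ℂ) (m : Fin M) : Matrix Bool Bool (FockOp M) :=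
  (sixVertexL η (u - ξ m)).map (siteHom m)

/-- The polynomial monodromy matrix of the sites in the list `l`. -/
def chainT {M : ℕ} (η : ℂ) (ξ : Fin M → ℂ) (l : List (Fin M)) (u : ℂ) :
    Matrix Bool Bool (FockOp M) :=
  (l.map (chainL η ξ u)).prod

section Chain

variable {M : ℕ} (η : ℂ) (ξ : Fin M → ℂ)

theorem chainT_nil (u : ℂ) : chainT η ξ [] u = 1 := rfl

theorem chainT_cons (m : Fin M) (l : List (Fin M)) (u : ℂ) :
    chainT η ξ (m :: l) u = chainL η ξ u m * chainT η ξ l u := by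
  simp [chainT]

theorem site_comm_chainT {m : Fin M} (X : Matrix Bool Bool ℂ) {l : List (Fin M)} (hm : m ∉ l)
    (u : ℂ) (i j : Bool) : Commute (site m X) (chainT η ξ l u i j) := by
  induction l generalizing i j with
  | nil =>
    rw [chainT_nil, Matrix.one_apply]
    split_ifs
    · exact Commute.one_right _
    · exact Commute.zero_right _
  | cons k l ih =>
    rw [chainT_cons, Matrix.mul_apply]
    refine Commute.sum_right _ _ _ fun b _ => Commute.mul_right ?_ (ih (by simp_all) b j)
    exact site_comm (fun h => hm (by simp [h])) _ _

theorem chainT_RTT (l : List (Fin M)) (hl : l.Nodup) : RTT η (chainT η ξ l) := by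
  induction l with
  | nil => exact RTT.one
  | cons m l ih =>
    rw [List.nodup_cons] at hl
    have h1 : RTT η fun u => chainL η ξ u m := (sixVertexL_RTT η (ξ m)).map (siteHom m)
    have := h1.mul (ih hl.2) fun u v i j k n => site_comm_chainT η ξ _ hl.1 v k n
    simpa only [← chainT_cons] using this

theorem continuous_chainT (l : List (Fin M)) : Continuous (chainT η ξ l) := by
  induction l with
  | nil => exact continuous_const
  | cons m l ih =>
    simp only [funext fun u => chainT_cons η ξ m l u]
    refine Continuous.matrix_mul ?_ ih
    refine continuous_pi fun i => continuous_pi fun j => continuous_pi fun n' =>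
      continuous_pi fun n => ?_
    simp only [chainL, Matrix.map_apply, siteHom_apply, site, sixVertexL, Matrix.of_apply,
      sixVertexR]
    split_ifs <;> fun_prop

theorem continuous_chainT_entry (l : List (Fin M)) (i j : Bool) :
    Continuous fun u => chainT η ξ l u i j :=
  ((continuous_chainT η ξ l).matrix_elem i j)

-- The zeros of `sinh` are simple: if `sinh c = 0` then `cosh c ≠ 0`, so the derivative in `ε` is
-- nonzero. This is the tool for all later perturbations into general position.
open Filter Topology in
theorem eventually_sinh_ne_zero (c : ℂ) {r : ℂ} (hr : r ≠ 0) :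
    ∀ᶠ ε in 𝓝[≠] (0 : ℂ), Complex.sinh (c + r * ε) ≠ 0 := by
  by_cases hc : Complex.sinh c = 0
  · have hcosh : Complex.cosh c ≠ 0 := fun h => by
      have := Complex.cosh_sq_sub_sinh_sq c
      rw [h, hc] at this
      norm_num at this
    have hd : HasDerivAt (fun ε : ℂ => Complex.sinh (c + r * ε))
        (Complex.cosh (c + r * 0) * (r * 1)) 0 :=
      (((hasDerivAt_id (0 : ℂ)).const_mul r).const_add c).csinh
    exact hd.eventually_ne (by simpa using ⟨hcosh, hr⟩)
  · have hcont : ContinuousAt (fun ε : ℂ => Complex.sinh (c + r * ε)) 0 := by fun_prop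
    exact (hcont.eventually_ne (by simpa using hc)).filter_mono nhdsWithin_le_nhds

open Filter Topology in
/-- A continuous function that vanishes off the zeros of `sh(u + c)` vanishes identically. -/
theorem eq_zero_of_sinh_smul {V : Type*} [TopologicalSpace V] [T2Space V] [Zero V] {F : ℂ → V}
    (hF : Continuous F) (c : ℂ) (h : ∀ u, Complex.sinh (u + c) ≠ 0 → F u = 0) (u : ℂ) :
    F u = 0 := by
  have h1 : Tendsto (fun ε : ℂ => F (u + ε)) (𝓝[≠] 0) (𝓝 (F u)) := by
    have : ContinuousAt (fun ε : ℂ => F (u + ε)) 0 := by fun_prop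
    have h2 := this.tendsto
    rw [add_zero] at h2
    exact h2.mono_left nhdsWithin_le_nhds
  have h2 : ∀ᶠ ε in 𝓝[≠] (0 : ℂ), (0 : V) = F (u + ε) := by
    filter_upwards [eventually_sinh_ne_zero (u + c) one_ne_zero] with ε hε
    exact (h _ (by rw [show u + ε + c = u + c + 1 * ε by ring]; exact hε)).symm
  exact tendsto_nhds_unique (h1.congr' (h2.mono fun _ h => h.symm)) tendsto_const_nhds

/-- The exchange relation yields commutation only where `sinh (u - v + η) ≠ 0`; the remaining `u`
follow by continuity. -/
theorem chainT_commute {l : List (Fin M)} {i j : Bool}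
    (hrel : ∀ u v, Complex.sinh (u - v + η) • (chainT η ξ l u i j * chainT η ξ l v i j) =
      Complex.sinh (u - v + η) • (chainT η ξ l v i j * chainT η ξ l u i j)) (u v : ℂ) :
    Commute (chainT η ξ l u i j) (chainT η ξ l v i j) := by
  have hc := continuous_chainT_entry η ξ l i j
  have := eq_zero_of_sinh_smul (F := fun u => chainT η ξ l u i j * chainT η ξ l v i j -
      chainT η ξ l v i j * chainT η ξ l u i j)
    ((hc.matrix_mul continuous_const).sub (continuous_const.matrix_mul hc)) (-v + η)
    (fun u hu => by
      rw [← add_assoc, ← sub_eq_add_neg] at hu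
      have h := hrel u v
      rw [← sub_eq_zero, ← smul_sub] at h
      exact (smul_eq_zero.1 h).resolve_left hu) u
  exact sub_eq_zero.1 this

theorem chainL_apply (u : ℂ) (m : Fin M) (i j : Bool) :
    chainL η ξ u m i j = site m (sixVertexL η (u - ξ m) i j) := rfl

/-- Each local `L`-matrix is triangular on the vacuum, so the diagonal eigenvalues multiply. The
cross term in `D` is a product of the local `C` with the `B` of other sites; these commute, and the
local `C` then annihilates the vacuum. -/
theorem chainT_vac (l : List (Fin M)) (hl : l.Nodup) (u : ℂ) :
    chainT η ξ l u false false *ᵥ vac M =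
        (l.map fun m => Complex.sinh (u - ξ m + η)).prod • vac M ∧
      chainT η ξ l u true true *ᵥ vac M = (l.map fun m => Complex.sinh (u - ξ m)).prod • vac M ∧
      chainT η ξ l u true false *ᵥ vac M = 0 := by
  induction l with
  | nil => simp [chainT_nil]
  | cons m l ih =>
    rw [List.nodup_cons] at hl
    obtain ⟨hA, hD, hC⟩ := ih hl.2
    have hcomm : chainL η ξ u m true false * chainT η ξ l u false true =
        chainT η ξ l u false true * chainL η ξ u m true false :=
      (site_comm_chainT η ξ _ hl.1 u _ _).eq
    have hL0 : chainL η ξ u m true false *ᵥ vac M = 0 := by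
      rw [chainL_apply, site_mulVec_vac] <;> simp [sixVertexL, sixVertexR]
    simp only [chainT_cons, Matrix.mul_apply, Fintype.sum_bool, Matrix.add_mulVec]
    refine ⟨?_, ?_, ?_⟩
    · rw [← Matrix.mulVec_mulVec, ← Matrix.mulVec_mulVec, hC, hA, Matrix.mulVec_smul,
        chainL_apply, chainL_apply, site_mulVec_vac _ (sixVertexL η (u - ξ m) false false)
          (by simp [sixVertexL, sixVertexR])]
      simp [sixVertexL, sixVertexR, smul_smul, mul_comm]
    · rw [hcomm, ← Matrix.mulVec_mulVec, ← Matrix.mulVec_mulVec, hL0, hD, Matrix.mulVec_smul,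
        chainL_apply, site_mulVec_vac _ _ (by simp [sixVertexL, sixVertexR])]
      simp [sixVertexL, sixVertexR, smul_smul, mul_comm]
    · rw [← Matrix.mulVec_mulVec, ← Matrix.mulVec_mulVec, hC, hA, Matrix.mulVec_smul, hL0]
      simp

theorem vac_chainT (l : List (Fin M)) (hl : l.Nodup) (u : ℂ) :
    vac M ᵥ* chainT η ξ l u false false =
        (l.map fun m => Complex.sinh (u - ξ m + η)).prod • vac M ∧
      vac M ᵥ* chainT η ξ l u true true = (l.map fun m => Complex.sinh (u - ξ m)).prod • vac M ∧
      vac M ᵥ* chainT η ξ l u false true = 0 := by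
  induction l with
  | nil => simp [chainT_nil]
  | cons m l ih =>
    rw [List.nodup_cons] at hl
    obtain ⟨hA, hD, hB⟩ := ih hl.2
    have hcomm : chainL η ξ u m true false * chainT η ξ l u false true =
        chainT η ξ l u false true * chainL η ξ u m true false :=
      (site_comm_chainT η ξ _ hl.1 u _ _).eq
    have hL0 : vac M ᵥ* chainL η ξ u m false true = 0 := by
      rw [chainL_apply, vac_vecMul_site] <;> simp [sixVertexL, sixVertexR]
    have hL1 : vac M ᵥ* chainL η ξ u m false false = Complex.sinh (u - ξ m + η) • vac M := by
      rw [chainL_apply, vac_vecMul_site] <;> simp [sixVertexL, sixVertexR]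
    have hL2 : vac M ᵥ* chainL η ξ u m true true = Complex.sinh (u - ξ m) • vac M := by
      rw [chainL_apply, vac_vecMul_site] <;> simp [sixVertexL, sixVertexR]
    simp only [chainT_cons, Matrix.mul_apply, Fintype.sum_bool, Matrix.vecMul_add]
    refine ⟨?_, ?_, ?_⟩
    · rw [← Matrix.vecMul_vecMul, ← Matrix.vecMul_vecMul, hL0, hL1, Matrix.smul_vecMul, hA]
      simp [smul_smul]
    · rw [hcomm, ← Matrix.vecMul_vecMul, ← Matrix.vecMul_vecMul, hB, hL2, Matrix.smul_vecMul, hD]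
      simp [smul_smul]
    · rw [← Matrix.vecMul_vecMul, ← Matrix.vecMul_vecMul, hL0, hL1, Matrix.smul_vecMul, hB]
      simp

/-- The representation of the Yang--Baxter algebra on the inhomogeneous chain whose monodromy
matrix is the product over the list `l`. -/
def chainRep (l : List (Fin M)) (hl : l.Nodup) : YBRep η where
  ι := Occ M
  A u := chainT η ξ l u false false
  B u := chainT η ξ l u false true
  C u := chainT η ξ l u true false
  D u := chainT η ξ l u true true
  a u := (l.map fun m => Complex.sinh (u - ξ m + η)).prod
  d u := (l.map fun m => Complex.sinh (u - ξ m)).prod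
  Ω := vac M
  ω := vac M
  comm_B := chainT_commute η ξ (chainT_RTT η ξ l hl).BB
  comm_C := chainT_commute η ξ (chainT_RTT η ξ l hl).CC
  rel_AB := (chainT_RTT η ξ l hl).AB
  rel_DB := (chainT_RTT η ξ l hl).DB
  rel_CA := (chainT_RTT η ξ l hl).CA
  rel_CD := (chainT_RTT η ξ l hl).CD
  rel_CB := (chainT_RTT η ξ l hl).CB
  rel_CB' := (chainT_RTT η ξ l hl).CB'
  A_vac u := (chainT_vac η ξ l hl u).1
  D_vac u := (chainT_vac η ξ l hl u).2.1
  C_vac u := (chainT_vac η ξ l hl u).2.2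
  vac_A u := (vac_chainT η ξ l hl u).1
  vac_D u := (vac_chainT η ξ l hl u).2.1
  vac_B u := (vac_chainT η ξ l hl u).2.2
  norm_vac := by simp [vac]

end Chain

/-- The points of `s` and their shifts by `η` are distinct modulo `iπ`. -/
def Generic (η : ℂ) (s : Finset ℂ) : Prop :=
  ∀ x ∈ s, ∀ y ∈ s, x ≠ y → Complex.sinh (x - y) ≠ 0 ∧ Complex.sinh (x - y + η) ≠ 0

theorem Generic.distinct {η : ℂ} {s : Finset ℂ} (h : Generic η s) : Distinct s :=
  fun x hx y hy hxy => (h x hx y hy hxy).1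

theorem Generic.mono {η : ℂ} {s t : Finset ℂ} (ht : Generic η t) (h : s ⊆ t) : Generic η s :=
  fun x hx y hy => ht x (h hx) y (h hy)

/-- There are representations whose vacuum eigenvalue `a` vanishes on a prescribed part of a
generic set of points, and `d` on the rest. -/
theorem exists_rep {η : ℂ} (hη : Complex.sinh η ≠ 0) {s T : Finset ℂ} (hs : Generic η s)
    (hT : T ⊆ s) : ∃ ρ : YBRep η, (∀ p ∈ T, ρ.a p = 0 ∧ ρ.d p ≠ 0) ∧
      ∀ p ∈ s \ T, ρ.a p ≠ 0 ∧ ρ.d p = 0 := by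
  classical
  let x : Fin s.card → ℂ := fun i => (s.equivFin.symm i : ℂ)
  have hx : ∀ p ∈ s, ∃ i, x i = p := fun p hp => ⟨s.equivFin ⟨p, hp⟩, by simp [x]⟩
  have hxs : ∀ i, x i ∈ s := fun i => (s.equivFin.symm i).2
  -- One site per point of `s`. An inhomogeneity at `p + η` makes the factor `sinh (p - ξ + η)` of
  -- `a p` vanish, one at `p` makes the factor `sinh (p - ξ)` of `d p` vanish; genericity keeps the
  -- other required factors nonzero.
  let ξ : Fin s.card → ℂ := fun i => if x i ∈ T then x i + η else x i
  have hsub : ∀ y z : ℂ, Complex.sinh (y - z + η) ≠ 0 → Complex.sinh (z - (y + η)) ≠ 0 := by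
    intro y z h
    rw [show z - (y + η) = -(y - z + η) by ring, Complex.sinh_neg]
    exact neg_ne_zero.2 h
  refine ⟨chainRep η ξ (List.finRange _) (List.nodup_finRange _), fun p hp => ⟨?_, ?_⟩,
    fun p hp => ⟨?_, ?_⟩⟩
  · obtain ⟨i, hi⟩ := hx p (hT hp)
    refine List.prod_eq_zero (List.mem_map.2 ⟨i, List.mem_finRange i, ?_⟩)
    simp only [ξ, hi, if_pos hp]
    rw [show p - (p + η) + η = 0 by ring, Complex.sinh_zero]
  · refine List.prod_ne_zero fun h => ?_
    obtain ⟨i, -, hi⟩ := List.mem_map.1 h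
    by_cases hpi : p = x i
    · simp only [ξ, ← hpi, if_pos hp] at hi
      rw [show p - (p + η) = -η by ring, Complex.sinh_neg, neg_eq_zero] at hi
      exact hη hi
    · obtain ⟨h1, h2⟩ := hs p (hT hp) (x i) (hxs i) hpi
      obtain ⟨h3, h4⟩ := hs (x i) (hxs i) p (hT hp) (Ne.symm hpi)
      simp only [ξ] at hi
      split_ifs at hi
      · exact hsub _ _ h4 hi
      · exact h1 hi
  · rw [Finset.mem_sdiff] at hp
    refine List.prod_ne_zero fun h => ?_
    obtain ⟨i, -, hi⟩ := List.mem_map.1 h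
    by_cases hpi : p = x i
    · simp only [ξ, ← hpi, if_neg hp.2] at hi
      rw [sub_self, zero_add] at hi
      exact hη hi
    · obtain ⟨h1, h2⟩ := hs p hp.1 (x i) (hxs i) hpi
      simp only [ξ] at hi
      split_ifs at hi
      · rw [show p - (x i + η) + η = p - x i by ring] at hi
        exact h1 hi
      · exact h2 hi
  · rw [Finset.mem_sdiff] at hp
    obtain ⟨i, hi⟩ := hx p hp.1
    refine List.prod_eq_zero (List.mem_map.2 ⟨i, List.mem_finRange i, ?_⟩)
    simp only [ξ, hi, if_neg hp.2, sub_self, Complex.sinh_zero]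

/-! ### Scalar products as universal multilinear functions of the vacuum eigenvalues -/

/-- `∏_{p ∈ T} d(p) ∏_{p ∈ s \ T} a(p)`. -/
def weightMono (s T : Finset ℂ) (a d : ℂ → ℂ) : ℂ := (∏ p ∈ T, d p) * ∏ p ∈ s \ T, a p

/-- The functions of `a` and `d` that are linear in each of the pairs `(a p, d p)`, `p ∈ s`, and
independent of the values at other points. -/
def WeightPoly (s : Finset ℂ) : Submodule ℂ ((ℂ → ℂ) → (ℂ → ℂ) → ℂ) :=
  Submodule.span ℂ (Set.range fun T : s.powerset => weightMono s T)

theorem weightMono_mem {s T : Finset ℂ} (h : T ⊆ s) : weightMono s T ∈ WeightPoly s :=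
  Submodule.subset_span ⟨⟨T, Finset.mem_powerset.2 h⟩, rfl⟩

theorem one_mem_weightPoly : (fun _ _ => 1 : (ℂ → ℂ) → (ℂ → ℂ) → ℂ) ∈ WeightPoly ∅ := by
  have := weightMono_mem (le_refl (∅ : Finset ℂ))
  convert this using 3
  simp [weightMono]

theorem WeightPoly.mul_a {s : Finset ℂ} {F : (ℂ → ℂ) → (ℂ → ℂ) → ℂ} (hF : F ∈ WeightPoly s)
    {q : ℂ} (hq : q ∉ s) : (fun a d => a q * F a d) ∈ WeightPoly (insert q s) := by
  induction hF using Submodule.span_induction with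
  | mem F hF =>
    obtain ⟨⟨T, hT⟩, rfl⟩ := hF
    rw [Finset.mem_powerset] at hT
    convert weightMono_mem (hT.trans (Finset.subset_insert q s)) using 1
    funext a d
    simp only [weightMono]
    rw [Finset.insert_sdiff_of_notMem _ fun h => hq (hT h), Finset.prod_insert (by simp [hq])]
    ring
  | zero =>
    convert Submodule.zero_mem _ using 1
    funext a d
    simp
  | add F G _ _ hF hG =>
    convert Submodule.add_mem _ hF hG using 1
    funext a d
    simp [mul_add]
  | smul c F _ hF =>
    convert Submodule.smul_mem _ c hF using 1
    funext a d
    simp only [Pi.smul_apply, smul_eq_mul]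
    ring

theorem WeightPoly.mul_d {s : Finset ℂ} {F : (ℂ → ℂ) → (ℂ → ℂ) → ℂ} (hF : F ∈ WeightPoly s)
    {q : ℂ} (hq : q ∉ s) : (fun a d => d q * F a d) ∈ WeightPoly (insert q s) := by
  induction hF using Submodule.span_induction with
  | mem F hF =>
    obtain ⟨⟨T, hT⟩, rfl⟩ := hF
    rw [Finset.mem_powerset] at hT
    convert weightMono_mem (Finset.insert_subset_insert q hT) using 1
    funext a d
    simp only [weightMono]
    rw [Finset.insert_sdiff_insert, Finset.sdiff_insert_of_notMem hq,
      Finset.prod_insert fun h => hq (hT h)]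
    ring
  | zero =>
    convert Submodule.zero_mem _ using 1
    funext a d
    simp
  | add F G _ _ hF hG =>
    convert Submodule.add_mem _ hF hG using 1
    funext a d
    simp [mul_add]
  | smul c F _ hF =>
    convert Submodule.smul_mem _ c hF using 1
    funext a d
    simp only [Pi.smul_apply, smul_eq_mul]
    ring

theorem WeightPoly.sum_mem {s : Finset ℂ} {t : Finset ℂ} {F : ℂ → (ℂ → ℂ) → (ℂ → ℂ) → ℂ}
    (hF : ∀ q ∈ t, F q ∈ WeightPoly s) : (fun a d => ∑ q ∈ t, F q a d) ∈ WeightPoly s := by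
  convert Submodule.sum_mem _ hF using 1
  funext a d
  simp [Finset.sum_apply]

theorem WeightPoly.const_mul {s : Finset ℂ} {F : (ℂ → ℂ) → (ℂ → ℂ) → ℂ}
    (hF : F ∈ WeightPoly s) (c : ℂ) : (fun a d => c * F a d) ∈ WeightPoly s :=
  Submodule.smul_mem _ c hF

theorem WeightPoly.congr {s : Finset ℂ} {F : (ℂ → ℂ) → (ℂ → ℂ) → ℂ} (hF : F ∈ WeightPoly s)
    {a d a' d' : ℂ → ℂ} (ha : ∀ p ∈ s, a p = a' p) (hd : ∀ p ∈ s, d p = d' p) :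
    F a d = F a' d' := by
  induction hF using Submodule.span_induction with
  | mem F hF =>
    obtain ⟨⟨T, hT⟩, rfl⟩ := hF
    rw [Finset.mem_powerset] at hT
    simp only [weightMono]
    rw [Finset.prod_congr rfl fun p hp => hd p (hT hp),
      Finset.prod_congr rfl fun p hp => ha p (Finset.mem_sdiff.1 hp).1]
  | zero => rfl
  | add F G _ _ hF hG => simp [hF, hG]
  | smul c F _ hF => simp [hF]

/-- A multilinear function of the weights that vanishes on all representations vanishes. The weights
`d` may be restricted to vanish on a given set `z`. -/
theorem WeightPoly.eq_zero {η : ℂ} (hη : Complex.sinh η ≠ 0) {s z : Finset ℂ} (hs : Generic η s)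
    (hz : z ⊆ s) {F : (ℂ → ℂ) → (ℂ → ℂ) → ℂ} (hF : F ∈ WeightPoly s)
    (h : ∀ ρ : YBRep η, (∀ x ∈ z, ρ.d x = 0) → F ρ.a ρ.d = 0) (a d : ℂ → ℂ)
    (hd : ∀ x ∈ z, d x = 0) : F a d = 0 := by
  obtain ⟨c, rfl⟩ := (Submodule.mem_span_range_iff_exists_fun ℂ).1 hF
  simp only [Finset.sum_apply, Pi.smul_apply, smul_eq_mul] at h ⊢
  refine Finset.sum_eq_zero fun T _ => ?_
  obtain ⟨T, hT⟩ := T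
  have hTs := Finset.mem_powerset.1 hT
  by_cases hTz : Disjoint T z
  · have hc : c ⟨T, hT⟩ = 0 := by
      -- In this representation `a` vanishes on `T` and `d` on `s \ T`, so the monomial of `T` is
      -- the only nonzero one: any other `T'` omits a point of `T` or contains a point outside `T`.
      -- The coefficient of `T` is thus isolated.
      obtain ⟨ρ, h1, h2⟩ := exists_rep hη hs hTs
      have h3 := h ρ fun x hx => (h2 x (Finset.mem_sdiff.2
        ⟨hz hx, fun h' => Finset.disjoint_left.1 hTz h' hx⟩)).2
      rw [Finset.sum_eq_single ⟨T, hT⟩] at h3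
      · refine (mul_eq_zero.1 h3).resolve_right (mul_ne_zero ?_ ?_)
        · exact Finset.prod_ne_zero_iff.2 fun p hp => (h1 p hp).2
        · exact Finset.prod_ne_zero_iff.2 fun p hp => (h2 p hp).1
      · rintro ⟨T', hT'⟩ _ hne
        have hTs' := Finset.mem_powerset.1 hT'
        have hne' : T' ≠ T := fun h => hne (Subtype.ext h)
        by_cases hsub : T' ⊆ T
        · obtain ⟨p, hp, hp'⟩ := Finset.exists_of_ssubset (hsub.ssubset_of_ne hne')
          have : ∏ p ∈ s \ T', ρ.a p = 0 :=
            Finset.prod_eq_zero (Finset.mem_sdiff.2 ⟨hTs hp, hp'⟩) (h1 p hp).1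
          simp only [weightMono]
          rw [this, mul_zero, mul_zero]
        · obtain ⟨p, hp, hp'⟩ := Finset.not_subset.1 hsub
          have : ∏ p ∈ T', ρ.d p = 0 :=
            Finset.prod_eq_zero hp (h2 p (Finset.mem_sdiff.2 ⟨hTs' hp, hp'⟩)).2
          simp only [weightMono]
          rw [this, zero_mul, mul_zero]
      · simp
    rw [hc, zero_mul]
  -- The coefficient of such a `T` is not controlled by `h`, but its monomial contains a `d p` with
  -- `p ∈ z`.
  · obtain ⟨p, hp, hp'⟩ := Finset.not_disjoint_iff.1 hTz
    have : ∏ p ∈ T, d p = 0 := Finset.prod_eq_zero hp (hd p hp')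
    simp only [weightMono]
    rw [this, zero_mul, mul_zero]

/-- The coefficients in the action of `A(v)` on an off-shell Bethe vector. -/
def coeffA (η v : ℂ) (s : Finset ℂ) (q : ℂ) : ℂ :=
  if q = v then ∏ l ∈ s, f η l v else g η v q * ∏ l ∈ s.erase q, f η l q

/-- The coefficients in the action of `D(v)` on an off-shell Bethe vector. -/
def coeffD (η v : ℂ) (s : Finset ℂ) (q : ℂ) : ℂ :=
  if q = v then ∏ l ∈ s, f η v l else g η q v * ∏ l ∈ s.erase q, f η q l

/-! ### Operator actions with coefficients independent of the representation. -/

namespace YBRep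

variable {η : ℂ} (ρ : YBRep η)

/-- The diagonal and the exchange terms in one sum: one of the points of `insert v s` is removed and
its vacuum eigenvalue appears. This form shows linearity in the weights. -/
theorem A_bethe' {s : Finset ℂ} {v : ℂ} (hv : v ∉ s) (hd : Distinct (insert v s)) :
    ρ.A v *ᵥ ρ.bethe s =
      ∑ q ∈ insert v s, (ρ.a q * coeffA η v s q) • ρ.bethe ((insert v s).erase q) := by
  rw [ρ.A_bethe hv hd, Finset.sum_insert hv, Finset.erase_insert hv, coeffA, if_pos rfl]
  congr 1
  refine Finset.sum_congr rfl fun k hk => ?_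
  have hkv : k ≠ v := fun h => hv (h ▸ hk)
  rw [coeffA, if_neg hkv, Finset.erase_insert_of_ne hkv.symm]

theorem D_bethe' {s : Finset ℂ} {v : ℂ} (hv : v ∉ s) (hd : Distinct (insert v s)) :
    ρ.D v *ᵥ ρ.bethe s =
      ∑ q ∈ insert v s, (ρ.d q * coeffD η v s q) • ρ.bethe ((insert v s).erase q) := by
  rw [ρ.D_bethe hv hd, Finset.sum_insert hv, Finset.erase_insert hv, coeffD, if_pos rfl]
  congr 1
  refine Finset.sum_congr rfl fun k hk => ?_
  have hkv : k ≠ v := fun h => hv (h ▸ hk)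
  rw [coeffD, if_neg hkv, Finset.erase_insert_of_ne hkv.symm]

/-- The action of `X(x) Y(y)` on an off-shell Bethe vector for diagonal `X = A` and `Y = D`. -/
theorem A_mul_D_bethe {s : Finset ℂ} {x y : ℂ} (hx : x ∉ s) (hy : y ∉ s) (hxy : x ≠ y)
    (hd : Distinct (insert x (insert y s))) :
    (ρ.A x * ρ.D y) *ᵥ ρ.bethe s = ∑ p ∈ insert y s, ∑ q ∈ (insert x (insert y s)).erase p,
      ((coeffD η y s p * coeffA η x ((insert y s).erase p) q) * (ρ.d p * ρ.a q)) •
        ρ.bethe (((insert x (insert y s)).erase p).erase q) := by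
  rw [← Matrix.mulVec_mulVec, ρ.D_bethe' hy (hd.mono (Finset.subset_insert _ _)),
    Matrix.mulVec_sum]
  refine Finset.sum_congr rfl fun p hp => ?_
  have hxp : x ∉ insert y s := by simp [hx, hxy]
  have hpx : p ≠ x := fun h => hxp (h ▸ hp)
  rw [Matrix.mulVec_smul, ρ.A_bethe' (fun h => hxp (Finset.mem_of_mem_erase h))
    (hd.mono (Finset.insert_subset_insert _ (Finset.erase_subset _ _))), Finset.smul_sum,
    Finset.erase_insert_of_ne hpx.symm]
  refine Finset.sum_congr rfl fun q _ => ?_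
  rw [smul_smul]
  congr 1
  ring

theorem sum_extend {V : Type*} [AddCommMonoid V] (P Q : Finset ℂ) (h : P ⊆ Q) (F : ℂ → V) :
    ∑ p ∈ P, F p = ∑ p ∈ Q, if p ∈ P then F p else 0 := by
  rw [← Finset.sum_filter, Finset.filter_mem_eq_inter, Finset.inter_eq_right.2 h]

/-- The action of `C(v)` on an off-shell Bethe vector: every term contains one factor `d` and one
factor `a`, at the two points that are removed. -/
theorem C_bethe (s : Finset ℂ) (v : ℂ) (hv : v ∉ s) (hd : Distinct (insert v s)) :
    ∃ c : ℂ → ℂ → ℂ, ∀ ρ : YBRep η, ρ.C v *ᵥ ρ.bethe s =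
      ∑ p ∈ insert v s, ∑ q ∈ (insert v s).erase p,
        (c p q * (ρ.d p * ρ.a q)) • ρ.bethe (((insert v s).erase p).erase q) := by
  induction s using Finset.induction_on with
  | empty =>
    refine ⟨fun _ _ => 0, fun ρ => ?_⟩
    simp [bethe_empty, ρ.C_vac]
  | insert x s hx ih =>
    have hvx : v ≠ x := fun h => hv (h ▸ Finset.mem_insert_self _ _)
    have hvs : v ∉ s := fun h => hv (Finset.mem_insert_of_mem h)
    have hvx0 : Complex.sinh (v - x) ≠ 0 := hd v (by simp) x (by simp) hvx
    have hcm : insert v (insert x s) = insert x (insert v s) := Finset.insert_comm _ _ _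
    have hd' : Distinct (insert x (insert v s)) := hcm ▸ hd
    obtain ⟨c, hc⟩ := ih hvs (hd.mono (Finset.insert_subset_insert v (Finset.subset_insert x s)))
    have hxvs : x ∉ insert v s := by simp [hvx.symm, hx]
    -- The three summands come from `B C`, `A(x) D(v)` and `A(v) D(x)` in the relation for `C(v)
    -- B(x)`. The conditions extend each coefficient by zero to the common range of `(p, q)`;
    -- nothing refers to `ρ`.
    refine ⟨fun p q =>
      (if p ∈ insert v s then if q ∈ (insert v s).erase p then c p q else 0 else 0) +
      (g η v x * (if p ∈ insert v s then
        coeffD η v s p * coeffA η x ((insert v s).erase p) q else 0) -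
      g η v x * (if p ∈ insert x s then
        coeffD η x s p * coeffA η v ((insert x s).erase p) q else 0)), fun ρ => ?_⟩
    have e1 : (ρ.B x * ρ.C v) *ᵥ ρ.bethe s = ∑ p ∈ insert x (insert v s),
        ∑ q ∈ (insert x (insert v s)).erase p,
          ((if p ∈ insert v s then if q ∈ (insert v s).erase p then c p q else 0 else 0) *
            (ρ.d p * ρ.a q)) • ρ.bethe (((insert x (insert v s)).erase p).erase q) := by
      rw [← Matrix.mulVec_mulVec, hc, Matrix.mulVec_sum,
        sum_extend _ _ (Finset.subset_insert x (insert v s))]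
      refine Finset.sum_congr rfl fun p _ => ?_
      split_ifs with hp
      · have hpx : p ≠ x := fun h => hxvs (h ▸ hp)
        rw [Matrix.mulVec_sum, sum_extend _ ((insert x (insert v s)).erase p)
          (Finset.erase_subset_erase _ (Finset.subset_insert _ _))]
        refine Finset.sum_congr rfl fun q _ => ?_
        split_ifs with hq
        · have hqx : q ≠ x := fun h => hxvs (h ▸ Finset.mem_of_mem_erase hq)
          rw [Matrix.mulVec_smul, ← ρ.bethe_insert (by
            intro h; exact hxvs (Finset.mem_of_mem_erase (Finset.mem_of_mem_erase h))),
            Finset.erase_insert_of_ne hpx.symm, Finset.erase_insert_of_ne hqx.symm]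
        · rw [zero_mul, zero_smul]
      · simp
    have e2 : (ρ.A x * ρ.D v) *ᵥ ρ.bethe s = ∑ p ∈ insert x (insert v s),
        ∑ q ∈ (insert x (insert v s)).erase p,
          ((if p ∈ insert v s then
            coeffD η v s p * coeffA η x ((insert v s).erase p) q else 0) *
            (ρ.d p * ρ.a q)) • ρ.bethe (((insert x (insert v s)).erase p).erase q) := by
      rw [ρ.A_mul_D_bethe hx hvs hvx.symm hd',
        sum_extend _ _ (Finset.subset_insert x (insert v s))]
      refine Finset.sum_congr rfl fun p _ => ?_
      split_ifs with hp
      · rfl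
      · simp
    have e3 : (ρ.A v * ρ.D x) *ᵥ ρ.bethe s = ∑ p ∈ insert x (insert v s),
        ∑ q ∈ (insert x (insert v s)).erase p,
          ((if p ∈ insert x s then
            coeffD η x s p * coeffA η v ((insert x s).erase p) q else 0) *
            (ρ.d p * ρ.a q)) • ρ.bethe (((insert x (insert v s)).erase p).erase q) := by
      rw [ρ.A_mul_D_bethe hvs hx hvx hd, ← hcm,
        sum_extend _ _ (Finset.subset_insert v (insert x s))]
      refine Finset.sum_congr rfl fun p _ => ?_
      split_ifs with hp
      · rfl
      · simp
    rw [ρ.bethe_insert hx, Matrix.mulVec_mulVec, ρ.C_mul_B hvx0, Matrix.add_mulVec,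
      Matrix.smul_mulVec, Matrix.sub_mulVec, e1, e2, e3, hcm, smul_sub, Finset.smul_sum,
      Finset.smul_sum, ← Finset.sum_sub_distrib, ← Finset.sum_add_distrib]
    refine Finset.sum_congr rfl fun p _ => ?_
    rw [Finset.smul_sum, Finset.smul_sum, ← Finset.sum_sub_distrib, ← Finset.sum_add_distrib]
    refine Finset.sum_congr rfl fun q _ => ?_
    module

end YBRep

open YBRep

/-- Off-shell scalar products are universal multilinear functions of the vacuum eigenvalues. -/
theorem exists_universal_scal (η : ℂ) (t : Finset ℂ) : ∀ s : Finset ℂ, Disjoint t s →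
    Distinct (t ∪ s) → ∃ F ∈ WeightPoly (t ∪ s), ∀ ρ : YBRep η, ρ.scal t s = F ρ.a ρ.d := by
  induction t using Finset.induction_on with
  | empty =>
    intro s _ _
    rw [Finset.empty_union]
    rcases s.eq_empty_or_nonempty with rfl | ⟨x, hx⟩
    · refine ⟨fun _ _ => 1, one_mem_weightPoly, fun ρ => ?_⟩
      rw [YBRep.scal, dual_empty, bethe_empty, ρ.norm_vac]
    -- A remaining `B` acts to the left on the dual vacuum and gives zero.
    · refine ⟨0, Submodule.zero_mem _, fun ρ => ?_⟩
      rw [YBRep.scal, dual_empty, ← Finset.insert_erase hx,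
        ρ.bethe_insert (Finset.notMem_erase x s), Matrix.dotProduct_mulVec, ρ.vac_B,
        zero_dotProduct]
      rfl
  | insert v t hv ih =>
    intro s hts hd
    rw [Finset.disjoint_insert_left] at hts
    have hsub : insert v s ⊆ insert v t ∪ s := by
      intro x hx
      simp only [Finset.mem_insert, Finset.mem_union] at hx ⊢
      tauto
    obtain ⟨c, hc⟩ := C_bethe (η := η) s v hts.1 (hd.mono hsub)
    -- The removed points `p` and `q` do not occur in the smaller scalar product, so multiplying it
    -- by `d p` and `a q` keeps it linear in each pair of weights.
    have hrest : ∀ p ∈ insert v s, ∀ q ∈ (insert v s).erase p,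
        p ∉ insert q (t ∪ ((insert v s).erase p).erase q) ∧
        q ∉ t ∪ ((insert v s).erase p).erase q ∧
        insert p (insert q (t ∪ ((insert v s).erase p).erase q)) = insert v t ∪ s ∧
        Disjoint t (((insert v s).erase p).erase q) := by
      intro p hp q hq
      have hst := Finset.disjoint_right.1 hts.2
      have hqs := Finset.mem_of_mem_erase hq
      have hqp := Finset.ne_of_mem_erase hq
      have key : ∀ x ∈ insert v s, x ∉ t := by
        intro x hx
        rcases Finset.mem_insert.1 hx with rfl | hx
        · exact hv
        · exact hst hx
      refine ⟨?_, ?_, ?_, ?_⟩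
      · simp [hqp.symm, key p hp]
      · simp [key q hqs]
      · have h1 : insert p (insert q (t ∪ ((insert v s).erase p).erase q)) =
            t ∪ insert p (insert q (((insert v s).erase p).erase q)) := by
          rw [Finset.union_insert, Finset.union_insert]
        rw [h1, Finset.insert_erase hq, Finset.insert_erase hp, Finset.insert_union,
          Finset.union_insert]
      · exact Finset.disjoint_right.2 fun x hx =>
          key x (Finset.mem_of_mem_erase (Finset.mem_of_mem_erase hx))
    have hF : ∀ p q, ∃ F : (ℂ → ℂ) → (ℂ → ℂ) → ℂ, p ∈ insert v s → q ∈ (insert v s).erase p →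
        (fun a d => c p q * (d p * (a q * F a d))) ∈ WeightPoly (insert v t ∪ s) ∧
        ∀ ρ : YBRep η, ρ.scal t (((insert v s).erase p).erase q) = F ρ.a ρ.d := by
      intro p q
      by_cases hp : p ∈ insert v s
      swap
      · exact ⟨0, fun h => absurd h hp⟩
      by_cases hq : q ∈ (insert v s).erase p
      swap
      · exact ⟨0, fun _ h => absurd h hq⟩
      obtain ⟨h1, h2, h3, h4⟩ := hrest p hp q hq
      obtain ⟨F, hF, hFρ⟩ := ih _ h4 (hd.mono (by
        rw [← h3]
        exact (Finset.subset_insert _ _).trans (Finset.subset_insert _ _)))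
      refine ⟨F, fun _ _ => ⟨?_, hFρ⟩⟩
      have := WeightPoly.const_mul (WeightPoly.mul_d (WeightPoly.mul_a hF h2) h1) (c p q)
      rwa [h3] at this
    choose F hF using hF
    refine ⟨fun a d => ∑ p ∈ insert v s, ∑ q ∈ (insert v s).erase p,
      c p q * (d p * (a q * F p q a d)), ?_, fun ρ => ?_⟩
    · exact WeightPoly.sum_mem fun p hp => WeightPoly.sum_mem fun q hq => (hF p q hp hq).1
    · rw [YBRep.scal, ρ.dual_insert hv, ← Matrix.dotProduct_mulVec, hc, dotProduct_sum]
      refine Finset.sum_congr rfl fun p hp => ?_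
      rw [dotProduct_sum]
      refine Finset.sum_congr rfl fun q hq => ?_
      rw [dotProduct_smul, ← (hF p q hp hq).2 ρ, YBRep.scal, smul_eq_mul]
      ring

/-! ### The Slavnov determinant -/

/-- The trigonometric Vandermonde product `∏_{i < j} sh(u_i - u_j)`. -/
def sinhVandermonde {N : ℕ} (u : Fin N → ℂ) : ℂ :=
  ∏ i, ∏ j ∈ Finset.Ioi i, Complex.sinh (u i - u j)

theorem prod_Ioi_succAbove {n : ℕ} (F : Fin (n + 1) → Fin (n + 1) → ℂ) (k : Fin (n + 1)) :
    ∏ i, ∏ j ∈ Finset.Ioi i, F i j =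
      (∏ i, if k.succAbove i < k then F (k.succAbove i) k else F k (k.succAbove i)) *
        ∏ i, ∏ j ∈ Finset.Ioi i, F (k.succAbove i) (k.succAbove j) := by
  have h : ∀ {m : ℕ} (G : Fin m → Fin m → ℂ), ∏ i, ∏ j ∈ Finset.Ioi i, G i j =
      ∏ i, ∏ j, if i < j then G i j else 1 := by
    intro m G
    refine Finset.prod_congr rfl fun i _ => ?_
    rw [← Finset.prod_filter]
    congr 1
    ext j
    simp
  rw [h, h, Fin.prod_univ_succAbove _ k]
  simp only [Fin.prod_univ_succAbove _ k, lt_irrefl, if_false, one_mul,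
    Fin.succAbove_lt_succAbove_iff, Finset.prod_mul_distrib]
  rw [← mul_assoc, ← Finset.prod_mul_distrib]
  congr 1
  refine Finset.prod_congr rfl fun i _ => ?_
  rcases lt_or_gt_of_ne (Fin.succAbove_ne k i) with h | h
  · simp [h, h.not_gt]
  · simp [h, h.not_gt]

theorem prod_erase_eq_prod_succAbove {n : ℕ} (k : Fin (n + 1)) (F : Fin (n + 1) → ℂ) :
    ∏ l ∈ Finset.univ.erase k, F l = ∏ i, F (k.succAbove i) := by
  have : (Finset.univ.erase k) = Finset.univ.image k.succAbove := by
    rw [Fin.image_succAbove_univ]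
    ext; simp
  rw [this, Finset.prod_image fun _ _ _ _ h => Fin.succAbove_right_injective h]

theorem sinhVandermonde_succAbove {n : ℕ} (u : Fin (n + 1) → ℂ) (k : Fin (n + 1)) :
    sinhVandermonde u = (∏ i, if k.succAbove i < k then (1 : ℂ) else -1) *
      (∏ l ∈ Finset.univ.erase k, Complex.sinh (u l - u k)) *
        sinhVandermonde fun i => u (k.succAbove i) := by
  rw [sinhVandermonde, prod_Ioi_succAbove (fun i j => Complex.sinh (u i - u j)) k, prod_erase_eq_prod_succAbove,
    sinhVandermonde]
  congr 1
  rw [← Finset.prod_mul_distrib]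
  refine Finset.prod_congr rfl fun i _ => ?_
  split_ifs
  · rw [one_mul]
  · rw [sinh_sub_comm, neg_one_mul]

/-- Of the `n` indices other than `k`, exactly `k` lie below it; the first product counts the
others. -/
theorem prod_ite_succAbove_lt {n : ℕ} (k : Fin (n + 1)) :
    (∏ i, if k.succAbove i < k then (1 : ℂ) else -1) * (-1) ^ (k : ℕ) = (-1) ^ n := by
  have h : ((-1 : ℂ)) ^ (k : ℕ) = ∏ i, if k.succAbove i < k then (-1 : ℂ) else 1 := by
    rw [Finset.prod_ite, Finset.prod_const, Finset.prod_const_one, mul_one]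
    congr 1
    have : (Finset.univ.filter fun i => k.succAbove i < k).image k.succAbove =
        Finset.Iio k := by
      ext j
      simp only [Finset.mem_image, Finset.mem_filter, Finset.mem_univ, true_and, Finset.mem_Iio]
      constructor
      · rintro ⟨i, hi, rfl⟩
        exact hi
      · intro hj
        obtain ⟨i, rfl⟩ := Fin.exists_succAbove_eq hj.ne
        exact ⟨i, hj, rfl⟩
    rw [← Fin.card_Iio k, ← this, Finset.card_image_of_injective _ Fin.succAbove_right_injective]
  rw [h, ← Finset.prod_mul_distrib]
  have : ∀ i : Fin n, ((if k.succAbove i < k then (1 : ℂ) else -1) *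
      if k.succAbove i < k then (-1 : ℂ) else 1) = -1 := fun i => by split_ifs <;> simp
  simp [this]

theorem sinhVandermonde_update {N : ℕ} (u : Fin N → ℂ) (k : Fin N) (v : ℂ) :
    sinhVandermonde (Function.update u k v) *
        ∏ l ∈ Finset.univ.erase k, Complex.sinh (u l - u k) =
      sinhVandermonde u * ∏ l ∈ Finset.univ.erase k, Complex.sinh (u l - v) := by
  obtain _ | n := N
  · exact k.elim0
  rw [sinhVandermonde_succAbove u k, sinhVandermonde_succAbove (Function.update u k v) k]
  have h : ∀ l, l ≠ k → Function.update u k v l = u l := fun l hl =>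
    Function.update_of_ne hl _ _
  have h' : ∏ l ∈ Finset.univ.erase k,
      Complex.sinh (Function.update u k v l - Function.update u k v k) =
      ∏ l ∈ Finset.univ.erase k, Complex.sinh (u l - v) :=
    Finset.prod_congr rfl fun l hl => by
      rw [h l (Finset.ne_of_mem_erase hl), Function.update_self]
  rw [h']
  simp only [h _ (Fin.succAbove_ne _ _)]
  ring

theorem sinhVandermonde_comp_perm {N : ℕ} (u : Fin N → ℂ) (σ : Equiv.Perm (Fin N)) :
    sinhVandermonde (u ∘ σ) = (Equiv.Perm.sign σ : ℂ) * sinhVandermonde u := by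
  exact σ.prod_Ioi_comp_eq_sign_mul_prod (f := fun i j => Complex.sinh (u i - u j))
    fun i j => sinh_sub_comm _ _

theorem sinhVandermonde_ne_zero {N : ℕ} {u : Fin N → ℂ}
    (h : ∀ i j, i ≠ j → Complex.sinh (u i - u j) ≠ 0) : sinhVandermonde u ≠ 0 :=
  Finset.prod_ne_zero_iff.2 fun i _ => Finset.prod_ne_zero_iff.2 fun j hj =>
    h i j (Finset.mem_Ioi.1 hj).ne

/-- The Slavnov matrix. -/
def slavnovMatrix (η κ : ℂ) {N : ℕ} (a d : ℂ → ℂ) (μ u : Fin N → ℂ) : Matrix (Fin N) (Fin N) ℂ :=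
  Matrix.of fun j k => slavnovEntry η κ μ (u k) (a (u k)) (d (u k)) j

/-- The Slavnov formula for the scalar product of an on-shell and an off-shell Bethe vector. -/
def slavnov (η κ : ℂ) {N : ℕ} (a d : ℂ → ℂ) (μ u : Fin N → ℂ) : ℂ :=
  (∏ j, d (μ j)) * (slavnovMatrix η κ a d μ u).det /
    (sinhVandermonde u * ∏ j, ∏ k ∈ Finset.Ioi j, Complex.sinh (μ k - μ j))

/-- The determinant and the Vandermonde product acquire the same sign. The formula is therefore a
function of the set of the `u k`, as the scalar product is. -/
theorem slavnov_comp_perm (η κ : ℂ) {N : ℕ} (a d : ℂ → ℂ) (μ u : Fin N → ℂ)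
    (σ : Equiv.Perm (Fin N)) : slavnov η κ a d μ (u ∘ σ) = slavnov η κ a d μ u := by
  have h : slavnovMatrix η κ a d μ (u ∘ σ) = (slavnovMatrix η κ a d μ u).submatrix id σ := rfl
  rw [slavnov, slavnov, h, Matrix.det_permute', sinhVandermonde_comp_perm]
  have : ((Equiv.Perm.sign σ : ℤ) : ℂ) ≠ 0 := by
    rcases Int.units_eq_one_or (Equiv.Perm.sign σ) with h | h <;> simp [h]
  rw [mul_left_comm, mul_assoc, mul_div_mul_left _ _ this]

/-- Cramer's rule for a row vector. -/
theorem sum_mul_det_updateCol {N : ℕ} (M : Matrix (Fin N) (Fin N) ℂ) (γ h r : Fin N → ℂ)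
    (hr : γ ᵥ* M = r) : ∑ k, r k * (M.updateCol k h).det = (γ ⬝ᵥ h) * M.det := by
  have h1 : ∀ k, (M.updateCol k h).det = (M.adjugate *ᵥ h) k := by
    intro k
    rw [← Matrix.cramer_eq_adjugate_mulVec, Matrix.cramer_apply]
  calc ∑ k, r k * (M.updateCol k h).det = r ⬝ᵥ (M.adjugate *ᵥ h) := by
        simp only [h1, dotProduct]
    _ = (γ ⬝ᵥ h) * M.det := by
        rw [← hr, ← Matrix.dotProduct_mulVec, Matrix.mulVec_mulVec, Matrix.mul_adjugate,
          Matrix.smul_mulVec, Matrix.one_mulVec, dotProduct_smul, smul_eq_mul, mul_comm]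

/-- The Slavnov formula satisfies the relation expressing that the left vector is an eigenvector of
`A(v) + κ D(v)`. -/
theorem slavnov_relation {η κ : ℂ} (hη : Complex.sinh η ≠ 0) {N : ℕ} (a d : ℂ → ℂ)
    (μ u : Fin N → ℂ) (v : ℂ) (hμ : ∀ i j, i ≠ j → Complex.sinh (μ i - μ j) ≠ 0)
    (huu : ∀ i j, i ≠ j → Complex.sinh (u i - u j) ≠ 0)
    (hu : ∀ i j, Complex.sinh (μ i - u j) ≠ 0 ∧ Complex.sinh (μ i - u j + η) ≠ 0 ∧
      Complex.sinh (μ i - u j - η) ≠ 0)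
    (hv : ∀ i, Complex.sinh (μ i - v) ≠ 0 ∧ Complex.sinh (μ i - v + η) ≠ 0)
    (huv : ∀ i, Complex.sinh (u i - v) ≠ 0) (ha : a v = 1) (hd : d v = 0) :
    (∏ j, f η (μ j) v - ∏ l, f η (u l) v) * slavnov η κ a d μ u =
      ∑ k, (a (u k) * (g η v (u k) * ∏ l ∈ Finset.univ.erase k, f η (u l) (u k)) +
        κ * d (u k) * (g η (u k) v * ∏ l ∈ Finset.univ.erase k, f η (u k) (u l))) *
          slavnov η κ a d μ (Function.update u k v) := by
  set M := slavnovMatrix η κ a d μ u with hM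
  set h : Fin N → ℂ := fun j => slavnovEntry η κ μ v 1 0 j with hh
  set r : Fin N → ℂ := slavnovWeight μ u ᵥ* M with hr
  have hr' : ∀ k, r k = Complex.sinh η *
      (a (u k) * ∏ l ∈ Finset.univ.erase k, Complex.sinh (u l - u k + η)
        - κ * d (u k) * ∏ l ∈ Finset.univ.erase k, Complex.sinh (u l - u k - η)) := fun k =>
    sum_slavnovWeight_mul_entry η κ μ u hμ (fun i j => (hu i j).1) k (fun i => (hu i k).2.1)
      (fun i => (hu i k).2.2) _ _
  have hnew := sum_slavnovWeight_mul_entry_new η κ μ u v hη hμ (fun i => (hv i).1)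
    fun i => (hv i).2
  have hcr := sum_mul_det_updateCol M (slavnovWeight μ u) h r rfl
  -- As `a v = 1` and `d v = 0`, replacing `u k` by `v` replaces the column `k` by the vector `h`,
  -- independent of `k`. This is the form needed for Cramer's rule.
  have hup : ∀ k, slavnovMatrix η κ a d μ (Function.update u k v) = M.updateCol k h := by
    intro k
    ext i j
    by_cases hj : j = k
    · subst hj
      simp [slavnovMatrix, hh, ha, hd]
    · simp [slavnovMatrix, hM, hj]
  have hΔ : sinhVandermonde u ≠ 0 := sinhVandermonde_ne_zero huu
  have hP0 : ∏ l, Complex.sinh (u l - v) ≠ 0 := Finset.prod_ne_zero_iff.2 fun l _ => huv l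
  set X := ∏ j, ∏ k ∈ Finset.Ioi j, Complex.sinh (μ k - μ j) with hX
  -- The bracket is the `k`-th component of `γ ᵥ* M` up to normalization, and the ratio of the
  -- Vandermonde products supplies the missing denominators, so that the prefactor no longer depends
  -- on `k`.
  have hterm : ∀ k, (a (u k) * (g η v (u k) * ∏ l ∈ Finset.univ.erase k, f η (u l) (u k)) +
        κ * d (u k) * (g η (u k) v * ∏ l ∈ Finset.univ.erase k, f η (u k) (u l))) *
          slavnov η κ a d μ (Function.update u k v) =
      -((∏ j, d (μ j)) / ((∏ l, Complex.sinh (u l - v)) * (sinhVandermonde u * X))) *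
        (r k * (M.updateCol k h).det) := by
    intro k
    have hQ : ∏ l ∈ Finset.univ.erase k, Complex.sinh (u l - u k) ≠ 0 :=
      Finset.prod_ne_zero_iff.2 fun l hl => huu _ _ (Finset.ne_of_mem_erase hl)
    have hQ' : ∏ l ∈ Finset.univ.erase k, Complex.sinh (u l - v) ≠ 0 :=
      Finset.prod_ne_zero_iff.2 fun l _ => huv l
    have hflip : ∀ l, f η (u k) (u l) =
        Complex.sinh (u l - u k - η) / Complex.sinh (u l - u k) := by
      intro l
      rw [f, show u k - u l + η = -(u l - u k - η) by ring, sinh_sub_comm (u k),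
        Complex.sinh_neg, neg_div_neg_eq]
    have hΔ' := sinhVandermonde_update u k v
    have hΔ1 : sinhVandermonde (Function.update u k v) = sinhVandermonde u *
        (∏ l ∈ Finset.univ.erase k, Complex.sinh (u l - v)) /
          ∏ l ∈ Finset.univ.erase k, Complex.sinh (u l - u k) := by
      rw [eq_div_iff hQ, hΔ']
    rw [slavnov, hup, hΔ1, hr', ← Finset.mul_prod_erase Finset.univ
      (fun l => Complex.sinh (u l - v)) (Finset.mem_univ k)]
    simp only [hflip]
    simp only [f, g, Finset.prod_div_distrib]
    rw [sinh_sub_comm v (u k)]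
    have h1 := huv k
    rw [div_neg]
    field_simp
    ring
  simp only [hterm]
  rw [← Finset.mul_sum, hcr]
  simp only [dotProduct, hh]
  rw [hnew, slavnov]
  have hfu : ∏ l, f η (u l) v =
      (∏ l, Complex.sinh (u l - v + η)) / ∏ l, Complex.sinh (u l - v) := by
    simp only [f, Finset.prod_div_distrib]
  rw [hfu]
  field_simp
  ring

/-- The recursion for the Slavnov formula at points with vanishing `d`, where it is the domain wall
partition function. -/
theorem slavnov_recursion {η κ : ℂ} {n : ℕ} (a d : ℂ → ℂ) (μ : Fin n → ℂ)
    (v : ℂ) (u : Fin (n + 1) → ℂ)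
    (hμ : ∀ i j, i ≠ j → Complex.sinh ((Fin.cons v μ : Fin (n + 1) → ℂ) i -
      (Fin.cons v μ : Fin (n + 1) → ℂ) j) ≠ 0)
    (huu : ∀ i j, i ≠ j → Complex.sinh (u i - u j) ≠ 0)
    (hu : ∀ i j, Complex.sinh ((Fin.cons v μ : Fin (n + 1) → ℂ) i - u j) ≠ 0 ∧
      Complex.sinh ((Fin.cons v μ : Fin (n + 1) → ℂ) i - u j + η) ≠ 0)
    (hd : ∀ k, d (u k) = 0) :
    slavnov η κ a d (Fin.cons v μ : Fin (n + 1) → ℂ) u =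
      ∑ k, (d v * a (u k) * (g η v (u k) *
        ∏ l ∈ Finset.univ.erase k, f η v (u l) * f η (u l) (u k))) *
          slavnov η κ a d μ fun i => u (k.succAbove i) := by
  set ν : Fin (n + 1) → ℂ := Fin.cons v μ with hν
  set W : Matrix (Fin (n + 1)) (Fin (n + 1)) ℂ := Matrix.of fun j k => t η (ν j) (u k) with hW
  set c : Fin (n + 1) → ℂ := fun k => a (u k) * ∏ l, Complex.sinh (ν l - u k + η) with hc
  -- With `d = 0` a column factor splits off and the matrix with entries `t(ν_j, u_k)` of the domain
  -- wall partition function remains; the twist `κ` disappears.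
  have hdet : (slavnovMatrix η κ a d ν u).det = (∏ k, c k) * W.det := by
    rw [← Matrix.det_mul_row]
    congr 1
    ext j k
    have h1 := (hu j k).1
    have h2 := (hu j k).2
    simp only [slavnovMatrix, slavnovEntry, Matrix.of_apply, hd, hW, hc, t]
    rw [← Finset.mul_prod_erase Finset.univ (fun l => Complex.sinh (ν l - u k + η))
      (Finset.mem_univ j)]
    field_simp
    ring
  have hdetk : ∀ k : Fin (n + 1), (slavnovMatrix η κ a d μ fun i => u (k.succAbove i)).det =
      (∏ i, a (u (k.succAbove i)) * ∏ l, Complex.sinh (μ l - u (k.succAbove i) + η)) *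
        (W.submatrix Fin.succ k.succAbove).det := by
    intro k
    rw [← Matrix.det_mul_row]
    congr 1
    ext j i
    have h1 := (hu j.succ (k.succAbove i)).1
    have h2 := (hu j.succ (k.succAbove i)).2
    simp only [hν, Fin.cons_succ] at h1 h2
    simp only [slavnovMatrix, slavnovEntry, Matrix.of_apply, hd, hW, t, Matrix.submatrix_apply,
      hν, Fin.cons_succ]
    rw [← Finset.mul_prod_erase Finset.univ (fun l => Complex.sinh (μ l - u (k.succAbove i) + η))
      (Finset.mem_univ j)]
    field_simp
    ring
  set γ := slavnovWeight ν u with hγ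
  set σ : Fin (n + 1) → ℂ := fun k => Complex.sinh η *
    (∏ l ∈ Finset.univ.erase k, Complex.sinh (u l - u k + η)) /
      ∏ l, Complex.sinh (ν l - u k + η) with hσ
  have hrow : γ ᵥ* W = σ := by
    funext k
    have h0 : ∏ l, Complex.sinh (ν l - u k + η) ≠ 0 :=
      Finset.prod_ne_zero_iff.2 fun l _ => (hu l k).2
    have := sum_slavnovWeight_shift η ν u hμ (fun i j => (hu i j).1) k fun i => (hu i k).2
    simp only [hσ]
    rw [← this, Matrix.vecMul, dotProduct, Finset.mul_sum, Finset.sum_div]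
    refine Finset.sum_congr rfl fun j _ => ?_
    have h1 := (hu j k).1
    have h2 := (hu j k).2
    rw [← Finset.mul_prod_erase Finset.univ (fun l => Complex.sinh (ν l - u k + η))
      (Finset.mem_univ j)] at h0 ⊢
    have h3 := right_ne_zero_of_mul h0
    simp only [hW, Matrix.of_apply, t, hγ]
    field_simp
  -- Replacing row `0` by the combination `γ ᵥ* W` multiplies the determinant by `γ 0`. The minors
  -- of row `0` do not contain `v`, so the Laplace expansion removes `v` and one `u k`.
  have hlap : γ 0 * W.det =
      ∑ k : Fin (n + 1), (-1) ^ (k : ℕ) * σ k * (W.submatrix Fin.succ k.succAbove).det := by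
    have h1 : (W.updateRow 0 σ).det = γ 0 * W.det := by
      rw [← hrow, Matrix.vecMul_eq_sum, Matrix.det_updateRow_sum, smul_eq_mul]
    rw [← h1, Matrix.det_succ_row_zero]
    refine Finset.sum_congr rfl fun k _ => ?_
    rw [Matrix.updateRow_self, ← Fin.succAbove_zero, Matrix.submatrix_updateRow_succAbove]
  have hγ0 : γ 0 = (∏ l, Complex.sinh (v - u l)) / ∏ l, Complex.sinh (v - μ l) := by
    rw [hγ, slavnovWeight, prod_erase_eq_prod_succAbove]
    simp [hν]
  have hvu : ∀ l, Complex.sinh (v - u l) ≠ 0 := fun l => by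
    have := (hu 0 l).1
    simpa [hν] using this
  have hvη : ∀ l, Complex.sinh (v - u l + η) ≠ 0 := fun l => by
    have := (hu 0 l).2
    simpa [hν] using this
  have hvμ : ∀ l : Fin n, Complex.sinh (v - μ l) ≠ 0 := fun l => by
    have := hμ 0 l.succ (Fin.succ_ne_zero l).symm
    simpa [hν] using this
  have hp1 : ∏ l, Complex.sinh (v - u l) ≠ 0 := Finset.prod_ne_zero_iff.2 fun l _ => hvu l
  have hp2 : ∏ l, Complex.sinh (v - μ l) ≠ 0 := Finset.prod_ne_zero_iff.2 fun l _ => hvμ l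
  have hWdet : W.det = (∏ l, Complex.sinh (v - μ l)) / (∏ l, Complex.sinh (v - u l)) *
      ∑ k : Fin (n + 1), (-1) ^ (k : ℕ) * σ k * (W.submatrix Fin.succ k.succAbove).det := by
    rw [← hlap, hγ0]
    field_simp
  have hΔν : ∏ j, ∏ k ∈ Finset.Ioi j, Complex.sinh (ν k - ν j) =
      (-1) ^ n * (∏ l, Complex.sinh (v - μ l)) *
        ∏ j, ∏ k ∈ Finset.Ioi j, Complex.sinh (μ k - μ j) := by
    rw [prod_Ioi_succAbove _ 0]
    congr 1
    · simp only [Fin.not_lt_zero, if_false, Fin.succAbove_zero, hν, Fin.cons_zero, Fin.cons_succ]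
      rw [Finset.prod_congr rfl fun l _ => sinh_sub_comm (μ l) v, Finset.prod_neg]
      simp
  rw [slavnov, hdet, hWdet, hΔν, Finset.mul_sum, Finset.mul_sum, Finset.mul_sum, Finset.sum_div]
  refine Finset.sum_congr rfl fun k _ => ?_
  rw [slavnov, hdetk, sinhVandermonde_succAbove u k, Fin.prod_univ_succ (fun j => d (ν j))]
  have hQ : ∏ l ∈ Finset.univ.erase k, Complex.sinh (u l - u k) ≠ 0 :=
    Finset.prod_ne_zero_iff.2 fun l hl => huu _ _ (Finset.ne_of_mem_erase hl)
  have hsgn := prod_ite_succAbove_lt k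
  set e := ∏ i, if k.succAbove i < k then (1 : ℂ) else -1 with he
  have he2 : ((-1 : ℂ)) ^ (k : ℕ) * (-1) ^ (k : ℕ) = 1 := by
    rw [← mul_pow]; simp
  have hn2 : ((-1 : ℂ)) ^ n * (-1) ^ n = 1 := by
    rw [← mul_pow]; simp
  have hee : e = (-1) ^ n * (-1) ^ (k : ℕ) := by
    rw [← hsgn, mul_assoc, he2, mul_one]
  have hΔk : sinhVandermonde (fun i => u (k.succAbove i)) ≠ 0 :=
    sinhVandermonde_ne_zero fun i j hij => huu _ _ fun h => hij (Fin.succAbove_right_injective h)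
  have hX : ∏ j, ∏ k ∈ Finset.Ioi j, Complex.sinh (μ k - μ j) ≠ 0 :=
    Finset.prod_ne_zero_iff.2 fun i _ => Finset.prod_ne_zero_iff.2 fun j hj => by
      have := hμ j.succ i.succ fun h => (Finset.mem_Ioi.1 hj).ne' (Fin.succ_injective _ h)
      simpa [hν] using this
  have hprod : ∏ k', c k' = c k * ((∏ i, a (u (k.succAbove i)) *
      ∏ l, Complex.sinh (μ l - u (k.succAbove i) + η)) *
        ∏ l ∈ Finset.univ.erase k, Complex.sinh (v - u l + η)) := by
    rw [Fin.prod_univ_succAbove _ k, prod_erase_eq_prod_succAbove, ← Finset.prod_mul_distrib]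
    congr 1
    refine Finset.prod_congr rfl fun i _ => ?_
    simp only [hc]
    rw [Fin.prod_univ_succ]
    simp only [hν, Fin.cons_zero, Fin.cons_succ]
    ring
  have hck : c k * σ k = a (u k) * (Complex.sinh η *
      ∏ l ∈ Finset.univ.erase k, Complex.sinh (u l - u k + η)) := by
    have h0 : ∏ l, Complex.sinh (ν l - u k + η) ≠ 0 :=
      Finset.prod_ne_zero_iff.2 fun l _ => (hu l k).2
    simp only [hc, hσ]
    field_simp
  -- What is left is bookkeeping of products: the sign `e` of the Vandermonde factorization combines
  -- with `(-1)^n` and the Laplace sign `(-1)^k`.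
  rw [hprod, ← Finset.mul_prod_erase Finset.univ (fun l => Complex.sinh (v - u l))
    (Finset.mem_univ k)] at *
  have hp3 := right_ne_zero_of_mul hp1
  have hvk := hvu k
  simp only [f, g, Finset.prod_mul_distrib, Finset.prod_div_distrib]
  have hν0 : ν 0 = v := rfl
  have hνs : ∀ i : Fin n, ν i.succ = μ i := fun i => rfl
  simp only [hν0, hνs]
  set D := ∏ i, d (μ i)
  set Pa := ∏ i, a (u (k.succAbove i)) * ∏ l, Complex.sinh (μ l - u (k.succAbove i) + η)
  set Pη := ∏ l ∈ Finset.univ.erase k, Complex.sinh (v - u l + η)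
  set dk := (W.submatrix Fin.succ k.succAbove).det
  set X := ∏ j, ∏ k ∈ Finset.Ioi j, Complex.sinh (μ k - μ j)
  have hen : e ≠ 0 := by
    rw [hee]; exact mul_ne_zero (pow_ne_zero _ (by norm_num)) (pow_ne_zero _ (by norm_num))
  have hnn : ((-1 : ℂ)) ^ n ≠ 0 := pow_ne_zero _ (by norm_num)
  field_simp
  rw [hee]
  set K := d v * D * (∏ x, a (u (k.succAbove x))) *
    (∏ x, ∏ l, Complex.sinh (μ l - u (k.succAbove x) + η)) * Pη * dk
  linear_combination (K * (-1) ^ (k : ℕ)) * hck - (K * (-1) ^ (k : ℕ) * (a (u k) *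
    (Complex.sinh η * ∏ l ∈ Finset.univ.erase k, Complex.sinh (u l - u k + η)))) * hn2

/-! ### Linear relations between the universal scalar products -/

/-- The scalar product as a function of the vacuum eigenvalues. -/
def universalScal (η : ℂ) (t s : Finset ℂ) : (ℂ → ℂ) → (ℂ → ℂ) → ℂ :=
  open Classical in
  if h : Disjoint t s ∧ Distinct (t ∪ s) then
    (exists_universal_scal η t s h.1 h.2).choose else 0

section

variable {η : ℂ} {t s : Finset ℂ}

theorem universalScal_mem (hts : Disjoint t s) (hd : Distinct (t ∪ s)) :
    universalScal η t s ∈ WeightPoly (t ∪ s) := by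
  rw [universalScal, dif_pos ⟨hts, hd⟩]
  exact (exists_universal_scal η t s hts hd).choose_spec.1

theorem YBRep.scal_eq (hts : Disjoint t s) (hd : Distinct (t ∪ s)) (ρ : YBRep η) :
    ρ.scal t s = universalScal η t s ρ.a ρ.d := by
  rw [universalScal, dif_pos ⟨hts, hd⟩]
  exact (exists_universal_scal η t s hts hd).choose_spec.2 ρ

theorem weightPoly_linear_mul {S r : Finset ℂ} {q : ℂ} {F : (ℂ → ℂ) → (ℂ → ℂ) → ℂ}
    (hF : F ∈ WeightPoly r) (hq : q ∉ r) (hS : insert q r = S) (x y : ℂ) :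
    (fun a d => (a q * x + d q * y) * F a d) ∈ WeightPoly S := by
  subst hS
  have := Submodule.add_mem _ (WeightPoly.const_mul (WeightPoly.mul_a hF hq) x)
    (WeightPoly.const_mul (WeightPoly.mul_d hF hq) y)
  convert this using 1
  funext a d
  simp only [Pi.add_apply]
  ring

/-- Matrix elements of `A(v) + κ D(v)` between off-shell Bethe vectors, computed in two ways. -/
theorem universalScal_relation (hη : Complex.sinh η ≠ 0) (κ v : ℂ) (hts : Disjoint t s)
    (hvt : v ∉ t) (hvs : v ∉ s) (hg : Generic η (insert v (t ∪ s))) (a d : ℂ → ℂ) :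
    ∑ q ∈ insert v t, (a q * coeffA η v t q + d q * (κ * coeffD η v t q)) *
        universalScal η ((insert v t).erase q) s a d =
      ∑ q ∈ insert v s, (a q * coeffA η v s q + d q * (κ * coeffD η v s q)) *
        universalScal η t ((insert v s).erase q) a d := by
  have hd := hg.distinct
  have hL : ∀ q ∈ insert v t, Disjoint ((insert v t).erase q) s ∧
      q ∉ (insert v t).erase q ∪ s ∧ insert q ((insert v t).erase q ∪ s) = insert v (t ∪ s) := by
    intro q hq
    have hdis : Disjoint (insert v t) s := Finset.disjoint_insert_left.2 ⟨hvs, hts⟩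
    refine ⟨hdis.mono_left (Finset.erase_subset _ _), ?_, ?_⟩
    · simp [Finset.disjoint_left.1 hdis hq]
    · rw [← Finset.insert_union, Finset.insert_erase hq, Finset.insert_union]
  have hR : ∀ q ∈ insert v s, Disjoint t ((insert v s).erase q) ∧
      q ∉ t ∪ (insert v s).erase q ∧ insert q (t ∪ (insert v s).erase q) = insert v (t ∪ s) := by
    intro q hq
    have hdis : Disjoint t (insert v s) := Finset.disjoint_insert_right.2 ⟨hvt, hts⟩
    refine ⟨hdis.mono_right (Finset.erase_subset _ _), ?_, ?_⟩
    · simp [Finset.disjoint_right.1 hdis hq]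
    · rw [← Finset.union_insert, Finset.insert_erase hq, Finset.union_insert]
  have hLd : ∀ q ∈ insert v t, Distinct ((insert v t).erase q ∪ s) := fun q hq =>
    hd.mono (by rw [← (hL q hq).2.2]; exact Finset.subset_insert _ _)
  have hRd : ∀ q ∈ insert v s, Distinct (t ∪ (insert v s).erase q) := fun q hq =>
    hd.mono (by rw [← (hR q hq).2.2]; exact Finset.subset_insert _ _)
  have hvtd : Distinct (insert v t) :=
    hd.mono (Finset.insert_subset_insert _ Finset.subset_union_left)
  have hvsd : Distinct (insert v s) :=
    hd.mono (Finset.insert_subset_insert _ Finset.subset_union_right)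
  have hmem := Submodule.sub_mem _
    (WeightPoly.sum_mem (t := insert v t) fun q hq => weightPoly_linear_mul
      (universalScal_mem (η := η) (hL q hq).1 (hLd q hq)) (hL q hq).2.1 (hL q hq).2.2
      (coeffA η v t q) (κ * coeffD η v t q))
    (WeightPoly.sum_mem (t := insert v s) fun q hq => weightPoly_linear_mul
      (universalScal_mem (η := η) (hR q hq).1 (hRd q hq)) (hR q hq).2.1 (hR q hq).2.2
      (coeffA η v s q) (κ * coeffD η v s q))
  -- Both sides lie in `WeightPoly` of the same set, so it suffices to compare them in
  -- representations, where both are the same matrix element.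
  refine sub_eq_zero.1 (WeightPoly.eq_zero hη hg (Finset.empty_subset _) hmem (fun ρ _ => ?_) a d
    (by simp))
  simp only [Pi.sub_apply]
  rw [sub_eq_zero, Finset.sum_congr rfl fun q hq => by
    rw [← ρ.scal_eq (hL q hq).1 (hLd q hq)], Finset.sum_congr (s₁ := insert v s) rfl fun q hq => by
    rw [← ρ.scal_eq (hR q hq).1 (hRd q hq)]]
  have h1 : ρ.dual t ᵥ* (ρ.A v + κ • ρ.D v) =
      ∑ q ∈ insert v t, (ρ.a q * coeffA η v t q + ρ.d q * (κ * coeffD η v t q)) •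
        ρ.dual ((insert v t).erase q) := by
    have hA : ρ.dual t ᵥ* ρ.A v = ∑ q ∈ insert v t, (ρ.a q * coeffA η v t q) •
        ρ.dual ((insert v t).erase q) := by
      -- The left action is the right action in the transposed representation, which has the same
      -- vacuum eigenvalues.
      have h := ρ.transpose.A_bethe' hvt hvtd
      simp only [YBRep.transpose_bethe] at h
      rw [← Matrix.mulVec_transpose]
      exact h
    have hD : ρ.dual t ᵥ* ρ.D v = ∑ q ∈ insert v t, (ρ.d q * coeffD η v t q) •
        ρ.dual ((insert v t).erase q) := by
      have h := ρ.transpose.D_bethe' hvt hvtd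
      simp only [YBRep.transpose_bethe] at h
      rw [← Matrix.mulVec_transpose]
      exact h
    rw [Matrix.vecMul_add, Matrix.vecMul_smul, hA, hD, Finset.smul_sum, ← Finset.sum_add_distrib]
    refine Finset.sum_congr rfl fun q _ => ?_
    module
  have h2 : (ρ.A v + κ • ρ.D v) *ᵥ ρ.bethe s =
      ∑ q ∈ insert v s, (ρ.a q * coeffA η v s q + ρ.d q * (κ * coeffD η v s q)) •
        ρ.bethe ((insert v s).erase q) := by
    rw [Matrix.add_mulVec, Matrix.smul_mulVec, ρ.A_bethe' hvs hvsd, ρ.D_bethe' hvs hvsd,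
      Finset.smul_sum, ← Finset.sum_add_distrib]
    refine Finset.sum_congr rfl fun q _ => ?_
    module
  have h3 := Matrix.dotProduct_mulVec (ρ.dual t) (ρ.A v + κ • ρ.D v) (ρ.bethe s)
  rw [h1, h2, dotProduct_sum, sum_dotProduct] at h3
  simp only [dotProduct_smul, smul_dotProduct, smul_eq_mul] at h3
  exact h3.symm

/-- The relation satisfied by the scalar products with an on-shell Bethe vector. -/
theorem universalScal_onShell (hη : Complex.sinh η ≠ 0) (κ v : ℂ) (hts : Disjoint t s)
    (hvt : v ∉ t) (hvs : v ∉ s) (hg : Generic η (insert v (t ∪ s))) (a d : ℂ → ℂ)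
    (hon : ∀ q ∈ t, a q * ∏ l ∈ t.erase q, f η l q = κ * d q * ∏ l ∈ t.erase q, f η q l)
    (ha : a v = 1) (hd : d v = 0) :
    (∏ l ∈ t, f η l v - ∏ l ∈ s, f η l v) * universalScal η t s a d =
      ∑ k ∈ s, (a k * (g η v k * ∏ l ∈ s.erase k, f η l k) +
        κ * d k * (g η k v * ∏ l ∈ s.erase k, f η k l)) *
          universalScal η t (insert v (s.erase k)) a d := by
  have h := universalScal_relation hη κ v hts hvt hvs hg a d
  rw [Finset.sum_insert hvt, Finset.sum_insert hvs, Finset.erase_insert hvt,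
    Finset.erase_insert hvs, Finset.sum_eq_zero (s := t)] at h
  · rw [sub_mul, sub_eq_iff_eq_add']
    simp only [coeffA, coeffD, if_pos, ha, hd, zero_mul, one_mul, add_zero] at h
    rw [h]
    congr 1
    refine Finset.sum_congr rfl fun k hk => ?_
    have hkv : k ≠ v := fun h => hvs (h ▸ hk)
    rw [if_neg hkv, if_neg hkv, Finset.erase_insert_of_ne hkv.symm]
    ring
  -- The exchange terms on the on-shell side: `A` and `κ D` enter with opposite signs `g(v, q) =
  -- -g(q, v)`, and the Bethe equation at `q` cancels them.
  · intro q hq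
    have hqv : q ≠ v := fun h => hvt (h ▸ hq)
    have h1 := hon q hq
    have hgg : g η q v = -g η v q := by rw [g, g, sinh_sub_comm, div_neg]
    rw [coeffA, coeffD, if_neg hqv, if_neg hqv, hgg]
    refine mul_eq_zero_of_left ?_ _
    linear_combination g η v q * h1

theorem universalScal_empty (hη : Complex.sinh η ≠ 0) (a d : ℂ → ℂ) :
    universalScal η ∅ ∅ a d = 1 := by
  have hD : Distinct (∅ ∪ ∅) := fun x hx => by simp at hx
  have hmem := Submodule.sub_mem _ (universalScal_mem (η := η) (Finset.disjoint_empty_left _) hD)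
    (by simpa using one_mem_weightPoly)
  refine sub_eq_zero.1 (WeightPoly.eq_zero (z := ∅) hη (s := ∅) (fun x hx => by simp at hx)
    (le_refl _) (by simpa using hmem) (fun ρ _ => ?_) a d (by simp))
  simp only [Pi.sub_apply]
  rw [← ρ.scal_eq (Finset.disjoint_empty_left _) hD, YBRep.scal, ρ.dual_empty, ρ.bethe_empty,
    ρ.norm_vac, sub_self]

/-- The recursion for the scalar products if `d` vanishes on the right arguments. -/
theorem universalScal_recursion (hη : Complex.sinh η ≠ 0) {v : ℂ} (hvt : v ∉ t)
    (hts : Disjoint (insert v t) s) (hg : Generic η (insert v t ∪ s)) (a d : ℂ → ℂ)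
    (hd : ∀ x ∈ s, d x = 0) :
    universalScal η (insert v t) s a d =
      ∑ k ∈ s, d v * a k * (g η v k * ∏ l ∈ s.erase k, f η v l * f η l k) *
        universalScal η t (s.erase k) a d := by
  rw [Finset.disjoint_insert_left] at hts
  have hdist := hg.distinct
  have hsub : ∀ k ∈ s, insert k (insert v (t ∪ s.erase k)) = insert v t ∪ s := by
    intro k hk
    rw [Finset.insert_comm, ← Finset.union_insert, Finset.insert_erase hk, Finset.insert_union]
  have hk1 : ∀ k ∈ s, Disjoint t (s.erase k) ∧ Distinct (t ∪ s.erase k) := fun k hk =>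
    ⟨hts.2.mono_right (Finset.erase_subset _ _), hdist.mono (by
      rw [← hsub k hk]
      exact (Finset.subset_insert _ _).trans (Finset.subset_insert _ _))⟩
  have hts' : Disjoint (insert v t) s := Finset.disjoint_insert_left.2 hts
  have hmem : (fun a d => universalScal η (insert v t) s a d -
      ∑ k ∈ s, (g η v k * ∏ l ∈ s.erase k, f η v l * f η l k) *
        (a k * (d v * universalScal η t (s.erase k) a d))) ∈ WeightPoly (insert v t ∪ s) := by
    refine Submodule.sub_mem _ (universalScal_mem hts' hdist)
      (WeightPoly.sum_mem fun k hk => WeightPoly.const_mul ?_ _)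
    have hvk : v ≠ k := fun h => hts.1 (h ▸ hk)
    have h1 := WeightPoly.mul_d (universalScal_mem (η := η) (hk1 k hk).1 (hk1 k hk).2)
      (q := v) (by simp [hvt, hts.1])
    have h2 := WeightPoly.mul_a h1 (q := k) (by
      simp [hvk.symm, Finset.disjoint_right.1 hts.2 hk])
    rwa [hsub k hk] at h2
  -- The formula for the action of `C` needs `d = 0` on `s`; only representations with this property
  -- are tested.
  have := WeightPoly.eq_zero hη hg (z := s) Finset.subset_union_right hmem (fun ρ hρ => ?_) a d hd
  · rw [sub_eq_zero.1 this]
    refine Finset.sum_congr rfl fun k _ => ?_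
    ring
  · rw [sub_eq_zero, ← ρ.scal_eq hts' hdist, YBRep.scal, ρ.dual_insert hvt,
      ← Matrix.dotProduct_mulVec, ρ.C_bethe_of_d_eq_zero hts.1 (hdist.mono (by
        rw [Finset.insert_union]
        exact Finset.insert_subset_insert _ Finset.subset_union_right)) hρ, dotProduct_sum]
    refine Finset.sum_congr rfl fun k hk => ?_
    rw [dotProduct_smul, ← ρ.scal_eq (hk1 k hk).1 (hk1 k hk).2, YBRep.scal, smul_eq_mul]
    ring

end

/-! ### The Slavnov formula -/

section

variable {η κ : ℂ} {N : ℕ}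

theorem erase_image_univ {u : Fin N → ℂ} (hu : Function.Injective u) (k : Fin N) :
    (Finset.univ.image u).erase (u k) = (Finset.univ.erase k).image u :=
  (Finset.image_erase hu _ _).symm

theorem prod_erase_image {u : Fin N → ℂ} (hu : Function.Injective u) (k : Fin N) (F : ℂ → ℂ) :
    ∏ l ∈ (Finset.univ.image u).erase (u k), F l = ∏ l ∈ Finset.univ.erase k, F (u l) := by
  rw [erase_image_univ hu, Finset.prod_image fun _ _ _ _ h => hu h]

theorem sum_image_univ {u : Fin N → ℂ} (hu : Function.Injective u) (F : ℂ → ℂ) :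
    ∑ l ∈ Finset.univ.image u, F l = ∑ k, F (u k) :=
  Finset.sum_image fun _ _ _ _ h => hu h

theorem prod_image_univ {u : Fin N → ℂ} (hu : Function.Injective u) (F : ℂ → ℂ) :
    ∏ l ∈ Finset.univ.image u, F l = ∏ k, F (u k) :=
  Finset.prod_image fun _ _ _ _ h => hu h

theorem Distinct.sinh_ne_zero {s : Finset ℂ} (hs : Distinct s) {u : Fin N → ℂ}
    (hu : Function.Injective u) (hus : ∀ i, u i ∈ s) (i j : Fin N) (hij : i ≠ j) :
    Complex.sinh (u i - u j) ≠ 0 :=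
  hs _ (hus i) _ (hus j) fun h => hij (hu h)

theorem Generic.sinh_ne_zero {s : Finset ℂ} (hs : Generic η s) {x y : ℂ} (hx : x ∈ s) (hy : y ∈ s)
    (hxy : x ≠ y) : Complex.sinh (x - y) ≠ 0 ∧ Complex.sinh (x - y + η) ≠ 0 ∧
      Complex.sinh (x - y - η) ≠ 0 := by
  refine ⟨(hs x hx y hy hxy).1, (hs x hx y hy hxy).2, ?_⟩
  rw [show x - y - η = -(y - x + η) by ring, Complex.sinh_neg]
  exact neg_ne_zero.2 (hs y hy x hx hxy.symm).2

/-- The case of the domain wall partition function. Both sides satisfy the same recursion, which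
removes one `μ` and one `u k`, and both equal `1` for empty arguments. The Bethe equations play no
role. -/
theorem universalScal_eq_slavnov_of_d_eq_zero (hη : Complex.sinh η ≠ 0) (κ : ℂ) (a d : ℂ → ℂ)
    {n : ℕ} (μ u : Fin n → ℂ) (hμ : Function.Injective μ) (hu : Function.Injective u)
    (hμu : ∀ i j, μ i ≠ u j) (hg : Generic η (Finset.univ.image μ ∪ Finset.univ.image u))
    (hd : ∀ k, d (u k) = 0) :
    universalScal η (Finset.univ.image μ) (Finset.univ.image u) a d = slavnov η κ a d μ u := by
  induction n with
  | zero => simp [universalScal_empty hη, slavnov, sinhVandermonde]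
  | succ n ih =>
    obtain ⟨v, μ', rfl⟩ : ∃ v μ', μ = (Fin.cons v μ' : Fin (n + 1) → ℂ) :=
      ⟨μ 0, Fin.tail μ, (Fin.cons_self_tail μ).symm⟩
    set ν : Fin (n + 1) → ℂ := Fin.cons v μ' with hν
    have hνs : ∀ i, μ' i = ν i.succ := fun i => rfl
    have himg : Finset.univ.image ν = insert v (Finset.univ.image μ') := by
      ext x
      simp only [Finset.mem_image, Finset.mem_univ, true_and, Finset.mem_insert, Fin.exists_fin_succ,
        hν, Fin.cons_zero, Fin.cons_succ]
      exact or_congr_left eq_comm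
    have hμ' : Function.Injective μ' := fun i j h =>
      Fin.succ_injective _ (hμ (a₁ := i.succ) (a₂ := j.succ) h)
    have hv : v ∉ Finset.univ.image μ' := by
      simp only [Finset.mem_image, Finset.mem_univ, true_and, not_exists]
      intro i h
      exact (Fin.succ_ne_zero i) (hμ (a₁ := i.succ) (a₂ := 0) h)
    have hm1 : ∀ i, ν i ∈ Finset.univ.image ν ∪ Finset.univ.image u := fun i =>
      Finset.mem_union_left _ (Finset.mem_image_of_mem _ (Finset.mem_univ _))
    have hm2 : ∀ i, u i ∈ Finset.univ.image ν ∪ Finset.univ.image u := fun i =>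
      Finset.mem_union_right _ (Finset.mem_image_of_mem _ (Finset.mem_univ _))
    have hdis : Disjoint (Finset.univ.image ν) (Finset.univ.image u) := by
      rw [Finset.disjoint_left]
      intro x hx hx'
      obtain ⟨i, _, rfl⟩ := Finset.mem_image.1 hx
      obtain ⟨j, _, hj⟩ := Finset.mem_image.1 hx'
      exact hμu i j hj.symm
    rw [slavnov_recursion a d μ' v u (hg.distinct.sinh_ne_zero hμ hm1)
      (hg.distinct.sinh_ne_zero hu hm2) (fun i j => by
        have := hg.sinh_ne_zero (hm1 i) (hm2 j) (hμu i j)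
        exact ⟨this.1, this.2.1⟩) hd, himg,
      universalScal_recursion hη hv (himg ▸ hdis) (himg ▸ hg) a d (by
        intro x hx
        obtain ⟨i, _, rfl⟩ := Finset.mem_image.1 hx
        exact hd i), sum_image_univ hu]
    refine Finset.sum_congr rfl fun k _ => ?_
    have hk : (Finset.univ.image u).erase (u k) =
        Finset.univ.image fun i => u (k.succAbove i) := by
      rw [erase_image_univ hu]
      have : (Finset.univ.erase k) = Finset.univ.image k.succAbove := by
        rw [Fin.image_succAbove_univ]
        ext; simp
      rw [this, Finset.image_image]
      rfl
    rw [prod_erase_image hu, hk]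
    congr 1
    refine ih μ' (fun i => u (k.succAbove i)) hμ' (hu.comp Fin.succAbove_right_injective)
      (fun i j => hμu i.succ _) (hg.mono ?_) fun i => hd _
    rw [himg, ← hk]
    exact Finset.union_subset_union (Finset.subset_insert _ _) (Finset.erase_subset _ _)

/-- An enumeration of a finite set with `N` elements. -/
def enum (N : ℕ) (s : Finset ℂ) : Fin N → ℂ :=
  if h : s.card = N then fun i => ((s.equivFinOfCardEq h).symm i : ℂ) else 0

theorem enum_spec {s : Finset ℂ} (h : s.card = N) :
    Function.Injective (enum N s) ∧ Finset.univ.image (enum N s) = s := by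
  have h1 : enum N s = fun i => ((s.equivFinOfCardEq h).symm i : ℂ) := by rw [enum, dif_pos h]
  rw [h1]
  refine ⟨Subtype.val_injective.comp (Equiv.injective _), ?_⟩
  ext x
  simp only [Finset.mem_image, Finset.mem_univ, true_and]
  constructor
  · rintro ⟨i, rfl⟩
    exact Subtype.coe_prop _
  · intro hx
    exact ⟨s.equivFinOfCardEq h ⟨x, hx⟩, by simp⟩

/-- Permutation invariance lets the formula be evaluated on a set through any enumeration, so that
points can be exchanged without tracking their order. -/
theorem slavnov_eq_enum (a d : ℂ → ℂ) (μ : Fin N → ℂ) {u : Fin N → ℂ} {s : Finset ℂ}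
    (hu : Function.Injective u) (hs : Finset.univ.image u = s) :
    slavnov η κ a d μ u = slavnov η κ a d μ (enum N s) := by
  have hc : s.card = N := by
    rw [← hs, Finset.card_image_of_injective _ hu, Finset.card_univ, Fintype.card_fin]
  obtain ⟨h1, h2⟩ := enum_spec hc
  have hex : ∀ i, ∃ j, enum N s j = u i := fun i => by
    have : u i ∈ Finset.univ.image (enum N s) := by
      rw [h2, ← hs]
      exact Finset.mem_image_of_mem _ (Finset.mem_univ _)
    obtain ⟨j, _, hj⟩ := Finset.mem_image.1 this
    exact ⟨j, hj⟩
  choose σ hσ using hex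
  have hσi : Function.Injective σ := fun i j h => hu (by rw [← hσ, ← hσ, h])
  have : u = enum N s ∘ Equiv.ofBijective σ (Finite.injective_iff_bijective.1 hσi) := by
    funext i
    simp [hσ]
  rw [this, slavnov_comp_perm]

/-- The difference of the two sides of the Slavnov formula. -/
def slavnovDefect (η κ : ℂ) (a d : ℂ → ℂ) (μ : Fin N → ℂ) (s : Finset ℂ) : ℂ :=
  universalScal η (Finset.univ.image μ) s a d - slavnov η κ a d μ (enum N s)

/-- The Bethe equations for the vacuum eigenvalues `a`, `d` and the twist `κ`. -/
def OnShell (η κ : ℂ) (a d : ℂ → ℂ) (μ : Fin N → ℂ) : Prop :=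
  ∀ j, a (μ j) * ∏ l ∈ Finset.univ.erase j, f η (μ l) (μ j) =
    κ * d (μ j) * ∏ l ∈ Finset.univ.erase j, f η (μ j) (μ l)

/-- The universal scalar product and the determinant formula satisfy the same linear relation; so
does their difference, with no inhomogeneous term. -/
theorem slavnovDefect_relation (hη : Complex.sinh η ≠ 0) {a d : ℂ → ℂ} {μ : Fin N → ℂ}
    (hμ : Function.Injective μ) (hon : OnShell η κ a d μ) {s : Finset ℂ} (hs : s.card = N) {v : ℂ}
    (hts : Disjoint (Finset.univ.image μ) s) (hvt : v ∉ Finset.univ.image μ) (hvs : v ∉ s)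
    (hg : Generic η (insert v (Finset.univ.image μ ∪ s))) (ha : a v = 1) (hd : d v = 0) :
    (∏ j, f η (μ j) v - ∏ l ∈ s, f η l v) * slavnovDefect η κ a d μ s =
      ∑ k ∈ s, (a k * (g η v k * ∏ l ∈ s.erase k, f η l k) +
        κ * d k * (g η k v * ∏ l ∈ s.erase k, f η k l)) *
          slavnovDefect η κ a d μ (insert v (s.erase k)) := by
  have h1 := universalScal_onShell hη κ v hts hvt hvs hg a d (by
    intro q hq
    obtain ⟨j, _, rfl⟩ := Finset.mem_image.1 hq
    rw [prod_erase_image hμ, prod_erase_image hμ]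
    exact hon j) ha hd
  rw [prod_image_univ hμ] at h1
  simp only [slavnovDefect]
  simp only [mul_sub]
  rw [Finset.sum_sub_distrib, h1]
  congr 1
  obtain ⟨hui, hus⟩ := enum_spec hs
  set u := enum N s with hu
  have hS : ∀ x ∈ s, x ∈ insert v (Finset.univ.image μ ∪ s) := fun x hx =>
    Finset.mem_insert_of_mem (Finset.mem_union_right _ hx)
  have hm1 : ∀ i, μ i ∈ insert v (Finset.univ.image μ ∪ s) := fun i =>
    Finset.mem_insert_of_mem (Finset.mem_union_left _
      (Finset.mem_image_of_mem _ (Finset.mem_univ _)))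
  have hus' : ∀ i, u i ∈ s := fun i => by
    rw [← hus]; exact Finset.mem_image_of_mem _ (Finset.mem_univ _)
  have hvu : ∀ i, u i ≠ v := fun i h => hvs (h ▸ hus' i)
  have hvm : v ∈ insert v (Finset.univ.image μ ∪ s) := Finset.mem_insert_self _ _
  have hμu : ∀ i j, μ i ≠ u j := fun i j h => Finset.disjoint_left.1 hts
    (Finset.mem_image_of_mem _ (Finset.mem_univ i)) (h ▸ hus' j)
  have h2 := slavnov_relation (κ := κ) hη a d μ u v (hg.distinct.sinh_ne_zero hμ hm1)
    (hg.distinct.sinh_ne_zero hui fun i => hS _ (hus' i))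
    (fun i j => hg.sinh_ne_zero (hm1 i) (hS _ (hus' j)) (hμu i j))
    (fun i => by
      have := hg.sinh_ne_zero (hm1 i) hvm fun h =>
        hvt (h ▸ Finset.mem_image_of_mem _ (Finset.mem_univ i))
      exact ⟨this.1, this.2.1⟩)
    (fun i => (hg.sinh_ne_zero (hS _ (hus' i)) hvm (hvu i)).1) ha hd
  have h3 : ∏ l ∈ s, f η l v = ∏ l, f η (u l) v := by
    rw [← prod_image_univ hui fun l => f η l v, hus]
  rw [h3, h2, ← hus, sum_image_univ hui]
  refine Finset.sum_congr rfl fun k _ => ?_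
  rw [prod_erase_image hui, prod_erase_image hui]
  congr 1
  refine slavnov_eq_enum a d μ ?_ ?_
  · intro i j hij
    by_cases hi : i = k <;> by_cases hj : j = k
    · rw [hi, hj]
    · subst hi
      rw [Function.update_self, Function.update_of_ne hj] at hij
      exact absurd hij.symm (hvu j)
    · subst hj
      rw [Function.update_self, Function.update_of_ne hi] at hij
      exact absurd hij (hvu i)
    · rw [Function.update_of_ne hi, Function.update_of_ne hj] at hij
      exact hui hij
  · rw [erase_image_univ hui, ← Finset.insert_erase (Finset.mem_univ k), Finset.image_insert,
      Function.update_self, Finset.erase_insert (Finset.notMem_erase _ _)]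
    congr 1
    refine Finset.image_congr fun i hi => ?_
    rw [Function.update_of_ne (Finset.ne_of_mem_erase hi)]

end

open Filter Topology

/-! ### Uniqueness of the solution of the linear relations -/

section

variable {η κ : ℂ} {N : ℕ}

/-- `ε` is a shift for which the points `μ_i + ε` are in general position with respect to `r`. -/
def GoodShift (η : ℂ) (μ : Fin N → ℂ) (r : Finset ℂ) (ε : ℂ) : Prop :=
  ∀ i, ∀ x ∈ r, Complex.sinh (μ i + ε - x) ≠ 0 ∧ Complex.sinh (μ i + ε - x + η) ≠ 0 ∧
    Complex.sinh (x - (μ i + ε) + η) ≠ 0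

theorem eventually_goodShift (η : ℂ) (μ : Fin N → ℂ) (r : Finset ℂ) :
    ∀ᶠ ε in 𝓝[≠] (0 : ℂ), GoodShift η μ r ε := by
  refine eventually_all.2 fun i => (Finset.eventually_all r).2 fun x _ => ?_
  filter_upwards [eventually_sinh_ne_zero (μ i - x) one_ne_zero,
    eventually_sinh_ne_zero (μ i - x + η) one_ne_zero,
    eventually_sinh_ne_zero (x - μ i + η) (neg_ne_zero.2 one_ne_zero)] with ε h1 h2 h3
  refine ⟨?_, ?_, ?_⟩
  · rwa [show μ i + ε - x = μ i - x + 1 * ε by ring]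
  · rwa [show μ i + ε - x + η = μ i - x + η + 1 * ε by ring]
  · rwa [show x - (μ i + ε) + η = x - μ i + η + -1 * ε by ring]

theorem GoodShift.notMem {μ : Fin N → ℂ} {r : Finset ℂ} {ε : ℂ} (h : GoodShift η μ r ε)
    (i : Fin N) : μ i + ε ∉ r := fun hi => (h i _ hi).1 (by simp)

theorem GoodShift.generic {μ : Fin N → ℂ} {r : Finset ℂ} {ε : ℂ} (h : GoodShift η μ r ε)
    (hr : Generic η r) (hμ : ∀ i, μ i ∈ r) :
    Generic η (r ∪ Finset.univ.image fun i => μ i + ε) := by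
  intro x hx y hy hxy
  rw [Finset.mem_union, Finset.mem_image] at hx hy
  rcases hx with hx | ⟨i, _, rfl⟩ <;> rcases hy with hy | ⟨j, _, rfl⟩
  · exact hr x hx y hy hxy
  · refine ⟨?_, (h j x hx).2.2⟩
    rw [sinh_sub_comm]
    exact neg_ne_zero.2 (h j x hx).1
  · exact ⟨(h i y hy).1, (h i y hy).2.1⟩
  · rw [add_sub_add_right_eq_sub]
    exact hr _ (hμ i) _ (hμ j) fun h => hxy (by rw [h])

/-- The matrix of the linear relations between the points near `μ_i`, `i ∈ K`, cleared of the
poles. -/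
def shiftMatrix (η : ℂ) (μ : Fin N → ℂ) (w : Finset ℂ) (K : Finset (Fin N)) (ε : ℂ) :
    Matrix K K ℂ :=
  Matrix.of fun i j =>
    if i = j then
      Complex.sinh (-ε + η) * (∏ l ∈ Finset.univ.erase (i : Fin N), f η (μ l) (μ i + ε)) -
        Complex.sinh (-ε) * ((∏ l ∈ w, f η l (μ i + ε)) *
          ∏ l ∈ K.erase i, f η (μ l + ε) (μ i + ε))
    else
      -(Complex.sinh (-ε) * (g η (μ i + ε) (μ j + ε) * ((∏ l ∈ w, f η l (μ j + ε)) *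
        ∏ l ∈ (K.erase i).erase j, f η (μ l + ε) (μ j + ε))))

theorem continuousAt_f {x y : ℂ} (h : Complex.sinh (x - y) ≠ 0) :
    ContinuousAt (fun ε => f η x (y + ε)) 0 := by
  unfold f
  refine ContinuousAt.div (by fun_prop) (by fun_prop) (by simpa using h)

/-- At `ε = 0` the factor `sinh (-ε)` removes everything except the diagonal entries `sinh η ∏
f(μ_l, μ_i)`, which are nonzero for generic points. The entries are continuous there, so the
determinant stays nonzero nearby. -/
theorem eventually_det_shiftMatrix_ne_zero (hη : Complex.sinh η ≠ 0) {μ : Fin N → ℂ}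
    (hμ : Function.Injective μ) {w : Finset ℂ} {K : Finset (Fin N)}
    (hg : Generic η (Finset.univ.image μ ∪ w)) (hw : ∀ i, μ i ∉ w) :
    ∀ᶠ ε in 𝓝[≠] (0 : ℂ), (shiftMatrix η μ w K ε).det ≠ 0 := by
  have hm1 : ∀ i, μ i ∈ Finset.univ.image μ ∪ w := fun i =>
    Finset.mem_union_left _ (Finset.mem_image_of_mem _ (Finset.mem_univ _))
  have hwμ : ∀ l ∈ w, ∀ i, Complex.sinh (l - μ i) ≠ 0 := fun l hl i =>
    (hg.sinh_ne_zero (Finset.mem_union_right _ hl) (hm1 i) fun h => hw i (h ▸ hl)).1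
  have hc : ContinuousAt (fun ε => (shiftMatrix η μ w K ε).det) 0 := by
    refine (Continuous.matrix_det continuous_id).continuousAt.comp
      (continuousAt_pi.2 fun i => continuousAt_pi.2 fun j => ?_)
    have h1 : ∀ j, ContinuousAt (fun ε => ∏ l ∈ w, f η l (μ j + ε)) 0 := fun j =>
      tendsto_finsetProd _ fun l hl => continuousAt_f (hwμ l hl j)
    have h2 : ∀ (L : Finset (Fin N)) (j : Fin N),
        ContinuousAt (fun ε => ∏ l ∈ L, f η (μ l + ε) (μ j + ε)) 0 := fun L j => by
      simp only [f, add_sub_add_right_eq_sub]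
      exact continuousAt_const
    have h3 : ∀ j, ContinuousAt
        (fun ε => ∏ l ∈ Finset.univ.erase j, f η (μ l) (μ j + ε)) 0 := fun j =>
      tendsto_finsetProd _ fun l hl => continuousAt_f
        (hg.distinct.sinh_ne_zero hμ hm1 _ _ (Finset.ne_of_mem_erase hl))
    have h4 : ContinuousAt (fun ε : ℂ => Complex.sinh (-ε + η)) 0 := by fun_prop
    have h5 : ContinuousAt (fun ε : ℂ => Complex.sinh (-ε)) 0 := by fun_prop
    by_cases hij : i = j
    · simp only [Matrix.of_apply, if_pos hij]
      exact (h4.mul (h3 _)).sub (h5.mul ((h1 _).mul (h2 _ _)))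
    · simp only [Matrix.of_apply, if_neg hij]
      refine (h5.mul (ContinuousAt.mul ?_ ((h1 _).mul (h2 _ _)))).neg
      simp only [g, add_sub_add_right_eq_sub]
      exact continuousAt_const
  refine (hc.eventually_ne ?_).filter_mono nhdsWithin_le_nhds
  have h0 : shiftMatrix η μ w K 0 = Matrix.diagonal fun i : K =>
      Complex.sinh η * ∏ l ∈ Finset.univ.erase (i : Fin N), f η (μ l) (μ i) := by
    ext i j
    by_cases hij : i = j
    · subst hij
      simp [shiftMatrix]
    · simp [shiftMatrix, hij]
  rw [h0, Matrix.det_diagonal]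
  refine Finset.prod_ne_zero_iff.2 fun i _ => mul_ne_zero hη
    (Finset.prod_ne_zero_iff.2 fun l hl => ?_)
  have := hg.sinh_ne_zero (hm1 l) (hm1 i) fun h => Finset.ne_of_mem_erase hl (hμ h)
  exact div_ne_zero this.2.1 this.1

/-- The arguments are interpolated between `s` and the shifted points `μ_i + ε`: `w` holds the
original points, `K` the labels of the shifted ones. For `w` empty all arguments are zeros of `d`
and the domain wall case applies. Adding a point to `w`, the relations at `v = μ_i + ε` for `i` in a
set `K'` with one label more form a square system, since terms removing a point of `w` vanish by
induction; `shiftMatrix` is invertible for small `ε ≠ 0`. For `n = N` no shifted point is left. -/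
theorem eventually_slavnovDefect_eq_zero (hη : Complex.sinh η ≠ 0) {a d : ℂ → ℂ} {μ : Fin N → ℂ}
    (hμ : Function.Injective μ) (hon : OnShell η κ a d μ) {s : Finset ℂ}
    (hts : Disjoint (Finset.univ.image μ) s) (hg : Generic η (Finset.univ.image μ ∪ s))
    (had : ∀ x, x ∉ Finset.univ.image μ ∪ s → a x = 1 ∧ d x = 0) (n : ℕ) :
    ∀ w ⊆ s, w.card = n → ∀ K : Finset (Fin N), K.card + n = N →
      ∀ᶠ ε in 𝓝[≠] (0 : ℂ), slavnovDefect η κ a d μ (w ∪ K.image fun i => μ i + ε) = 0 := by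
  have hμr : ∀ i, μ i ∈ Finset.univ.image μ ∪ s := fun i =>
    Finset.mem_union_left _ (Finset.mem_image_of_mem _ (Finset.mem_univ _))
  have hinj : ∀ ε : ℂ, Function.Injective fun i => μ i + ε := fun ε i j h =>
    hμ (add_right_cancel h)
  have hmem : ∀ i, μ i ∉ s := fun i h => Finset.disjoint_left.1 hts
    (Finset.mem_image_of_mem _ (Finset.mem_univ _)) h
  induction n with
  | zero =>
    intro w _ hw K hK
    have hK' : K = Finset.univ := by
      rw [← Finset.card_eq_iff_eq_univ, Fintype.card_fin]
      omega
    rw [Finset.card_eq_zero] at hw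
    subst hw hK'
    filter_upwards [eventually_goodShift η μ (Finset.univ.image μ ∪ s)] with ε hε
    rw [Finset.empty_union, slavnovDefect, sub_eq_zero,
      ← slavnov_eq_enum a d μ (hinj ε) rfl]
    refine universalScal_eq_slavnov_of_d_eq_zero hη κ a d μ _ hμ (hinj ε) (fun i j h => ?_)
      ((hε.generic hg hμr).mono (Finset.union_subset_union Finset.subset_union_left (le_refl _)))
      fun k => (had _ (hε.notMem k)).2
    exact hε.notMem j (h ▸ hμr i)
  | succ n ih =>
    intro w hws hwc K hK
    -- One label is free because `w` is nonempty. The unknowns are the defects at `w ∪ (K' \ {i})`,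
    -- `i ∈ K'`, and the one with `i = i₀` is wanted.
    obtain ⟨i₀, hi₀⟩ : ∃ i, i ∉ K := by
      by_contra! h
      have : K = Finset.univ := Finset.eq_univ_iff_forall.2 h
      rw [this, Finset.card_univ, Fintype.card_fin] at hK
      omega
    set K' := insert i₀ K with hK'
    have hKc : K'.card = K.card + 1 := Finset.card_insert_of_notMem hi₀
    have hev : ∀ᶠ ε in 𝓝[≠] (0 : ℂ), ∀ k ∈ w,
        slavnovDefect η κ a d μ (w.erase k ∪ K'.image fun i => μ i + ε) = 0 :=
      (Finset.eventually_all w).2 fun k hk => ih _ ((Finset.erase_subset _ _).trans hws)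
        (by rw [Finset.card_erase_of_mem hk]; omega) _ (by omega)
    have hw' : ∀ i, μ i ∉ w := fun i h => hmem i (hws h)
    filter_upwards [eventually_goodShift η μ (Finset.univ.image μ ∪ s), hev,
      eventually_det_shiftMatrix_ne_zero (K := K') hη hμ (w := w)
        (hg.mono (Finset.union_subset_union (le_refl _) hws)) hw'] with ε hε hεw hdet
    have hG := hε.generic hg hμr
    have hvw : ∀ i, μ i + ε ∉ w := fun i h => hε.notMem i (Finset.mem_union_right _ (hws h))
    have hvt : ∀ i, μ i + ε ∉ Finset.univ.image μ := fun i h =>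
      hε.notMem i (Finset.mem_union_left _ h)
    set v : Fin N → ℂ := fun i => μ i + ε with hv
    have hvi : Function.Injective v := hinj ε
    have hvL : ∀ i (L : Finset (Fin N)), v i ∈ L.image v ↔ i ∈ L := fun i L =>
      hvi.mem_finset_image
    have hdis : ∀ L : Finset (Fin N), Disjoint w (L.image v) := by
      intro L
      rw [Finset.disjoint_right]
      intro x hx
      obtain ⟨i, _, rfl⟩ := Finset.mem_image.1 hx
      exact hvw i
    have hsub : ∀ (L : Finset (Fin N)), L.image v ⊆ Finset.univ.image v := fun L =>
      Finset.image_subset_image (Finset.subset_univ _)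
    have hX : shiftMatrix η μ w K' ε *ᵥ
        (fun i => slavnovDefect η κ a d μ (w ∪ (K'.erase i).image v)) = 0 := by
      funext i
      have hcard : (w ∪ (K'.erase (i : Fin N)).image v).card = N := by
        rw [Finset.card_union_of_disjoint (hdis _), Finset.card_image_of_injective _ hvi,
          Finset.card_erase_of_mem i.2]
        omega
      have hvs : v i ∉ w ∪ (K'.erase (i : Fin N)).image v := by
        rw [Finset.mem_union, hvL, not_or]
        exact ⟨hvw i, Finset.notMem_erase _ _⟩
      have hrel := slavnovDefect_relation (κ := κ) hη hμ hon hcard (v := v i) (by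
        rw [Finset.disjoint_union_right]
        refine ⟨hts.mono_right hws, Finset.disjoint_right.2 fun x hx => ?_⟩
        obtain ⟨j, _, rfl⟩ := Finset.mem_image.1 hx
        exact hvt j) (hvt i) hvs (hG.mono (by
          refine Finset.insert_subset (Finset.mem_union_right _
            (Finset.mem_image_of_mem _ (Finset.mem_univ _))) (Finset.union_subset ?_
              (Finset.union_subset ?_ ?_))
          · exact Finset.subset_union_left.trans Finset.subset_union_left
          · exact hws.trans (Finset.subset_union_right.trans Finset.subset_union_left)
          · exact (hsub _).trans Finset.subset_union_right))
        (had _ (hε.notMem i)).1 (had _ (hε.notMem i)).2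
      rw [Finset.sum_union (hdis _), Finset.sum_eq_zero (s := w), zero_add,
        Finset.sum_image fun _ _ _ _ h => hvi h, Finset.prod_union (hdis _),
        Finset.prod_image fun _ _ _ _ h => hvi h] at hrel
      · have hterm : ∀ j ∈ K'.erase (i : Fin N),
            (a (v j) * (g η (v i) (v j) * ∏ l ∈ (w ∪ (K'.erase (i : Fin N)).image v).erase (v j),
                f η l (v j)) +
              κ * d (v j) * (g η (v j) (v i) *
                ∏ l ∈ (w ∪ (K'.erase (i : Fin N)).image v).erase (v j), f η (v j) l)) *
            slavnovDefect η κ a d μ (insert (v i)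
              ((w ∪ (K'.erase (i : Fin N)).image v).erase (v j))) =
            (g η (v i) (v j) * ((∏ l ∈ w, f η l (v j)) *
              ∏ l ∈ (K'.erase (i : Fin N)).erase j, f η (v l) (v j))) *
            slavnovDefect η κ a d μ (w ∪ (K'.erase j).image v) := by
          intro j hj
          have hji := Finset.ne_of_mem_erase hj
          have he : (w ∪ (K'.erase (i : Fin N)).image v).erase (v j) =
              w ∪ ((K'.erase (i : Fin N)).erase j).image v := by
            rw [Finset.erase_union_distrib, Finset.erase_eq_of_notMem (hvw j),
              Finset.image_erase hvi, Finset.image_erase hvi, Finset.image_erase hvi]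
          have he' : insert (v i) (w ∪ ((K'.erase (i : Fin N)).erase j).image v) =
              w ∪ (K'.erase j).image v := by
            rw [← Finset.union_insert, ← Finset.image_insert, Finset.erase_right_comm,
              Finset.insert_erase (Finset.mem_erase.2 ⟨hji.symm, i.2⟩)]
          rw [he, he', (had _ (hε.notMem j)).1, (had _ (hε.notMem j)).2,
            Finset.prod_union (hdis _), Finset.prod_image fun _ _ _ _ h => hvi h]
          ring
        rw [Finset.sum_congr rfl hterm] at hrel
        -- The simple pole of `∏ f(μ_j, v)` at `v = μ_i` dominates the relation; multiplication by
        -- `sinh (-ε) = sinh (μ_i - v_i)` clears it.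
        have hmul : Complex.sinh (-ε) * ∏ j, f η (μ j) (v i) = Complex.sinh (-ε + η) *
            ∏ l ∈ Finset.univ.erase (i : Fin N), f η (μ l) (v i) := by
          have h0 : Complex.sinh (-ε) ≠ 0 := by
            have := (hε i (μ i) (hμr i)).1
            rw [Complex.sinh_neg]
            refine neg_ne_zero.2 ?_
            rwa [add_sub_cancel_left] at this
          rw [← Finset.mul_prod_erase Finset.univ _ (Finset.mem_univ (i : Fin N)), f,
            show μ i - v i = -ε by simp [hv], ← mul_assoc, mul_div_cancel₀ _ h0]
        set Y : Fin N → ℂ := fun j => slavnovDefect η κ a d μ (w ∪ (K'.erase j).image v) with hY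
        have hsum : (shiftMatrix η μ w K' ε *ᵥ fun j => Y j) i = ∑ j ∈ K', (if (i : Fin N) = j then
            Complex.sinh (-ε + η) * (∏ l ∈ Finset.univ.erase (i : Fin N), f η (μ l) (v i)) -
              Complex.sinh (-ε) * ((∏ l ∈ w, f η l (v i)) *
                ∏ l ∈ K'.erase i, f η (v l) (v i))
            else -(Complex.sinh (-ε) * (g η (v i) (v j) * ((∏ l ∈ w, f η l (v j)) *
              ∏ l ∈ (K'.erase (i : Fin N)).erase j, f η (v l) (v j))))) * Y j := by
          rw [← Finset.sum_coe_sort K']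
          refine Finset.sum_congr rfl fun j _ => ?_
          simp only [shiftMatrix, Matrix.of_apply, Subtype.ext_iff, hv]
        rw [hsum, Pi.zero_apply, ← Finset.add_sum_erase K' _ i.2, if_pos rfl,
          Finset.sum_congr rfl fun j hj => by rw [if_neg (Finset.ne_of_mem_erase hj).symm]]
        have hsum2 := congrArg (fun x => -Complex.sinh (-ε) * x) hrel
        simp only [Finset.mul_sum] at hsum2
        rw [← hmul, add_eq_zero_iff_eq_neg, ← Finset.sum_neg_distrib]
        refine Eq.trans ?_ ((congrArg Neg.neg hsum2).trans ?_)
        · ring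
        · rw [← Finset.sum_neg_distrib]
          refine Finset.sum_congr rfl fun j _ => ?_
          ring
      -- Replacing a point of `w` by `v i` completes `K'` and leaves one original point fewer: the
      -- induction hypothesis.
      · intro k hk
        have he : insert (v i) ((w ∪ (K'.erase (i : Fin N)).image v).erase k) =
            w.erase k ∪ K'.image v := by
          rw [Finset.erase_union_distrib, Finset.erase_eq_of_notMem
            (Finset.disjoint_left.1 (hdis _) hk), ← Finset.union_insert, ← Finset.image_insert,
            Finset.insert_erase i.2]
        rw [he, hεw k hk, mul_zero]
    have h0 := congrFun (Matrix.eq_zero_of_mulVec_eq_zero hdet hX)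
      ⟨i₀, Finset.mem_insert_self _ _⟩
    simpa [hK', Finset.erase_insert hi₀] using h0

/-- **Slavnov's formula** for the scalar product of an on-shell and an off-shell Bethe vector. -/
theorem universalScal_eq_slavnov (hη : Complex.sinh η ≠ 0) {a d : ℂ → ℂ} {μ u : Fin N → ℂ}
    (hμ : Function.Injective μ) (hu : Function.Injective u) (hμu : ∀ i j, μ i ≠ u j)
    (hon : OnShell η κ a d μ) (hg : Generic η (Finset.univ.image μ ∪ Finset.univ.image u)) :
    universalScal η (Finset.univ.image μ) (Finset.univ.image u) a d = slavnov η κ a d μ u := by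
  set s := Finset.univ.image u with hs
  have hdis : Disjoint (Finset.univ.image μ) s := by
    rw [Finset.disjoint_left]
    intro x hx hx'
    obtain ⟨i, _, rfl⟩ := Finset.mem_image.1 hx
    obtain ⟨j, _, hj⟩ := Finset.mem_image.1 hx'
    exact hμu i j hj.symm
  have hμr : ∀ i, μ i ∈ Finset.univ.image μ ∪ s := fun i =>
    Finset.mem_union_left _ (Finset.mem_image_of_mem _ (Finset.mem_univ _))
  have hur : ∀ i, u i ∈ Finset.univ.image μ ∪ s := fun i =>
    Finset.mem_union_right _ (Finset.mem_image_of_mem _ (Finset.mem_univ _))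
  set r := Finset.univ.image μ ∪ s with hr
  -- The given weights need not satisfy `a = 1`, `d = 0` at auxiliary points. Off the finite set `r`
  -- they may be redefined, because neither side depends on values there; such weights need not come
  -- from a representation.
  set a' : ℂ → ℂ := fun x => if x ∈ r then a x else 1 with ha'
  set d' : ℂ → ℂ := fun x => if x ∈ r then d x else 0 with hd'
  have ha : ∀ x ∈ r, a x = a' x := fun x hx => by simp [ha', hx]
  have hd : ∀ x ∈ r, d x = d' x := fun x hx => by simp [hd', hx]
  have hon' : OnShell η κ a' d' μ := fun j => by
    rw [← ha _ (hμr j), ← hd _ (hμr j)]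
    exact hon j
  have hsc : s.card = N := by
    rw [hs, Finset.card_image_of_injective _ hu, Finset.card_univ, Fintype.card_fin]
  have h := (eventually_slavnovDefect_eq_zero hη hμ hon' hdis hg (fun x hx => by
    rw [← hr] at hx
    exact ⟨if_neg hx, if_neg hx⟩) N s (le_refl _) hsc ∅ (by simp)).exists
  obtain ⟨ε, hε⟩ := h
  rw [Finset.image_empty, Finset.union_empty, slavnovDefect, sub_eq_zero,
    ← slavnov_eq_enum a' d' μ hu hs.symm] at hε
  rw [WeightPoly.congr (universalScal_mem hdis hg.distinct) ha hd, hε, slavnov, slavnov]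
  congr 2
  · exact Finset.prod_congr rfl fun j _ => (hd _ (hμr j)).symm
  · congr 1
    ext i j
    simp only [slavnovMatrix, Matrix.of_apply]
    rw [ha _ (hur j), hd _ (hur j)]

end

/-! ### Scalar products for arbitrary tuples of arguments -/

theorem finProd_image {n : Type} [Fintype n] [DecidableEq n] (B : ℂ → Matrix n n ℂ)
    (hB : ∀ u v, Commute (B u) (B v)) {N : ℕ} {u : Fin N → ℂ} (hu : Function.Injective u) :
    finProd B hB (Finset.univ.image u) = (List.ofFn fun k => B (u k)).prod := by
  induction N with
  | zero => simp [finProd_empty]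
  | succ N ih =>
    have h1 : Finset.univ.image u = insert (u 0) (Finset.univ.image fun i : Fin N => u i.succ) := by
      ext x
      simp only [Finset.mem_image, Finset.mem_univ, true_and, Finset.mem_insert,
        Fin.exists_fin_succ]
      exact or_congr_left eq_comm
    have h2 : u 0 ∉ Finset.univ.image fun i : Fin N => u i.succ := by
      simp only [Finset.mem_image, Finset.mem_univ, true_and, not_exists]
      exact fun i h => Fin.succ_ne_zero i (hu h)
    rw [h1, finProd_insert _ _ h2, List.ofFn_succ, List.prod_cons,
      ih (u := fun i => u i.succ) (hu.comp (Fin.succ_injective _))]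

theorem eq_at_zero_of_eventually_eq {x y : ℂ → ℂ} (hx : ContinuousAt x 0) (hy : ContinuousAt y 0)
    (h : ∀ᶠ ε in 𝓝[≠] (0 : ℂ), x ε = y ε) : x 0 = y 0 :=
  tendsto_nhds_unique ((hx.tendsto.mono_left nhdsWithin_le_nhds).congr' h)
    (hy.tendsto.mono_left nhdsWithin_le_nhds)

namespace YBRep

variable {η : ℂ} (ρ : YBRep η)

/-- `⟨ω| C(v_1) ⋯ C(v_N) B(u_1) ⋯ B(u_N) |Ω⟩`. -/
def tupleScal {N : ℕ} (v u : Fin N → ℂ) : ℂ :=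
  ρ.ω ⬝ᵥ (((List.ofFn fun k => ρ.C (v k)).prod * (List.ofFn fun k => ρ.B (u k)).prod) *ᵥ ρ.Ω)

theorem tupleScal_eq_scal {N : ℕ} {v u : Fin N → ℂ} (hv : Function.Injective v)
    (hu : Function.Injective u) :
    ρ.tupleScal v u = ρ.scal (Finset.univ.image v) (Finset.univ.image u) := by
  rw [tupleScal, scal, dual, bethe, finProd_image _ _ hv, finProd_image _ _ hu,
    ← Matrix.mulVec_mulVec, Matrix.dotProduct_mulVec]

/-- The vacuum eigenvalues and the operators `B` and `C` depend continuously on the spectral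
parameter. -/
def IsContinuous : Prop := Continuous ρ.B ∧ Continuous ρ.C ∧ Continuous ρ.a ∧ Continuous ρ.d

variable {ρ}

theorem IsContinuous.tupleScal (hρ : ρ.IsContinuous) {N : ℕ} {v u : ℂ → Fin N → ℂ}
    (hv : Continuous v) (hu : Continuous u) : Continuous fun ε => ρ.tupleScal (v ε) (u ε) := by
  have h : ∀ {F : ℂ → Matrix ρ.ι ρ.ι ℂ} (_ : Continuous F) {w : ℂ → Fin N → ℂ}
      (_ : Continuous w), Continuous fun ε => (List.ofFn fun k => F (w ε k)).prod := by
    intro F hF w hw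
    simp only [List.ofFn_eq_map]
    exact continuous_list_prod _ fun k _ => hF.comp ((continuous_apply k).comp hw)
  exact continuous_const.dotProduct
    (((h hρ.2.1 hv).matrix_mul (h hρ.1 hu)).matrix_mulVec continuous_const)

/-- Transposition interchanges the two sets but preserves the vacuum eigenvalues, and the scalar
product is a universal function of these. -/
theorem scal_comm {t s : Finset ℂ} (hts : Disjoint t s) (hd : Distinct (t ∪ s)) :
    ρ.scal t s = ρ.scal s t := by
  rw [← ρ.scal_transpose t s, ρ.scal_eq hts hd, ρ.transpose.scal_eq hts hd]
  rfl

/-- The scalar product is symmetric in the two sets of arguments. -/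
theorem IsContinuous.tupleScal_comm (hρ : ρ.IsContinuous) {N : ℕ} (v u : Fin N → ℂ) :
    ρ.tupleScal v u = ρ.tupleScal u v := by
  -- The `2N` arguments move with the pairwise distinct velocities `0, …, 2N - 1`, so for small `ε ≠
  -- 0` they are all distinct modulo `iπ`.
  set v' : ℂ → Fin N → ℂ := fun ε k => v k + (k : ℕ) * ε with hv'
  set u' : ℂ → Fin N → ℂ := fun ε k => u k + ((N + k : ℕ) : ℂ) * ε with hu'
  have cv : Continuous v' := by fun_prop
  have cu : Continuous u' := by fun_prop
  have h := eq_at_zero_of_eventually_eq (hρ.tupleScal cv cu).continuousAt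
    (hρ.tupleScal cu cv).continuousAt ?_
  · simpa [hv', hu'] using h
  have h1 : ∀ᶠ ε in 𝓝[≠] (0 : ℂ), ∀ i j, i ≠ j → Complex.sinh (v' ε i - v' ε j) ≠ 0 :=
    eventually_all.2 fun i => eventually_all.2 fun j => by
      by_cases hij : i = j
      · exact Eventually.of_forall fun ε h => absurd hij h
      filter_upwards [eventually_sinh_ne_zero (v i - v j) (r := ((i : ℕ) : ℂ) - (j : ℕ))
        (sub_ne_zero.2 fun h => hij (Fin.ext (by exact_mod_cast h)))] with ε hε _
      convert hε using 2
      simp only [hv']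
      ring
  have h2 : ∀ᶠ ε in 𝓝[≠] (0 : ℂ), ∀ i j, i ≠ j → Complex.sinh (u' ε i - u' ε j) ≠ 0 :=
    eventually_all.2 fun i => eventually_all.2 fun j => by
      by_cases hij : i = j
      · exact Eventually.of_forall fun ε h => absurd hij h
      filter_upwards [eventually_sinh_ne_zero (u i - u j) (r := ((N + i : ℕ) : ℂ) - ((N + j : ℕ) : ℂ))
        (sub_ne_zero.2 fun h => hij (Fin.ext (by
          have : N + (i : ℕ) = N + j := by exact_mod_cast h
          omega)))] with ε hε _
      convert hε using 2
      simp only [hu']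
      ring
  have h3 : ∀ᶠ ε in 𝓝[≠] (0 : ℂ), ∀ i j, Complex.sinh (v' ε i - u' ε j) ≠ 0 :=
    eventually_all.2 fun i => eventually_all.2 fun j => by
      filter_upwards [eventually_sinh_ne_zero (v i - u j) (r := ((i : ℕ) : ℂ) - ((N + j : ℕ) : ℂ))
        (sub_ne_zero.2 fun h => by
          have : (i : ℕ) = N + j := by exact_mod_cast h
          omega)] with ε hε
      convert hε using 2
      simp only [hv', hu']
      ring
  filter_upwards [h1, h2, h3] with ε h1 h2 h3
  have hvi : Function.Injective (v' ε) := fun i j h => by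
    by_contra hij
    exact h1 i j hij (by rw [h]; simp)
  have hui : Function.Injective (u' ε) := fun i j h => by
    by_contra hij
    exact h2 i j hij (by rw [h]; simp)
  rw [ρ.tupleScal_eq_scal hvi hui, ρ.tupleScal_eq_scal hui hvi]
  refine scal_comm ?_ ?_
  · rw [Finset.disjoint_left]
    intro x hx hx'
    obtain ⟨i, _, rfl⟩ := Finset.mem_image.1 hx
    obtain ⟨j, _, hj⟩ := Finset.mem_image.1 hx'
    exact h3 i j (by rw [hj]; simp)
  · intro x hx y hy hxy
    rw [Finset.mem_union, Finset.mem_image, Finset.mem_image] at hx hy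
    rcases hx with ⟨i, _, rfl⟩ | ⟨i, _, rfl⟩ <;> rcases hy with ⟨j, _, rfl⟩ | ⟨j, _, rfl⟩
    · exact h1 i j fun h => hxy (by rw [h])
    · exact h3 i j
    · rw [sinh_sub_comm]
      exact neg_ne_zero.2 (h3 j i)
    · exact h2 i j fun h => hxy (by rw [h])

/-- Slavnov's formula without any restriction on the off-shell arguments other than that the
determinant be defined. -/
theorem IsContinuous.tupleScal_mul (hρ : ρ.IsContinuous) (hη : Complex.sinh η ≠ 0) {κ : ℂ} {N : ℕ}
    {μ u : Fin N → ℂ}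
    (hμ : ∀ i j, i ≠ j → Complex.sinh (μ i - μ j) ≠ 0 ∧ Complex.sinh (μ i - μ j + η) ≠ 0)
    (hon : OnShell η κ ρ.a ρ.d μ) (hu : ∀ i j, Complex.sinh (μ i - u j) ≠ 0) :
    ρ.tupleScal μ u * (sinhVandermonde u * ∏ j, ∏ k ∈ Finset.Ioi j, Complex.sinh (μ k - μ j)) =
      (∏ j, ρ.d (μ j)) * (slavnovMatrix η κ ρ.a ρ.d μ u).det := by
  have hμi : Function.Injective μ := fun i j h => by
    by_contra hij
    exact (hμ i j hij).1 (by rw [h]; simp)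
  -- Here `μ` must stay fixed to remain on shell, so the velocities `k + 1` of the `u k` are
  -- distinct and also nonzero. The identity is stated without dividing by the Vandermonde product
  -- of `u`, which may vanish at `ε = 0`.
  set u' : ℂ → Fin N → ℂ := fun ε k => u k + ((k + 1 : ℕ) : ℂ) * ε with hu'
  have cu : Continuous u' := by fun_prop
  have cuk : ∀ k, Continuous fun ε => u' ε k := fun k => (continuous_apply k).comp cu
  set X := ∏ j, ∏ k ∈ Finset.Ioi j, Complex.sinh (μ k - μ j) with hX
  have hX0 : X ≠ 0 := Finset.prod_ne_zero_iff.2 fun i _ => Finset.prod_ne_zero_iff.2 fun j hj =>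
    (hμ j i (Finset.mem_Ioi.1 hj).ne').1
  have hu0 : u' 0 = u := by
    funext k
    simp [hu']
  have h := eq_at_zero_of_eventually_eq
    (x := fun ε => ρ.tupleScal μ (u' ε) * (sinhVandermonde (u' ε) * X))
    (y := fun ε => (∏ j, ρ.d (μ j)) * (slavnovMatrix η κ ρ.a ρ.d μ (u' ε)).det) ?_ ?_ ?_
  · simpa only [hu0] using h
  · refine ((hρ.tupleScal continuous_const cu).mul (Continuous.mul ?_
      continuous_const)).continuousAt
    unfold sinhVandermonde
    fun_prop
  · refine continuousAt_const.mul ?_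
    refine (Continuous.matrix_det continuous_id).continuousAt.comp
      (continuousAt_pi.2 fun i => continuousAt_pi.2 fun j => ?_)
    simp only [slavnovEntry, Matrix.of_apply]
    have ca := hρ.2.2.1.comp (cuk j)
    have cd := hρ.2.2.2.comp (cuk j)
    refine ContinuousAt.mul (ContinuousAt.div continuousAt_const ?_ ?_) (Continuous.continuousAt ?_)
    · exact (Complex.continuous_sinh.comp (continuous_const.sub (cuk j))).continuousAt
    · simpa only [hu0] using hu i j
    · have c1 : ∀ l, Continuous fun ε => Complex.sinh (μ l - u' ε j + η) := fun l =>
        Complex.continuous_sinh.comp ((continuous_const.sub (cuk j)).add continuous_const)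
      have c2 : ∀ l, Continuous fun ε => Complex.sinh (μ l - u' ε j - η) := fun l =>
        Complex.continuous_sinh.comp ((continuous_const.sub (cuk j)).sub continuous_const)
      exact (ca.mul (continuous_finsetProd _ fun l _ => c1 l)).sub
        ((continuous_const.mul cd).mul (continuous_finsetProd _ fun l _ => c2 l))
  have hk0 : ∀ k : Fin N, ((k + 1 : ℕ) : ℂ) ≠ 0 := fun k =>
    Nat.cast_ne_zero.2 (Nat.succ_ne_zero _)
  have h1 : ∀ (c : ℂ) (i j : Fin N), i ≠ j →
      ∀ᶠ ε in 𝓝[≠] (0 : ℂ), Complex.sinh (u' ε i - u' ε j + c) ≠ 0 := fun c i j hij => by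
    filter_upwards [eventually_sinh_ne_zero (u i - u j + c)
      (r := ((i + 1 : ℕ) : ℂ) - ((j + 1 : ℕ) : ℂ)) (sub_ne_zero.2 fun h => hij (Fin.ext (by
          have : (i : ℕ) + 1 = j + 1 := by exact_mod_cast h
          omega)))] with ε hε
    convert hε using 2
    simp only [hu']
    ring
  have h2 : ∀ (c : ℂ) (i j : Fin N),
      ∀ᶠ ε in 𝓝[≠] (0 : ℂ), Complex.sinh (u' ε i - μ j + c) ≠ 0 := fun c i j => by
    filter_upwards [eventually_sinh_ne_zero (u i - μ j + c) (hk0 i)] with ε hε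
    convert hε using 2
    simp only [hu']
    ring
  have h3 : ∀ (c : ℂ) (i j : Fin N),
      ∀ᶠ ε in 𝓝[≠] (0 : ℂ), Complex.sinh (μ j - u' ε i + c) ≠ 0 := fun c i j => by
    filter_upwards [eventually_sinh_ne_zero (μ j - u i + c) (neg_ne_zero.2 (hk0 i))] with ε hε
    convert hε using 2
    simp only [hu']
    ring
  have h4 : ∀ᶠ ε in 𝓝[≠] (0 : ℂ), ∀ i j, i ≠ j →
      Complex.sinh (u' ε i - u' ε j + 0) ≠ 0 ∧ Complex.sinh (u' ε i - u' ε j + η) ≠ 0 :=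
    eventually_all.2 fun i => eventually_all.2 fun j => by
      by_cases hij : i = j
      · exact Eventually.of_forall fun ε h => absurd hij h
      filter_upwards [h1 0 i j hij, h1 η i j hij] with ε h h' _
      exact ⟨h, h'⟩
  have h5 : ∀ᶠ ε in 𝓝[≠] (0 : ℂ), ∀ i j,
      (Complex.sinh (u' ε i - μ j + 0) ≠ 0 ∧ Complex.sinh (u' ε i - μ j + η) ≠ 0) ∧
      Complex.sinh (μ j - u' ε i + 0) ≠ 0 ∧ Complex.sinh (μ j - u' ε i + η) ≠ 0 :=
    eventually_all.2 fun i => eventually_all.2 fun j => by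
      filter_upwards [h2 0 i j, h2 η i j, h3 0 i j, h3 η i j] with ε h h' h'' h'''
      exact ⟨⟨h, h'⟩, h'', h'''⟩
  filter_upwards [h4, h5] with ε h4 h5
  simp only [add_zero] at h4 h5
  have hui : Function.Injective (u' ε) := fun i j h => by
    by_contra hij
    exact (h4 i j hij).1 (by rw [h]; simp)
  have hne : ∀ i j, μ i ≠ u' ε j := fun i j h => (h5 j i).1.1 (by rw [h]; simp)
  have hg : Generic η (Finset.univ.image μ ∪ Finset.univ.image (u' ε)) := by
    intro x hx y hy hxy
    rw [Finset.mem_union, Finset.mem_image, Finset.mem_image] at hx hy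
    rcases hx with ⟨i, _, rfl⟩ | ⟨i, _, rfl⟩ <;> rcases hy with ⟨j, _, rfl⟩ | ⟨j, _, rfl⟩
    · exact hμ i j fun h => hxy (by rw [h])
    · exact (h5 j i).2
    · exact (h5 i j).1
    · exact h4 i j fun h => hxy (by rw [h])
  have hdis : Disjoint (Finset.univ.image μ) (Finset.univ.image (u' ε)) := by
    rw [Finset.disjoint_left]
    intro x hx hx'
    obtain ⟨i, _, rfl⟩ := Finset.mem_image.1 hx
    obtain ⟨j, _, hj⟩ := Finset.mem_image.1 hx'
    exact hne i j hj.symm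
  rw [ρ.tupleScal_eq_scal hμi hui, ρ.scal_eq hdis hg.distinct,
    universalScal_eq_slavnov hη hμi hui hne hon hg, slavnov]
  exact div_mul_cancel₀ _ (mul_ne_zero
    (sinhVandermonde_ne_zero fun i j hij => (h4 i j hij).1) hX0)

end YBRep

theorem chainRep_isContinuous {M : ℕ} (η : ℂ) (ξ : Fin M → ℂ) (l : List (Fin M)) (hl : l.Nodup) :
    (chainRep η ξ l hl).IsContinuous := by
  refine ⟨continuous_chainT_entry η ξ l _ _, continuous_chainT_entry η ξ l _ _, ?_, ?_⟩
  · exact continuous_list_prod _ fun m _ => by fun_prop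
  · exact continuous_list_prod _ fun m _ => by fun_prop

/-! ### The Jordan--Wigner transformation -/

section Parity

variable {M : ℕ}

/-- The parity operator of the sites in `S`. -/
def par (S : Finset (Fin M)) : FockOp M :=
  Matrix.diagonal fun n => ∏ i ∈ S, if n i = true then -1 else 1

theorem par_mul_self (S : Finset (Fin M)) : par S * par S = 1 := by
  rw [par, Matrix.diagonal_mul_diagonal, ← Matrix.diagonal_one]
  congr 1
  funext n
  rw [← Finset.prod_mul_distrib]
  exact Finset.prod_eq_one fun i _ => by split_ifs <;> simp

theorem par_comm (S R : Finset (Fin M)) : par S * par R = par R * par S := by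
  rw [par, par, Matrix.diagonal_mul_diagonal, Matrix.diagonal_mul_diagonal]
  congr 1
  funext n
  exact mul_comm _ _

theorem par_empty : par (∅ : Finset (Fin M)) = 1 := by simp [par]

theorem par_insert {j : Fin M} {S : Finset (Fin M)} (hj : j ∉ S) :
    par (insert j S) = par {j} * par S := by
  rw [par, par, par, Matrix.diagonal_mul_diagonal]
  congr 1
  funext n
  rw [Finset.prod_insert hj, Finset.prod_singleton]

theorem par_singleton_mul_site (j : Fin M) (X : Matrix Bool Bool ℂ) :
    par {j} * site j X = site j (Matrix.of fun a b => if a = true then -X a b else X a b) := by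
  ext n' n
  simp only [par, Matrix.diagonal_mul, site, Matrix.of_apply, Finset.prod_singleton]
  split_ifs <;> simp

theorem site_mul_par_singleton (j : Fin M) (X : Matrix Bool Bool ℂ) :
    site j X * par {j} = site j (Matrix.of fun a b => if b = true then -X a b else X a b) := by
  ext n' n
  simp only [par, Matrix.mul_diagonal, site, Matrix.of_apply, Finset.prod_singleton]
  split_ifs <;> simp

theorem par_mul_site_of_notMem {j : Fin M} {S : Finset (Fin M)} (hj : j ∉ S)
    (X : Matrix Bool Bool ℂ) : par S * site j X = site j X * par S := by
  ext n' n
  simp only [par, Matrix.diagonal_mul, Matrix.mul_diagonal, site, Matrix.of_apply]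
  split_ifs with h
  · rw [mul_comm]
    congr 1
    refine Finset.prod_congr rfl fun i hi => ?_
    rw [h i fun hij => hj (hij ▸ hi)]
  · simp

/-- The sign of the matrix unit `E_{ab}` under conjugation by the parity. -/
def grade (a b : Bool) : ℂ := if a = b then 1 else -1

theorem par_mul_site_single (j : Fin M) (S : Finset (Fin M)) (a b : Bool) (c : ℂ) :
    par S * site j (Matrix.single a b c) =
      (if j ∈ S then grade a b else 1) • (site j (Matrix.single a b c) * par S) := by
  split_ifs with hj
  · obtain ⟨R, hR, rfl⟩ : ∃ R, j ∉ R ∧ insert j R = S :=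
      ⟨S.erase j, Finset.notMem_erase _ _, Finset.insert_erase hj⟩
    rw [par_insert hR, mul_assoc, par_mul_site_of_notMem hR, ← mul_assoc, ← mul_assoc,
      par_singleton_mul_site, site_mul_par_singleton, ← smul_mul_assoc]
    congr 1
    ext n' n
    simp only [site, Matrix.of_apply, Matrix.smul_apply, smul_eq_mul]
    split_ifs with h1 h2 h3 h3
    all_goals cases a <;> cases b <;> simp_all [grade, Matrix.single]
  · rw [par_mul_site_of_notMem hj, one_smul]

/-- The fermionic matrix units at the site `j`. -/
def funit (j : Fin M) (a b : Bool) : FockOp M :=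
  (if a = b then 1 else par (Finset.Iio j)) * site j (Matrix.single a b 1)

theorem funit_mul_self (j : Fin M) (a b c d : Bool) :
    funit j a b * funit j c d = if b = c then funit j a d else 0 := by
  have hpar : ∀ X : Matrix Bool Bool ℂ, site j X * par (Finset.Iio j) =
      par (Finset.Iio j) * site j X := fun X => (par_mul_site_of_notMem (by simp) X).symm
  have key : ∀ p q : Prop, [Decidable p] → [Decidable q] → ∀ X Y : Matrix Bool Bool ℂ,
      ((if p then 1 else par (Finset.Iio j)) * site j X) *
        ((if q then 1 else par (Finset.Iio j)) * site j Y) =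
      (if (p ↔ q) then 1 else par (Finset.Iio j)) * site j (X * Y) := by
    intro p q _ _ X Y
    have := par_mul_self (Finset.Iio j)
    by_cases hp : p <;> by_cases hq : q <;> simp only [hp, hq, if_true, if_false, one_mul, site_mul,
      iff_false, not_true, iff_true]
    · rw [← mul_assoc, hpar, mul_assoc]
    · rw [mul_assoc]
    · rw [mul_assoc, ← mul_assoc (site j X), hpar, mul_assoc, ← mul_assoc, this, one_mul]
  rw [funit, funit, key]
  by_cases hbc : b = c
  · subst hbc
    rw [if_pos rfl, funit, Matrix.single_mul_single_same, one_mul]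
    congr 1
    cases a <;> cases b <;> cases d <;> simp
  · rw [if_neg hbc, Matrix.single_mul_single_of_ne _ _ _ _ hbc]
    have : site j (0 : Matrix Bool Bool ℂ) = 0 := map_zero (siteHom j)
    rw [this, mul_zero]

/-- Matrix units that change the occupation are odd. If both are odd, the parity string of the
larger site `j` contains `i` and produces the single sign; the string of `i` does not meet `j`. -/
theorem funit_mul_of_lt {i j : Fin M} (hij : i < j) (a b c d : Bool) :
    funit i a b * funit j c d =
      (if a = b ∨ c = d then (1 : ℂ) else -1) • (funit j c d * funit i a b) := by
  have h1 := par_mul_site_single i (Finset.Iio j) a b 1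
  rw [if_pos (Finset.mem_Iio.2 hij)] at h1
  have h2 := par_mul_site_of_notMem (j := j) (S := Finset.Iio i) (by simp [hij.le])
    (Matrix.single c d 1)
  have h3 := (site_comm hij.ne (Matrix.single a b 1) (Matrix.single c d 1)).eq
  have h4 := par_comm (Finset.Iio i) (Finset.Iio j)
  unfold funit
  generalize site i (Matrix.single a b 1) = X at *
  generalize site j (Matrix.single c d 1) = Y at *
  generalize par (Finset.Iio i) = p at *
  generalize par (Finset.Iio j) = q at *
  by_cases hab : a = b <;> by_cases hcd : c = d <;>
    simp only [hab, hcd, if_true, if_false, or_true, or_false, one_mul, one_smul, grade]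
      at h1 ⊢
  · exact h3
  · rw [← mul_assoc, ← h1, mul_assoc, h3, mul_assoc]
  · rw [mul_assoc, h3, ← mul_assoc, h2, mul_assoc]
  · have h5 : X * q = (-1 : ℂ) • (q * X) := by rw [h1, smul_smul]; simp
    rw [mul_assoc, ← mul_assoc X, h5, smul_mul_assoc, mul_smul_comm, mul_assoc q, h3, ← mul_assoc,
      ← mul_assoc, h4, mul_assoc, mul_assoc, ← mul_assoc p, h2, mul_assoc Y, mul_assoc]

theorem funit_mul_of_ne {i j : Fin M} (hij : i ≠ j) (a b c d : Bool) :
    funit i a b * funit j c d =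
      (if a = b ∨ c = d then (1 : ℂ) else -1) • (funit j c d * funit i a b) := by
  rcases lt_or_gt_of_ne hij with h | h
  · exact funit_mul_of_lt h a b c d
  · rw [funit_mul_of_lt h c d a b, smul_smul]
    by_cases hab : a = b <;> by_cases hcd : c = d <;> simp [hab, hcd]

theorem funit_false_add_funit_true (j : Fin M) :
    funit j false false + funit j true true = 1 := by
  rw [funit, funit, if_pos rfl, if_pos rfl, one_mul, one_mul, ← siteHom_apply, ← siteHom_apply,
    ← map_add, ← map_one (siteHom j)]
  congr 1
  ext a b
  cases a <;> cases b <;> simp [Matrix.single]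

theorem ann_eq_funit (j : Fin M) : ann j = funit j false true := by
  ext n' n
  rw [ann, funit, if_neg (by simp), par, Matrix.diagonal_mul, site]
  simp only [Matrix.of_apply]
  by_cases h : n j = true ∧ n' = Function.update n j false
  · obtain ⟨h1, rfl⟩ := h
    rw [if_pos ⟨h1, rfl⟩, if_pos fun i hi => Function.update_of_ne hi _ _, Function.update_self, h1,
      Matrix.single_apply_same, mul_one, ← Finset.prod_const, Finset.prod_filter,
      ← Finset.prod_subset (Finset.subset_univ (Finset.Iio j))]
    · refine Finset.prod_congr rfl fun i hi => ?_
      rw [Finset.mem_Iio] at hi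
      rw [Function.update_of_ne hi.ne]
      simp [hi]
    · intro i _ hi
      rw [Finset.mem_Iio] at hi
      rw [if_neg fun h => hi h.1]
  · rw [if_neg h]
    split_ifs with h1
    · rw [Matrix.single_apply_of_ne, mul_zero]
      rintro ⟨h2, h3⟩
      refine h ⟨h3.symm, funext fun i => ?_⟩
      by_cases hi : i = j
      · rw [hi, Function.update_self, h2]
      · rw [Function.update_of_ne hi, h1 i hi]
    · rw [mul_zero]

theorem cre_eq_funit (j : Fin M) : cre j = funit j true false := by
  have h1 : (par (Finset.Iio j) : FockOp M)ᴴ = par (Finset.Iio j) := by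
    rw [par, Matrix.diagonal_conjTranspose]
    congr 1
    funext n
    simp only [Pi.star_apply, star_prod]
    exact Finset.prod_congr rfl fun i _ => by split_ifs <;> simp
  have h2 : (site j (Matrix.single false true 1))ᴴ = site j (Matrix.single true false 1) := by
    ext n' n
    simp only [Matrix.conjTranspose_apply, site, Matrix.of_apply, eq_comm (a := n _), ne_eq]
    split_ifs
    · cases n' j <;> cases n j <;> simp [Matrix.single]
    · simp
  rw [cre, ann_eq_funit, funit, funit, if_neg (by simp), if_neg (by simp),
    Matrix.conjTranspose_mul, h1, h2, par_mul_site_of_notMem (by simp)]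

theorem num_eq_funit (j : Fin M) : num j = funit j true true := by
  rw [num, ann_eq_funit, cre_eq_funit, funit_mul_self, if_pos rfl]

end Parity

/-! ### The fermionic monodromy matrix -/

section Blocks

variable {M : ℕ}

/-- Operators on `M + 1` modes as block matrices with respect to the auxiliary mode. -/
def blocks : FockOp (M + 1) →ₐ[ℂ] Matrix Bool Bool (FockOp M) :=
  AlgHom.ofLinearMap
    { toFun := fun X => Matrix.of fun p q => auxBlock X p q
      map_add' := fun _ _ => rfl
      map_smul' := fun _ _ => rfl }
    (by
      ext p q n' n
      simp only [LinearMap.coe_mk, AddHom.coe_mk, Matrix.of_apply, auxBlock, Matrix.one_apply,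
        Fin.cons_inj]
      by_cases hpq : p = q <;> simp [hpq, Matrix.one_apply])
    (by
      intro X Y
      ext p q n' n
      simp only [LinearMap.coe_mk, AddHom.coe_mk, Matrix.of_apply, auxBlock, Matrix.mul_apply,
        Matrix.sum_apply]
      rw [← Fintype.sum_prod_type', ← (Fin.consEquiv fun _ : Fin (M + 1) => Bool).sum_comp]
      rfl)

theorem blocks_apply (X : FockOp (M + 1)) (p q : Bool) : blocks X p q = auxBlock X p q := rfl

theorem blocks_conjTranspose (X : FockOp (M + 1)) (p q : Bool) :
    blocks Xᴴ p q = (blocks X q p)ᴴ := rfl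

theorem blocks_ann_zero :
    blocks (ann (0 : Fin (M + 1))) = Matrix.single false true (1 : FockOp M) := by
  ext p q n' n
  simp only [blocks_apply, auxBlock, ann, Matrix.of_apply, Fin.cons_zero, Fin.update_cons_zero,
    Fin.cons_inj, Fin.not_lt_zero, false_and, Finset.filter_false, Finset.card_empty, pow_zero]
  cases p <;> cases q <;> simp [Matrix.single, Matrix.one_apply]

/-- The auxiliary mode precedes all sites, so an occupied auxiliary mode contributes one more sign
to `c_m`. -/
theorem blocks_ann_succ (m : Fin M) :
    blocks (ann m.succ) = Matrix.diagonal fun p => grade false p • ann m := by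
  ext p q n' n
  simp only [blocks_apply, auxBlock, ann, Matrix.of_apply, Fin.cons_succ, ← Fin.cons_update,
    Fin.cons_inj, Matrix.diagonal_apply]
  have hcard : (Finset.univ.filter fun i : Fin (M + 1) =>
      i < m.succ ∧ (Fin.cons q n : Occ (M + 1)) i = true).card =
      (if q = true then 1 else 0) + (Finset.univ.filter fun i : Fin M => i < m ∧ n i = true).card := by
    rw [Finset.card_filter, Fin.sum_univ_succ, Finset.card_filter]
    simp
  rw [hcard]
  by_cases hpq : p = q
  · subst hpq
    cases p <;> simp [grade, pow_add]
  · simp [hpq]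

theorem blocks_cre_zero :
    blocks (cre (0 : Fin (M + 1))) = Matrix.single true false (1 : FockOp M) := by
  ext1 p q
  rw [cre, blocks_conjTranspose, blocks_ann_zero]
  cases p <;> cases q <;> simp [Matrix.single]

theorem blocks_cre_succ (m : Fin M) :
    blocks (cre m.succ) = Matrix.diagonal fun p => grade false p • cre m := by
  ext1 p q
  rw [cre, blocks_conjTranspose, blocks_ann_succ, cre]
  cases p <;> cases q <;> simp [grade]

/-- The blocks of the fermionic `L`-operator with weights `b` and `c` at the site `m`. -/
def fermBlock (b c : ℂ) (m : Fin M) : Matrix Bool Bool (FockOp M) :=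
  Matrix.of fun p q => match p, q with
    | false, false => funit m false false + b • funit m true true
    | false, true => c • funit m true false
    | true, false => c • funit m false true
    | true, true => b • funit m false false - funit m true true

variable (η : ℂ) (ξ : Fin M → ℂ)

/-- The weight `sh w / sh (w + η)`. -/
def wb (w : ℂ) : ℂ := Complex.sinh w / Complex.sinh (w + η)

/-- The weight `sh η / sh (w + η)`. -/
def wc (w : ℂ) : ℂ := Complex.sinh η / Complex.sinh (w + η)

/-- The blocks of `L_m(u)`. -/
def fermL (u : ℂ) (m : Fin M) : Matrix Bool Bool (FockOp M) :=
  fermBlock (wb η (u - ξ m)) (wc η (u - ξ m)) m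

theorem blocks_Lop (m : Fin M) (u : ℂ) : blocks (Lop η ξ m u) = fermL η ξ u m := by
  have h1 : (1 : Matrix Bool Bool (FockOp M)) =
      Matrix.diagonal fun _ => funit m false false + funit m true true := by
    rw [funit_false_add_funit_true, Matrix.diagonal_one]
  have h2 : (funit m false false : FockOp M) = 1 - funit m true true := by
    rw [← funit_false_add_funit_true m]
    abel
  rw [Lop, Rop, num, num]
  simp only [map_add, map_sub, map_smul, map_mul, map_one, blocks_ann_zero, blocks_ann_succ,
    blocks_cre_zero, blocks_cre_succ]
  simp only [ann_eq_funit, cre_eq_funit]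
  ext1 p q
  simp only [fermL, fermBlock, wb, wc]
  cases p <;> cases q <;>
    simp [Matrix.mul_apply, Matrix.diagonal_apply, Matrix.single, grade,
      funit_mul_self, h2]; module

/-- The fermionic monodromy matrix of the sites in the list `l`. -/
def fermT (l : List (Fin M)) (u : ℂ) : Matrix Bool Bool (FockOp M) :=
  (l.map (fermL η ξ u)).prod

theorem fermT_cons (m : Fin M) (l : List (Fin M)) (u : ℂ) :
    fermT η ξ (m :: l) u = fermL η ξ u m * fermT η ξ l u := by
  simp [fermT]

theorem auxBlock_monodromy (u : ℂ) (p q : Bool) :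
    auxBlock (monodromy η ξ u) p q = fermT η ξ (List.finRange M).reverse u p q := by
  rw [← blocks_apply, monodromy, map_list_prod, List.map_reverse, fermT, List.map_reverse,
    List.ofFn_eq_map, List.map_map]
  simp only [Function.comp_def, blocks_Lop]

/-- The Jordan--Wigner twist of the auxiliary space. -/
def auxPar (S : Finset (Fin M)) : Matrix Bool Bool (FockOp M) :=
  Matrix.diagonal fun p => if p = true then par S else 1

theorem chainL_apply_eq (u : ℂ) (m : Fin M) :
    chainL η ξ u m false false = Complex.sinh (u - ξ m + η) • site m (Matrix.single false false 1) +
        Complex.sinh (u - ξ m) • site m (Matrix.single true true 1) ∧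
      chainL η ξ u m false true = Complex.sinh η • site m (Matrix.single true false 1) ∧
      chainL η ξ u m true false = Complex.sinh η • site m (Matrix.single false true 1) ∧
      chainL η ξ u m true true = Complex.sinh (u - ξ m) • site m (Matrix.single false false 1) +
        Complex.sinh (u - ξ m + η) • site m (Matrix.single true true 1) := by
  simp only [chainL_apply, ← siteHom_apply, ← map_smul, ← map_add]
  refine ⟨?_, ?_, ?_, ?_⟩ <;> congr 1 <;> ext a b <;> cases a <;> cases b <;>
    simp [sixVertexL, sixVertexR, Matrix.single]

/-- The Jordan–Wigner string of the hopping terms is the parity of the sites below `m`, which the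
twist of the auxiliary mode absorbs. The sign of `n_m` in the block `D` is the parity of `m` itself,
so the twist grows by one site. -/
theorem fermL_mul_auxPar (m : Fin M) (u : ℂ) (hu : Complex.sinh (u - ξ m + η) ≠ 0) :
    Complex.sinh (u - ξ m + η) • (fermL η ξ u m * auxPar (Finset.Iio m)) =
      auxPar (insert m (Finset.Iio m)) * chainL η ξ u m := by
  obtain ⟨h1, h2, h3, h4⟩ := chainL_apply_eq η ξ u m
  have hm : m ∉ Finset.Iio m := by simp
  have hpar : ∀ X : Matrix Bool Bool ℂ, site m X * par (Finset.Iio m) =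
      par (Finset.Iio m) * site m X := fun X => (par_mul_site_of_notMem hm X).symm
  have hps : ∀ a b, par {m} * site m (Matrix.single a b 1) =
      grade false a • site m (Matrix.single a b 1) := by
    intro a b
    rw [par_singleton_mul_site, ← siteHom_apply, ← siteHom_apply, ← map_smul]
    congr 1
    ext a' b'
    cases a <;> cases b <;> cases a' <;> cases b' <;> simp [Matrix.single, grade]
  have hpp : par (Finset.Iio m) * par (Finset.Iio m) = 1 := par_mul_self _
  have hpp' : ∀ Y : FockOp M, par (Finset.Iio m) * (par (Finset.Iio m) * Y) = Y := fun Y => by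
    rw [← mul_assoc, hpp, one_mul]
  have e : ∀ x : ℂ, Complex.sinh (u - ξ m + η) * (x / Complex.sinh (u - ξ m + η)) = x := fun x =>
    mul_div_cancel₀ _ hu
  ext1 p q
  simp only [Matrix.smul_apply, auxPar, Matrix.mul_diagonal, Matrix.diagonal_mul, par_insert hm,
    par_comm {m} (Finset.Iio m)]
  cases p <;> cases q
  · simp [fermL, fermBlock, h1, funit, smul_smul, wb, e]
  · simp [fermL, fermBlock, h2, funit, smul_smul, wc, e, mul_assoc, hpar, hpp']
  · simp [fermL, fermBlock, h3, funit, smul_smul, wc, e, mul_assoc, hps, grade]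
  · simp [fermL, fermBlock, h4, funit, smul_smul, wb, e, mul_assoc, hps, grade, mul_add, sub_mul,
      hpar, smul_sub]
    rw [sub_eq_add_neg]

/-- The Jordan--Wigner transformation of the fermionic monodromy matrix. -/
theorem fermT_eq (l : List (Fin M)) (hl : l.Pairwise (· > ·)) (hl' : ∀ i ∈ l, ∀ j < i, j ∈ l)
    (u : ℂ) (hu : ∀ m ∈ l, Complex.sinh (u - ξ m + η) ≠ 0) :
    (l.map fun m => Complex.sinh (u - ξ m + η)).prod • fermT η ξ l u =
      auxPar l.toFinset * chainT η ξ l u := by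
  induction l with
  | nil =>
    simp only [List.map_nil, List.prod_nil, one_smul, chainT_nil, mul_one, fermT, auxPar,
      List.toFinset_nil, par_empty]
    rw [← Matrix.diagonal_one]
    congr 1
    funext p
    simp
  | cons m l ih =>
    rw [List.pairwise_cons] at hl
    -- A decreasing, downward closed list with head `m` has exactly the sites below `m` as its tail,
    -- so the twists of consecutive factors telescope.
    have hS : l.toFinset = Finset.Iio m := by
      ext j
      rw [List.mem_toFinset, Finset.mem_Iio]
      refine ⟨hl.1 j, fun hj => ?_⟩
      rcases List.mem_cons.1 (hl' m List.mem_cons_self j hj) with h | h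
      · exact absurd h hj.ne
      · exact h
    have h := ih hl.2 (fun i hi j hj => by
      rcases List.mem_cons.1 (hl' i (List.mem_cons_of_mem _ hi) j hj) with h | h
      · exact absurd (hl.1 i hi) (by rw [← h]; exact hj.not_gt)
      · exact h) fun i hi => hu i (List.mem_cons_of_mem _ hi)
    rw [hS] at h
    rw [fermT_cons, chainT_cons, List.map_cons, List.prod_cons, List.toFinset_cons, hS, mul_smul,
      ← mul_smul_comm, h, ← mul_assoc, ← smul_mul_assoc, fermL_mul_auxPar η ξ m u (hu m
        List.mem_cons_self), mul_assoc]

end Blocks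

/-! ### The quantum inverse problem -/

section InverseProblem

variable {M : ℕ}

/-- The fermionic `R`-operator of the sites `x` and `y` in terms of matrix units. -/
def fermR (b c : ℂ) (x y : Fin M) : FockOp M :=
  funit x false false * funit y false false +
    b • (funit x false false * funit y true true + funit x true true * funit y false false) -
    funit x true true * funit y true true +
    c • (funit x true false * funit y false true + funit y true false * funit x false true)

theorem funit_mul_self_assoc (j : Fin M) (a b c d : Bool) (X : FockOp M) :
    funit j a b * (funit j c d * X) = if b = c then funit j a d * X else 0 := by
  rw [← mul_assoc, funit_mul_self]
  split_ifs <;> simp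

theorem funit_mul_of_ne_assoc {i j : Fin M} (hij : i ≠ j) (a b c d : Bool) (X : FockOp M) :
    funit i a b * (funit j c d * X) =
      (if a = b ∨ c = d then (1 : ℂ) else -1) • (funit j c d * (funit i a b * X)) := by
  rw [← mul_assoc, funit_mul_of_ne hij, smul_mul_assoc, mul_assoc]

/-- The weights `b = 0`, `c = 1` give the graded permutation of the auxiliary mode with `x`. Moving
it to the left turns the `L`-operator of `y` into the `R`-operator of the sites `x` and `y`. -/
theorem fermBlock_mul_perm {x y : Fin M} (hyx : y ≠ x) (b c : ℂ) :
    fermBlock b c y * fermBlock 0 1 x = fermBlock 0 1 x * Matrix.diagonal fun _ => fermR b c x y := by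
  ext1 p q
  rw [Matrix.mul_diagonal, Matrix.mul_apply, Fintype.sum_bool]
  cases p <;> cases q <;>
  · simp [fermBlock, fermR, mul_add, add_mul, mul_sub, sub_mul, funit_mul_self_assoc,
      funit_mul_of_ne hyx]
    try module

/-- The local exchange relation. -/
theorem fermR_mul_fermBlock {x y : Fin M} (hyx : y ≠ x) {b c b₁ c₁ b₂ c₂ : ℂ}
    (e1 : b * c₁ * c₂ + c * b₁ = c * b₂) (e2 : b * b₁ * c₂ + c * c₁ = c₂)
    (e3 : c * b₁ * c₂ + b * c₁ = c₁ * b₂) :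
    (Matrix.diagonal fun _ => fermR b c x y) * (fermBlock b₂ c₂ y * fermBlock b₁ c₁ x) =
      fermBlock b₁ c₁ x * fermBlock b₂ c₂ y * Matrix.diagonal fun _ => fermR b c x y := by
  ext1 p q
  rw [Matrix.mul_diagonal, Matrix.diagonal_mul, Matrix.mul_apply, Fintype.sum_bool,
    Matrix.mul_apply, Fintype.sum_bool]
  cases p <;> cases q <;>
    simp [fermBlock, fermR, mul_add, add_mul, mul_sub, sub_mul, mul_assoc, funit_mul_self,
      funit_mul_self_assoc, funit_mul_of_ne hyx, funit_mul_of_ne_assoc hyx, smul_smul]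
  · linear_combination (norm := module)
      -(e1 • (funit x true false * funit y false true + funit x false true * funit y true false))
  · linear_combination (norm := module)
      e2 • (funit x false false * funit y true false - funit x true true * funit y true false) +
      e3 • (funit x true false * funit y false false + funit x true false * funit y true true)
  · linear_combination (norm := module)
      e2 • (funit x true true * funit y false true - funit x false false * funit y false true) -
      e3 • (funit x false true * funit y false false + funit x false true * funit y true true)
  · linear_combination (norm := module)
      -(e1 • (funit x true false * funit y false true + funit x false true * funit y true false))

/-- The scalar content of the local exchange relation; the weights of `fermR` are taken at the
difference of the two spectral parameters. -/
theorem weight_relations {η u v : ℂ} (h : Complex.sinh (v - u + η) ≠ 0)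
    (hu : Complex.sinh (u + η) ≠ 0) (hv : Complex.sinh (v + η) ≠ 0) :
    wb η (v - u) * wc η u * wc η v + wc η (v - u) * wb η u = wc η (v - u) * wb η v ∧
    wb η (v - u) * wb η u * wc η v + wc η (v - u) * wc η u = wc η v ∧
    wc η (v - u) * wb η u * wc η v + wb η (v - u) * wc η u = wc η u * wb η v := by
  obtain ⟨w, rfl⟩ : ∃ w, v = u + w := ⟨v - u, by ring⟩
  rw [add_sub_cancel_left] at *
  have h1 := sinh_add_mul_sinh_add u w η
  have h2 := sinh_add_mul_sinh_add w η u
  have h3 := sinh_add_mul_sinh_add u η w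
  rw [add_comm w u, add_comm η u, show w + η + u = u + w + η by ring] at h2
  rw [add_comm η w, show u + η + w = u + w + η by ring] at h3
  simp only [wb, wc]
  refine ⟨?_, ?_, ?_⟩
  · field_simp
    linear_combination -Complex.sinh η * h2
  · field_simp
    linear_combination -Complex.sinh η * h1
  · field_simp
    linear_combination -Complex.sinh η * h3

theorem fermR_comm_fermBlock {x y z : Fin M} (hzx : z ≠ x) (hzy : z ≠ y) (b c b' c' : ℂ) :
    (Matrix.diagonal fun _ => fermR b c x y) * fermBlock b' c' z =
      fermBlock b' c' z * Matrix.diagonal fun _ => fermR b c x y := by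
  ext1 p q
  rw [Matrix.mul_diagonal, Matrix.diagonal_mul]
  cases p <;> cases q <;>
  · simp [fermBlock, fermR, mul_add, add_mul, mul_sub, sub_mul, mul_assoc, funit_mul_of_ne hzx,
      funit_mul_of_ne hzy, funit_mul_of_ne_assoc hzx, funit_mul_of_ne_assoc hzy]
    try module

variable (η : ℂ) (ξ : Fin M → ℂ)

/-- The operator moving the site `x` through the sites in the list `l`. -/
def fermShift (l : List (Fin M)) (x : Fin M) : FockOp M :=
  (l.map fun y => fermR (wb η (ξ x - ξ y)) (wc η (ξ x - ξ y)) x y).prod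

theorem diagonal_fermShift_cons (y : Fin M) (l : List (Fin M)) (x : Fin M) :
    (Matrix.diagonal fun _ : Bool => fermShift η ξ (y :: l) x) =
      (Matrix.diagonal fun _ => fermR (wb η (ξ x - ξ y)) (wc η (ξ x - ξ y)) x y) *
        Matrix.diagonal fun _ => fermShift η ξ l x := by
  rw [Matrix.diagonal_mul_diagonal, fermShift, List.map_cons, List.prod_cons]
  rfl

theorem fermL_self (hη : Complex.sinh η ≠ 0) (x : Fin M) :
    fermL η ξ (ξ x) x = fermBlock 0 1 x := by
  rw [fermL, sub_self, wb, wc, Complex.sinh_zero, zero_div, zero_add, div_self hη]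

theorem fermT_append_singleton (l : List (Fin M)) (x : Fin M) (u : ℂ) :
    fermT η ξ (l ++ [x]) u = fermT η ξ l u * fermL η ξ u x := by
  simp [fermT]

/-- At an inhomogeneity the monodromy matrix factorizes. -/
theorem fermT_self (hη : Complex.sinh η ≠ 0) {l : List (Fin M)} {x : Fin M} (hx : x ∉ l) :
    fermT η ξ (l ++ [x]) (ξ x) = fermBlock 0 1 x * Matrix.diagonal fun _ => fermShift η ξ l x := by
  rw [fermT_append_singleton, fermL_self η ξ hη]
  induction l with
  | nil => simp [fermT, fermShift]
  | cons y l ih =>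
    rw [List.mem_cons, not_or] at hx
    rw [fermT_cons, mul_assoc, ih hx.2, diagonal_fermShift_cons, ← mul_assoc, ← mul_assoc, fermL,
      fermBlock_mul_perm (Ne.symm hx.1)]

theorem fermShift_comm_fermL {l : List (Fin M)} {x z : Fin M} (hzx : z ≠ x) (hz : z ∉ l) (u : ℂ) :
    (Matrix.diagonal fun _ => fermShift η ξ l x) * fermL η ξ u z =
      fermL η ξ u z * Matrix.diagonal fun _ => fermShift η ξ l x := by
  induction l with
  | nil => simp [fermShift]
  | cons y l ih =>
    rw [List.mem_cons, not_or] at hz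
    rw [diagonal_fermShift_cons, mul_assoc, ih hz.2, ← mul_assoc, fermL,
      fermR_comm_fermBlock hzx hz.1, mul_assoc]

theorem fermR_comm_fermT {l : List (Fin M)} {x y : Fin M} (hx : x ∉ l) (hy : y ∉ l) (b c u : ℂ) :
    (Matrix.diagonal fun _ => fermR b c x y) * fermT η ξ l u =
      fermT η ξ l u * Matrix.diagonal fun _ => fermR b c x y := by
  induction l with
  | nil => simp [fermT]
  | cons z l ih =>
    rw [List.mem_cons, not_or] at hx hy
    rw [fermT_cons, ← mul_assoc, fermL, fermR_comm_fermBlock (Ne.symm hx.1) (Ne.symm hy.1),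
      mul_assoc, ih hx.2 hy.2, mul_assoc]

/-- Each factor of the shift operator interchanges `x` with one neighbour by the local exchange
relation and commutes with the `L`-operators of all other sites. Together they carry `x` from the
right end to the left end. -/
theorem fermShift_mul_fermT (hξ : ∀ j k, Complex.sinh (ξ j - ξ k + η) ≠ 0) {l : List (Fin M)}
    (hl : l.Nodup) {x : Fin M} (hx : x ∉ l) {u : ℂ}
    (hu : ∀ m, Complex.sinh (u - ξ m + η) ≠ 0) :
    (Matrix.diagonal fun _ => fermShift η ξ l x) * fermT η ξ (l ++ [x]) u =
      fermT η ξ (x :: l) u * Matrix.diagonal fun _ => fermShift η ξ l x := by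
  rw [fermT_append_singleton, fermT_cons]
  induction l with
  | nil => simp [fermT, fermShift]
  | cons y l ih =>
    rw [List.mem_cons, not_or] at hx
    rw [List.nodup_cons] at hl
    obtain ⟨e1, e2, e3⟩ := weight_relations (η := η) (u := u - ξ x) (v := u - ξ y)
      (by rw [show u - ξ y - (u - ξ x) + η = ξ x - ξ y + η by ring]; exact hξ _ _) (hu x) (hu y)
    rw [show u - ξ y - (u - ξ x) = ξ x - ξ y by ring] at e1 e2 e3
    have hex := fermR_mul_fermBlock (Ne.symm hx.1) e1 e2 e3
    rw [diagonal_fermShift_cons, fermT_cons]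
    have h1 := fermShift_comm_fermL η ξ (Ne.symm hx.1) hl.1 u
    have h2 := fermR_comm_fermT η ξ hx.2 hl.1 (wb η (ξ x - ξ y)) (wc η (ξ x - ξ y)) u
    have h3 := ih hl.2 hx.2
    change _ * (fermL η ξ u y * fermL η ξ u x) = fermL η ξ u x * fermL η ξ u y * _ at hex
    generalize (Matrix.diagonal fun _ : Bool => fermShift η ξ l x) = U at *
    generalize (Matrix.diagonal fun _ : Bool =>
      fermR (wb η (ξ x - ξ y)) (wc η (ξ x - ξ y)) x y) = R at *
    generalize fermL η ξ u y = Ly at *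
    generalize fermL η ξ u x = Lx at *
    generalize fermT η ξ l u = T at *
    calc R * U * (Ly * T * Lx) = R * (U * Ly) * (T * Lx) := by simp only [mul_assoc]
      _ = R * Ly * (U * (T * Lx)) := by rw [h1]; simp only [mul_assoc]
      _ = R * (Ly * Lx) * T * U := by rw [h3]; simp only [mul_assoc]
      _ = Lx * Ly * (R * T) * U := by rw [hex]; simp only [mul_assoc]
      _ = Lx * (Ly * T) * (R * U) := by rw [h2]; simp only [mul_assoc]

/-- The transfer matrix `A(u) - D(u)`. -/
def fermTau (u : ℂ) : FockOp M :=
  fermT η ξ (List.finRange M).reverse u false false -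
    fermT η ξ (List.finRange M).reverse u true true

/-- The product of the transfer matrices at the first `k` inhomogeneities. -/
def fermV : ℕ → FockOp M
  | 0 => 1
  | k + 1 => fermV k * if h : k < M then fermTau η ξ (ξ ⟨k, h⟩) else 1

/-- The monodromy matrix is ordered from the last site to the first, hence the reversal. After
rotation by `m` the site `m` is the rightmost factor, after one more step the leftmost. -/
theorem exists_rotate (m : Fin M) : ∃ l : List (Fin M), m ∉ l ∧ l.Nodup ∧
    ((List.finRange M).rotate m).reverse = l ++ [m] ∧
    ((List.finRange M).rotate (m + 1)).reverse = m :: l := by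
  have hm : (m : ℕ) < (List.finRange M).length := by simp
  have h1 := List.head?_rotate hm
  rw [List.getElem?_eq_getElem hm, List.getElem_finRange] at h1
  obtain ⟨r, hr⟩ : ∃ r, (List.finRange M).rotate m = m :: r := by
    cases hl : (List.finRange M).rotate m with
    | nil => rw [hl] at h1; simp at h1
    | cons a r =>
      rw [hl] at h1
      refine ⟨r, ?_⟩
      simpa using h1
  have hnd : (m :: r).Nodup := by
    rw [← hr]
    exact List.nodup_rotate.2 (List.nodup_finRange M)
  rw [List.nodup_cons] at hnd
  refine ⟨r.reverse, by simpa using hnd.1, List.nodup_reverse.2 hnd.2, ?_, ?_⟩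
  · rw [hr, List.reverse_cons]
  · rw [← List.rotate_rotate, hr, List.rotate_cons_succ, List.rotate_zero]
    simp

theorem diagonal_const_mul_apply (X : FockOp M) (T : Matrix Bool Bool (FockOp M)) (p q : Bool) :
    ((Matrix.diagonal fun _ : Bool => X) * T : Matrix Bool Bool (FockOp M)) p q = X * T p q := by
  rw [Matrix.diagonal_mul]

theorem mul_diagonal_const_apply (X : FockOp M) (T : Matrix Bool Bool (FockOp M)) (p q : Bool) :
    (T * Matrix.diagonal fun _ : Bool => X : Matrix Bool Bool (FockOp M)) p q = T p q * X := by
  rw [Matrix.mul_diagonal]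

/-- The combination `A - D` of the graded permutation is `(1 - n_m) + n_m = 1`. Thus the transfer
matrix at `ξ m` of the rotated chain is the shift operator itself. -/
theorem fermV_succ (hη : Complex.sinh η ≠ 0) {m : Fin M} {l : List (Fin M)} (hm : m ∉ l)
    (hl : ((List.finRange M).rotate m).reverse = l ++ [m])
    (h : (Matrix.diagonal fun _ => fermV η ξ m) * fermT η ξ (List.finRange M).reverse (ξ m) =
      fermT η ξ ((List.finRange M).rotate m).reverse (ξ m) *
        Matrix.diagonal fun _ => fermV η ξ m) :
    fermV η ξ (m + 1) = fermShift η ξ l m * fermV η ξ m := by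
  rw [hl, fermT_self η ξ hη hm] at h
  have hA := congrFun (congrFun h false) false
  have hD := congrFun (congrFun h true) true
  simp only [diagonal_const_mul_apply, mul_diagonal_const_apply] at hA hD
  rw [fermV, dif_pos m.2, fermTau, mul_sub, hA, hD, ← sub_mul, ← sub_mul]
  simp only [fermBlock, Matrix.of_apply, zero_smul, add_zero, zero_sub, sub_neg_eq_add]
  rw [funit_false_add_funit_true, one_mul]

/-- The products of transfer matrices at the inhomogeneities rotate the chain. -/
theorem fermV_mul (hξ : ∀ j k, Complex.sinh (ξ j - ξ k + η) ≠ 0) (k : ℕ) (hk : k ≤ M) :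
    ∀ u, (∀ m, Complex.sinh (u - ξ m + η) ≠ 0) →
      (Matrix.diagonal fun _ => fermV η ξ k) * fermT η ξ (List.finRange M).reverse u =
        fermT η ξ ((List.finRange M).rotate k).reverse u * Matrix.diagonal fun _ => fermV η ξ k := by
  induction k with
  | zero =>
    intro u _
    have : (Matrix.diagonal fun _ : Bool => fermV η ξ 0) = 1 := Matrix.diagonal_one
    rw [this, one_mul, mul_one, List.rotate_zero]
  | succ k ih =>
    intro u hu
    have hη : Complex.sinh η ≠ 0 := by
      have := hξ ⟨k, hk⟩ ⟨k, hk⟩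
      rwa [sub_self, zero_add] at this
    obtain ⟨l, hml, hnd, h1, h2⟩ := exists_rotate (⟨k, hk⟩ : Fin M)
    -- The rotation property at step `k`, used at the spectral parameter `ξ k`, identifies the next
    -- transfer matrix with a shift.
    have h3 := fermV_succ η ξ hη hml h1 (ih (Nat.le_of_succ_le hk) _ fun m => hξ _ m)
    have h4 : (Matrix.diagonal fun _ : Bool => fermV η ξ (k + 1)) =
        (Matrix.diagonal fun _ : Bool => fermShift η ξ l ⟨k, hk⟩) *
          Matrix.diagonal fun _ : Bool => fermV η ξ k := by
      rw [Matrix.diagonal_mul_diagonal]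
      congr 1
      funext _
      exact h3
    change ((List.finRange M).rotate k).reverse = _ at h1
    change ((List.finRange M).rotate (k + 1)).reverse = _ at h2
    rw [h4, mul_assoc, ih (Nat.le_of_succ_le hk) u hu, h1, ← mul_assoc,
      fermShift_mul_fermT η ξ hξ hnd hml hu, h2, mul_assoc]

/-- The solution of the quantum inverse problem. -/
theorem fermV_mul_fermT (hξ : ∀ j k, Complex.sinh (ξ j - ξ k + η) ≠ 0) (m : Fin M) (p q : Bool) :
    fermV η ξ m * fermT η ξ (List.finRange M).reverse (ξ m) p q =
      fermBlock 0 1 m p q * fermV η ξ (m + 1) := by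
  have hη : Complex.sinh η ≠ 0 := by
    have := hξ m m
    rwa [sub_self, zero_add] at this
  obtain ⟨l, hml, hnd, h1, h2⟩ := exists_rotate m
  have h := fermV_mul η ξ hξ m m.2.le _ fun k => hξ m k
  rw [fermV_succ η ξ hη hml h1 h]
  rw [h1, fermT_self η ξ hη hml] at h
  have := congrFun (congrFun h p) q
  simp only [diagonal_const_mul_apply, mul_diagonal_const_apply] at this
  rw [this, mul_assoc]

end InverseProblem

/-! ### Bethe vectors labelled by tuples -/

namespace YBRep

variable {η : ℂ} (ρ : YBRep η) {N : ℕ}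

/-- `B(u_1) ⋯ B(u_N) Ω`. -/
def ket (u : Fin N → ℂ) : ρ.ι → ℂ := (List.ofFn fun k => ρ.B (u k)).prod *ᵥ ρ.Ω

/-- `ω C(v_1) ⋯ C(v_N)`. -/
def bra (v : Fin N → ℂ) : ρ.ι → ℂ := ρ.ω ᵥ* (List.ofFn fun k => ρ.C (v k)).prod

theorem bra_dotProduct_ket (v u : Fin N → ℂ) : ρ.bra v ⬝ᵥ ρ.ket u = ρ.tupleScal v u := by
  rw [tupleScal, bra, ket, ← Matrix.mulVec_mulVec, ← Matrix.dotProduct_mulVec]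

theorem ket_eq_bethe {u : Fin N → ℂ} (hu : Function.Injective u) :
    ρ.ket u = ρ.bethe (Finset.univ.image u) := by
  rw [ket, bethe, finProd_image _ _ hu]

theorem bra_eq_transpose_ket {v : Fin N → ℂ} (hv : Function.Injective v) :
    ρ.bra v = ρ.transpose.ket v := by
  rw [ket_eq_bethe _ hv, transpose_bethe, bra, dual, finProd_image _ _ hv]

theorem ket_snoc (u : Fin N → ℂ) (x : ℂ) :
    ρ.ket (Fin.snoc u x : Fin (N + 1) → ℂ) = ρ.B x *ᵥ ρ.ket u := by
  have hc : Commute (ρ.B x) (List.ofFn fun k => ρ.B (u k)).prod :=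
    Commute.list_prod_right _ _ fun y hy => by
      obtain ⟨k, rfl⟩ := (List.mem_ofFn' _ _).1 hy
      exact ρ.comm_B _ _
  rw [ket, List.ofFn_succ']
  simp only [Fin.snoc_castSucc, Fin.snoc_last, List.concat_eq_append, List.prod_append,
    List.prod_singleton]
  rw [← hc.eq, ← Matrix.mulVec_mulVec, ket]

theorem bra_snoc (v : Fin N → ℂ) (x : ℂ) :
    ρ.bra (Fin.snoc v x : Fin (N + 1) → ℂ) = ρ.bra v ᵥ* ρ.C x := by
  rw [bra, List.ofFn_succ']
  simp only [Fin.snoc_castSucc, Fin.snoc_last, List.concat_eq_append, List.prod_append,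
    List.prod_singleton]
  rw [← Matrix.vecMul_vecMul, bra]

variable {u : Fin N → ℂ} {v : ℂ}

theorem injective_of_sinh_ne_zero (hu : ∀ i j, i ≠ j → Complex.sinh (u i - u j) ≠ 0) :
    Function.Injective u := fun i j h => by
  by_contra hij
  exact hu i j hij (by rw [h]; simp)

theorem notMem_image_of_sinh_ne_zero (hv : ∀ k, Complex.sinh (u k - v) ≠ 0) :
    v ∉ Finset.univ.image u := by
  rw [Finset.mem_image]
  rintro ⟨k, _, rfl⟩
  exact hv k (by simp)

theorem distinct_insert_image (hu : ∀ i j, i ≠ j → Complex.sinh (u i - u j) ≠ 0)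
    (hv : ∀ k, Complex.sinh (u k - v) ≠ 0) : Distinct (insert v (Finset.univ.image u)) := by
  intro x hx y hy hxy
  rw [Finset.mem_insert, Finset.mem_image] at hx hy
  rcases hx with rfl | ⟨i, _, rfl⟩ <;> rcases hy with rfl | ⟨j, _, rfl⟩
  · exact absurd rfl hxy
  · rw [sinh_sub_comm]
    exact neg_ne_zero.2 (hv j)
  · exact hv i
  · exact hu i j fun h => hxy (by rw [h])

theorem insert_erase_image (hu : Function.Injective u) (k : Fin N) (v : ℂ) :
    insert v ((Finset.univ.image u).erase (u k)) = Finset.univ.image (Function.update u k v) := by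
  ext x
  simp only [Finset.mem_insert, Finset.mem_erase, Finset.mem_image, Finset.mem_univ, true_and]
  constructor
  · rintro (rfl | ⟨h, j, rfl⟩)
    · exact ⟨k, Function.update_self ..⟩
    · exact ⟨j, Function.update_of_ne (fun h' => h (by rw [h'])) ..⟩
  · rintro ⟨j, rfl⟩
    by_cases hj : j = k
    · subst hj
      left
      simp
    · right
      rw [Function.update_of_ne hj]
      exact ⟨fun h => hj (hu h), j, rfl⟩

theorem injective_update (hu : Function.Injective u) (hv : ∀ k, u k ≠ v) (k : Fin N) :
    Function.Injective (Function.update u k v) := by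
  intro i j h
  by_cases hi : i = k <;> by_cases hj : j = k
  · rw [hi, hj]
  · subst hi
    rw [Function.update_self, Function.update_of_ne hj] at h
    exact absurd h.symm (hv j)
  · subst hj
    rw [Function.update_self, Function.update_of_ne hi] at h
    exact absurd h (hv i)
  · rw [Function.update_of_ne hi, Function.update_of_ne hj] at h
    exact hu h

theorem A_ket (hu : ∀ i j, i ≠ j → Complex.sinh (u i - u j) ≠ 0)
    (hv : ∀ k, Complex.sinh (u k - v) ≠ 0) :
    ρ.A v *ᵥ ρ.ket u = (ρ.a v * ∏ l, f η (u l) v) • ρ.ket u +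
      ∑ k, (ρ.a (u k) * (g η v (u k) * ∏ l ∈ Finset.univ.erase k, f η (u l) (u k))) •
        ρ.ket (Function.update u k v) := by
  have hi := injective_of_sinh_ne_zero hu
  have hne : ∀ k, u k ≠ v := fun k h => hv k (by rw [h]; simp)
  rw [ket_eq_bethe _ hi, ρ.A_bethe (notMem_image_of_sinh_ne_zero hv) (distinct_insert_image hu hv),
    Finset.prod_image hi.injOn, Finset.sum_image hi.injOn]
  congr 1
  refine Finset.sum_congr rfl fun k _ => ?_
  rw [ket_eq_bethe _ (injective_update hi hne k), insert_erase_image hi, prod_erase_image hi]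

theorem D_ket (hu : ∀ i j, i ≠ j → Complex.sinh (u i - u j) ≠ 0)
    (hv : ∀ k, Complex.sinh (u k - v) ≠ 0) :
    ρ.D v *ᵥ ρ.ket u = (ρ.d v * ∏ l, f η v (u l)) • ρ.ket u +
      ∑ k, (ρ.d (u k) * (g η (u k) v * ∏ l ∈ Finset.univ.erase k, f η (u k) (u l))) •
        ρ.ket (Function.update u k v) := by
  have hi := injective_of_sinh_ne_zero hu
  have hne : ∀ k, u k ≠ v := fun k h => hv k (by rw [h]; simp)
  rw [ket_eq_bethe _ hi, ρ.D_bethe (notMem_image_of_sinh_ne_zero hv) (distinct_insert_image hu hv),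
    Finset.prod_image hi.injOn, Finset.sum_image hi.injOn]
  congr 1
  refine Finset.sum_congr rfl fun k _ => ?_
  rw [ket_eq_bethe _ (injective_update hi hne k), insert_erase_image hi, prod_erase_image hi]

/-- The action of `D` on an on-shell Bethe vector at a zero of `d`. -/
theorem smul_D_ket {κ : ℂ} (hu : ∀ i j, i ≠ j → Complex.sinh (u i - u j) ≠ 0)
    (hv : ∀ k, Complex.sinh (u k - v) ≠ 0) (hon : OnShell η κ ρ.a ρ.d u) (hd : ρ.d v = 0) :
    κ • (ρ.D v *ᵥ ρ.ket u) =
      ∑ k, (ρ.a (u k) * (g η (u k) v * ∏ l ∈ Finset.univ.erase k, f η (u l) (u k))) •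
        ρ.ket (Function.update u k v) := by
  rw [ρ.D_ket hu hv, hd, zero_mul, zero_smul, zero_add, Finset.smul_sum]
  refine Finset.sum_congr rfl fun k _ => ?_
  rw [smul_smul]
  congr 1
  -- With `d v = 0` only exchange terms remain, and the Bethe equation replaces `κ d(u_k)` by
  -- `a(u_k)`.
  linear_combination (-g η (u k) v) * hon k

/-- On-shell Bethe vectors are eigenvectors of the transfer matrix. -/
theorem transfer_ket {κ : ℂ} (hu : ∀ i j, i ≠ j → Complex.sinh (u i - u j) ≠ 0)
    (hv : ∀ k, Complex.sinh (u k - v) ≠ 0) (hon : OnShell η κ ρ.a ρ.d u) (hd : ρ.d v = 0) :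
    (ρ.A v + κ • ρ.D v) *ᵥ ρ.ket u = (ρ.a v * ∏ l, f η (u l) v) • ρ.ket u := by
  rw [Matrix.add_mulVec, Matrix.smul_mulVec, ρ.A_ket hu hv, ρ.smul_D_ket hu hv hon hd, add_assoc,
    ← Finset.sum_add_distrib, Finset.sum_eq_zero, add_zero]
  intro k _
  rw [← add_smul, g, g, sinh_sub_comm v, div_neg]
  convert zero_smul ℂ _ using 2
  ring

theorem bra_transfer {κ : ℂ} (hu : ∀ i j, i ≠ j → Complex.sinh (u i - u j) ≠ 0)
    (hv : ∀ k, Complex.sinh (u k - v) ≠ 0) (hon : OnShell η κ ρ.a ρ.d u) (hd : ρ.d v = 0) :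
    ρ.bra u ᵥ* (ρ.A v + κ • ρ.D v) = (ρ.a v * ∏ l, f η (u l) v) • ρ.bra u := by
  -- The transposed representation has the same Bethe equations and eigenvalues, so the bra case is
  -- the ket case there.
  have h := ρ.transpose.transfer_ket hu hv hon hd
  have hb : ρ.bra u = ρ.transpose.ket u :=
    bra_eq_transpose_ket _ (injective_of_sinh_ne_zero hu)
  rw [← Matrix.mulVec_transpose, Matrix.transpose_add, Matrix.transpose_smul]
  generalize ρ.bra u = b at hb
  subst hb
  exact h

end YBRep

/-! ### The fermionic operators in terms of the six-vertex chain -/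

section Fermion

variable {M : ℕ} (η : ℂ) (ξ : Fin M → ℂ)

/-- The six-vertex chain on all sites. -/
def fullRep : YBRep η :=
  chainRep η ξ (List.finRange M).reverse (List.nodup_reverse.2 (List.nodup_finRange M))

/-- The monodromy matrix of the six-vertex chain on all sites. -/
def fullT (u : ℂ) : Matrix Bool Bool (FockOp M) := chainT η ξ (List.finRange M).reverse u

/-- The vacuum eigenvalue of `A`. -/
def fullA (u : ℂ) : ℂ := ∏ m, Complex.sinh (u - ξ m + η)

/-- The vacuum eigenvalue of `D`. -/
def fullD (u : ℂ) : ℂ := ∏ m, Complex.sinh (u - ξ m)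

variable {N : ℕ}

/-- The Bethe vector of the six-vertex chain. -/
def fullKet (u : Fin N → ℂ) : Occ M → ℂ :=
  (List.ofFn fun k => fullT η ξ (u k) false true).prod *ᵥ vac M

/-- The dual Bethe vector of the six-vertex chain. -/
def fullBra (v : Fin N → ℂ) : Occ M → ℂ :=
  vac M ᵥ* (List.ofFn fun k => fullT η ξ (v k) true false).prod

/-- The scalar product of Bethe vectors of the six-vertex chain. -/
def fullScal (v u : Fin N → ℂ) : ℂ := fullBra η ξ v ⬝ᵥ fullKet η ξ u

theorem prod_map_reverse_finRange (F : Fin M → ℂ) :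
    ((List.finRange M).reverse.map F).prod = ∏ m, F m := by
  rw [List.map_reverse, List.prod_reverse, ← List.ofFn_eq_map, List.prod_ofFn]

theorem fullRep_a : (fullRep η ξ).a = fullA η ξ := funext fun _ => prod_map_reverse_finRange _

theorem fullRep_d : (fullRep η ξ).d = fullD ξ := funext fun _ => prod_map_reverse_finRange _

theorem fullScal_eq (v u : Fin N → ℂ) : fullScal η ξ v u = (fullRep η ξ).tupleScal v u :=
  (fullRep η ξ).bra_dotProduct_ket v u

theorem fullRep_isContinuous : (fullRep η ξ).IsContinuous := chainRep_isContinuous _ _ _ _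

theorem fullScal_comm (v u : Fin N → ℂ) : fullScal η ξ v u = fullScal η ξ u v := by
  rw [fullScal_eq, fullScal_eq, (fullRep_isContinuous η ξ).tupleScal_comm]

theorem fullKet_snoc (u : Fin N → ℂ) (x : ℂ) :
    fullKet η ξ (Fin.snoc u x : Fin (N + 1) → ℂ) = fullT η ξ x false true *ᵥ fullKet η ξ u :=
  (fullRep η ξ).ket_snoc u x

theorem fullBra_snoc (v : Fin N → ℂ) (x : ℂ) :
    fullBra η ξ (Fin.snoc v x : Fin (N + 1) → ℂ) = fullBra η ξ v ᵥ* fullT η ξ x true false :=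
  (fullRep η ξ).bra_snoc v x

section OnShell

variable {u : Fin N → ℂ} {v κ : ℂ}

theorem smul_fullT_mulVec_fullKet (hu : ∀ i j, i ≠ j → Complex.sinh (u i - u j) ≠ 0)
    (hv : ∀ k, Complex.sinh (u k - v) ≠ 0) (hon : OnShell η κ (fullA η ξ) (fullD ξ) u)
    (hd : fullD ξ v = 0) :
    κ • (fullT η ξ v true true *ᵥ fullKet η ξ u) =
      ∑ k, (fullA η ξ (u k) * (g η (u k) v * ∏ l ∈ Finset.univ.erase k, f η (u l) (u k))) •
        fullKet η ξ (Function.update u k v) := by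
  rw [← fullRep_a, ← fullRep_d] at hon
  rw [← fullRep_d] at hd
  rw [← fullRep_a]
  exact (fullRep η ξ).smul_D_ket hu hv hon hd

theorem transfer_mulVec_fullKet (hu : ∀ i j, i ≠ j → Complex.sinh (u i - u j) ≠ 0)
    (hv : ∀ k, Complex.sinh (u k - v) ≠ 0) (hon : OnShell η κ (fullA η ξ) (fullD ξ) u)
    (hd : fullD ξ v = 0) :
    (fullT η ξ v false false + κ • fullT η ξ v true true) *ᵥ fullKet η ξ u =
      (fullA η ξ v * ∏ l, f η (u l) v) • fullKet η ξ u := by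
  rw [← fullRep_a, ← fullRep_d] at hon
  rw [← fullRep_d] at hd
  rw [← fullRep_a]
  exact (fullRep η ξ).transfer_ket hu hv hon hd

theorem fullBra_vecMul_transfer (hu : ∀ i j, i ≠ j → Complex.sinh (u i - u j) ≠ 0)
    (hv : ∀ k, Complex.sinh (u k - v) ≠ 0) (hon : OnShell η κ (fullA η ξ) (fullD ξ) u)
    (hd : fullD ξ v = 0) :
    fullBra η ξ u ᵥ* (fullT η ξ v false false + κ • fullT η ξ v true true) =
      (fullA η ξ v * ∏ l, f η (u l) v) • fullBra η ξ u := by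
  rw [← fullRep_a, ← fullRep_d] at hon
  rw [← fullRep_d] at hd
  rw [← fullRep_a]
  exact (fullRep η ξ).bra_transfer hu hv hon hd

theorem fullScal_mul {μ : Fin N → ℂ} (hη : Complex.sinh η ≠ 0)
    (hμ : ∀ i j, i ≠ j → Complex.sinh (μ i - μ j) ≠ 0 ∧ Complex.sinh (μ i - μ j + η) ≠ 0)
    (hon : OnShell η κ (fullA η ξ) (fullD ξ) μ) (hu : ∀ i j, Complex.sinh (μ i - u j) ≠ 0) :
    fullScal η ξ μ u *
        (sinhVandermonde u * ∏ j, ∏ k ∈ Finset.Ioi j, Complex.sinh (μ k - μ j)) =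
      (∏ j, fullD ξ (μ j)) * (slavnovMatrix η κ (fullA η ξ) (fullD ξ) μ u).det := by
  rw [← fullRep_a, ← fullRep_d] at hon ⊢
  rw [fullScal_eq]
  exact (fullRep_isContinuous η ξ).tupleScal_mul hη hμ hon hu

end OnShell

theorem fullA_mul_d {u : ℂ} (hu : ∀ m, Complex.sinh (u - ξ m + η) ≠ 0) :
    fullA η ξ u * d η ξ u = fullD ξ u := by
  rw [fullA, fullD, d, ← Finset.prod_mul_distrib]
  refine Finset.prod_congr rfl fun m _ => ?_
  have := hu m
  rw [f, inv_div]
  field_simp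

theorem fullA_ne_zero {u : ℂ} (hu : ∀ m, Complex.sinh (u - ξ m + η) ≠ 0) : fullA η ξ u ≠ 0 :=
  Finset.prod_ne_zero_iff.2 fun m _ => hu m

theorem fullD_inhomogeneity (ξ : Fin M → ℂ) (m : Fin M) : fullD ξ (ξ m) = 0 :=
  Finset.prod_eq_zero (Finset.mem_univ m) (by simp)

/-- The parity of the number of particles. -/
abbrev totalPar : FockOp M := par Finset.univ

theorem grade_mul (i k j : Bool) : grade i k * grade k j = grade i j := by
  cases i <;> cases k <;> cases j <;> simp [grade]

theorem totalPar_mul_fullT (u : ℂ) (i j : Bool) :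
    totalPar * fullT η ξ u i j = grade i j • (fullT η ξ u i j * totalPar) := by
  have hL : ∀ (m : Fin M) (i j : Bool), totalPar * chainL η ξ u m i j =
      grade i j • (chainL η ξ u m i j * totalPar) := by
    intro m i j
    obtain ⟨h1, h2, h3, h4⟩ := chainL_apply_eq η ξ u m
    have hs := fun a b => par_mul_site_single m Finset.univ a b 1
    simp only [Finset.mem_univ, if_true] at hs
    cases i <;> cases j <;>
      simp [h1, h2, h3, h4, mul_add, add_mul, hs, grade]
  rw [fullT]
  generalize (List.finRange M).reverse = l
  induction l generalizing i j with
  | nil => cases i <;> cases j <;> simp [chainT_nil, grade]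
  | cons m l ih =>
    rw [chainT_cons, Matrix.mul_apply, Finset.mul_sum, Finset.sum_mul, Finset.smul_sum]
    refine Finset.sum_congr rfl fun k _ => ?_
    rw [← mul_assoc, hL, smul_mul_assoc, mul_assoc, ih, mul_smul_comm, smul_smul, grade_mul,
      mul_assoc]

theorem totalPar_mulVec_vac : (totalPar : FockOp M) *ᵥ vac M = vac M := by
  ext n
  rw [totalPar, par, Matrix.mulVec_diagonal, vac]
  by_cases h : n = fun _ => false
  · subst h; simp
  · rw [Pi.single_eq_of_ne h, mul_zero]

theorem vac_vecMul_totalPar : vac M ᵥ* (totalPar : FockOp M) = vac M := by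
  ext n
  rw [totalPar, par, Matrix.vecMul_diagonal, vac]
  by_cases h : n = fun _ => false
  · subst h; simp
  · rw [Pi.single_eq_of_ne h, zero_mul]

theorem vev_eq (X : FockOp M) : vev X = vac M ⬝ᵥ X *ᵥ vac M := by
  rw [vac, Matrix.mulVec_single_one, single_one_dotProduct]
  rfl

theorem totalPar_mulVec_fullKet (u : Fin N → ℂ) :
    (totalPar : FockOp M) *ᵥ fullKet η ξ u = (-1 : ℂ) ^ N • fullKet η ξ u := by
  induction N with
  | zero =>
    rw [fullKet, List.ofFn_zero, List.prod_nil, Matrix.one_mulVec, totalPar_mulVec_vac, pow_zero,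
      one_smul]
  | succ N ih =>
    rw [← Fin.snoc_init_self u, fullKet_snoc, Matrix.mulVec_mulVec, totalPar_mul_fullT,
      Matrix.smul_mulVec, ← Matrix.mulVec_mulVec, ih, Matrix.mulVec_smul, smul_smul, pow_succ']
    simp [grade]

theorem fullBra_vecMul_totalPar (v : Fin N → ℂ) :
    fullBra η ξ v ᵥ* (totalPar : FockOp M) = (-1 : ℂ) ^ N • fullBra η ξ v := by
  induction N with
  | zero =>
    rw [fullBra, List.ofFn_zero, List.prod_nil, Matrix.vecMul_one, vac_vecMul_totalPar, pow_zero,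
      one_smul]
  | succ N ih =>
    have hC : fullT η ξ (v (Fin.last N)) true false * totalPar =
        (-1 : ℂ) • (totalPar * fullT η ξ (v (Fin.last N)) true false) := by
      rw [totalPar_mul_fullT, smul_smul]
      simp [grade]
    rw [← Fin.snoc_init_self v, fullBra_snoc, Matrix.vecMul_vecMul, hC, Matrix.vecMul_smul,
      ← Matrix.vecMul_vecMul, ih, Matrix.smul_vecMul, smul_smul, pow_succ']

variable {η ξ}

/-- The blocks `A` and `B` agree with the normalized six-vertex ones; `C` and `D` carry the total
parity on the left. -/
theorem smul_fermT {u : ℂ} (hu : ∀ m, Complex.sinh (u - ξ m + η) ≠ 0) (p q : Bool) :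
    fullA η ξ u • fermT η ξ (List.finRange M).reverse u p q =
      (if p = true then totalPar else 1) * fullT η ξ u p q := by
  have hl : (List.finRange M).reverse.Pairwise (· > ·) :=
    List.pairwise_reverse.2 (List.pairwise_lt_finRange M)
  have h := fermT_eq η ξ (List.finRange M).reverse hl (by simp) u fun m _ => hu m
  have h2 : (List.finRange M).reverse.toFinset = Finset.univ := by
    ext; simp
  rw [h2, prod_map_reverse_finRange] at h
  have := congrFun (congrFun h p) q
  rw [auxPar, Matrix.diagonal_mul] at this
  exact this

theorem smul_opB {u : ℂ} (hu : ∀ m, Complex.sinh (u - ξ m + η) ≠ 0) :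
    fullA η ξ u • opB η ξ u = fullT η ξ u false true := by
  rw [opB, auxBlock_monodromy, smul_fermT hu]
  exact one_mul _

theorem smul_opC {u : ℂ} (hu : ∀ m, Complex.sinh (u - ξ m + η) ≠ 0) :
    fullA η ξ u • opC η ξ u = totalPar * fullT η ξ u true false := by
  rw [opC, auxBlock_monodromy, smul_fermT hu]
  rfl

theorem prodB_mulVec_vac {u : Fin N → ℂ} (hu : ∀ k m, Complex.sinh (u k - ξ m + η) ≠ 0) :
    (∏ k, fullA η ξ (u k)) • (prodB η ξ u *ᵥ vac M) = fullKet η ξ u := by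
  induction N with
  | zero =>
    rw [Finset.univ_eq_empty, Finset.prod_empty, one_smul, prodB, fullKet, List.ofFn_zero,
      List.ofFn_zero]
  | succ N ih =>
    have h := ih (u := fun k => u k.succ) fun k => hu _
    rw [prodB, fullKet] at h
    rw [prodB, List.ofFn_succ, List.prod_cons, Fin.prod_univ_succ, ← Matrix.mulVec_mulVec, mul_smul,
      ← Matrix.mulVec_smul, h, fullKet, List.ofFn_succ, List.prod_cons, ← Matrix.mulVec_mulVec,
      ← smul_opB (hu 0), Matrix.smul_mulVec]

/-- The parity in front of the `C` with index `k` acts to the left on a `k`-particle bra and gives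
`(-1)^k`; the exponents sum to `N(N-1)/2`. -/
theorem vac_vecMul_prodC {v : Fin N → ℂ} (hv : ∀ k m, Complex.sinh (v k - ξ m + η) ≠ 0) :
    (∏ k, fullA η ξ (v k)) • (vac M ᵥ* prodC η ξ v) =
      (-1 : ℂ) ^ (N * (N - 1) / 2) • fullBra η ξ v := by
  rw [← Finset.sum_range_id]
  induction N with
  | zero =>
    rw [Finset.univ_eq_empty, Finset.prod_empty, one_smul, prodC, fullBra, List.ofFn_zero,
      List.ofFn_zero, Finset.range_zero, Finset.sum_empty, pow_zero, one_smul]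
  | succ N ih =>
    have h := ih (v := Fin.init v) fun k => hv _
    have hC := smul_opC (hv (Fin.last N))
    have hb : fullBra η ξ v =
        fullBra η ξ (Fin.init v : Fin N → ℂ) ᵥ* fullT η ξ (v (Fin.last N)) true false := by
      rw [← fullBra_snoc, Fin.snoc_init_self]
    have hp : prodC η ξ v = prodC η ξ (Fin.init v : Fin N → ℂ) * opC η ξ (v (Fin.last N)) := by
      rw [prodC, List.ofFn_succ', List.concat_eq_append, List.prod_append, List.prod_singleton]
      rfl
    have hs : ∏ k, fullA η ξ (v k) =
        fullA η ξ (v (Fin.last N)) * ∏ k, fullA η ξ ((Fin.init v : Fin N → ℂ) k) := by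
      rw [Fin.prod_univ_castSucc, mul_comm]
      rfl
    rw [hp, hs, ← Matrix.vecMul_vecMul, mul_smul, ← Matrix.smul_vecMul, h, ← Matrix.vecMul_smul, hC,
      Matrix.smul_vecMul, ← Matrix.vecMul_vecMul, fullBra_vecMul_totalPar, Matrix.smul_vecMul, ← hb,
      smul_smul, Finset.sum_range_succ, pow_add]

/-- Matrix elements between fermionic Bethe vectors. -/
theorem vev_prodC_mul_prodB {N' : ℕ} {v : Fin N' → ℂ} {u : Fin N → ℂ}
    (hv : ∀ k m, Complex.sinh (v k - ξ m + η) ≠ 0) (hu : ∀ k m, Complex.sinh (u k - ξ m + η) ≠ 0)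
    (X : FockOp M) :
    (∏ k, fullA η ξ (v k)) * (∏ k, fullA η ξ (u k)) * vev (prodC η ξ v * X * prodB η ξ u) =
      (-1 : ℂ) ^ (N' * (N' - 1) / 2) * (fullBra η ξ v ⬝ᵥ (X *ᵥ fullKet η ξ u)) := by
  rw [vev_eq, ← Matrix.mulVec_mulVec, ← Matrix.mulVec_mulVec, Matrix.dotProduct_mulVec,
    ← prodB_mulVec_vac hu, Matrix.mulVec_smul, dotProduct_smul, ← smul_eq_mul ((-1 : ℂ) ^ _),
    smul_comm, ← smul_dotProduct, ← vac_vecMul_prodC hv, smul_dotProduct]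
  simp only [smul_eq_mul]
  ring

end Fermion

/-! ### Bethe solutions -/

section BetheSolution

variable {M N : ℕ} {η : ℂ} {ξ : Fin M → ℂ} {v : Fin N → ℂ}

namespace IsBetheSolution

theorem f_ne_zero (h : IsBetheSolution η ξ v) {j k : Fin N} (hjk : j ≠ k) :
    f η (v j) (v k) ≠ 0 :=
  div_ne_zero ((h.regular j).2 k hjk.symm).2 ((h.regular j).2 k hjk.symm).1

theorem sinh_sub_ne_zero (h : IsBetheSolution η ξ v) (i j : Fin N) (hij : i ≠ j) :
    Complex.sinh (v i - v j) ≠ 0 := ((h.regular i).2 j hij.symm).1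

/-- Clearing denominators, with `d` the ratio of the two vacuum eigenvalues. The sign `(-1)^(N+1)`
of the Bethe equations becomes the twist. -/
theorem onShell (h : IsBetheSolution η ξ v) :
    OnShell η ((-1) ^ (N + 1)) (fullA η ξ) (fullD ξ) v := by
  intro j
  have h1 := h j
  rw [Finset.prod_div_distrib] at h1
  have h2 : ∏ k ∈ Finset.univ.erase j, f η (v k) (v j) ≠ 0 :=
    Finset.prod_ne_zero_iff.2 fun k hk => h.f_ne_zero (Finset.ne_of_mem_erase hk)
  rw [mul_div_assoc', eq_div_iff h2] at h1
  have h3 : ((-1 : ℂ) ^ (N + 1)) * (-1) ^ (N + 1) = 1 := by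
    rw [← mul_pow]; simp
  rw [← fullA_mul_d η ξ fun m => ((h.regular j).1 m).2]
  linear_combination (fullA η ξ (v j) * (-1) ^ (N + 1)) * h1 -
    (fullA η ξ (v j) * ∏ k ∈ Finset.univ.erase j, f η (v k) (v j)) * h3

/-- In the product of all Bethe equations the scattering factors cancel in pairs and the sign is
`(-1)^(N(N+1)) = 1`. -/
theorem prod_d (h : IsBetheSolution η ξ v) : ∏ j, d η ξ (v j) = 1 := by
  have h1 : ∏ j : Fin N, ((-1 : ℂ) ^ (N + 1)) = 1 := by
    rw [Finset.prod_const, Finset.card_univ, Fintype.card_fin, ← pow_mul]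
    exact Even.neg_one_pow (by rw [mul_comm]; exact Nat.even_mul_succ_self N)
  rw [Finset.prod_congr rfl fun j _ => h j, Finset.prod_mul_distrib] at h1
  have h2 : ∏ j, ∏ k ∈ Finset.univ.erase j, f η (v j) (v k) =
      ∏ j, ∏ k ∈ Finset.univ.erase j, f η (v k) (v j) :=
    Finset.prod_comm' fun x y => by simp [eq_comm]
  have h3 : ∏ j, ∏ k ∈ Finset.univ.erase j, f η (v k) (v j) ≠ 0 :=
    Finset.prod_ne_zero_iff.2 fun j _ => Finset.prod_ne_zero_iff.2 fun k hk =>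
      h.f_ne_zero (Finset.ne_of_mem_erase hk)
  simp only [Finset.prod_div_distrib] at h1
  rwa [h2, div_self h3, mul_one] at h1

theorem prod_fullD (h : IsBetheSolution η ξ v) :
    ∏ j, fullD ξ (v j) = ∏ j, fullA η ξ (v j) := by
  rw [← mul_one (∏ j, fullA η ξ (v j)), ← h.prod_d, ← Finset.prod_mul_distrib]
  exact Finset.prod_congr rfl fun j _ => (fullA_mul_d η ξ fun m => ((h.regular j).1 m).2).symm

theorem prod_fullA_ne_zero (h : IsBetheSolution η ξ v) : ∏ j, fullA η ξ (v j) ≠ 0 :=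
  Finset.prod_ne_zero_iff.2 fun j _ => fullA_ne_zero η ξ fun m => ((h.regular j).1 m).2

theorem phi_ne_zero (h : IsBetheSolution η ξ v) (r : ℕ) : phi η ξ r v ≠ 0 :=
  Finset.prod_ne_zero_iff.2 fun j _ => Finset.prod_ne_zero_iff.2 fun m _ =>
    div_ne_zero ((h.regular j).1 m).2 ((h.regular j).1 m).1

end IsBetheSolution

theorem phi_succ (η : ℂ) (ξ : Fin M → ℂ) (v : Fin N → ℂ) {k : ℕ} (hk : k < M) :
    phi η ξ (k + 1) v = phi η ξ k v * ∏ j, f η (v j) (ξ ⟨k, hk⟩) := by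
  have hs : (Finset.univ.filter fun i : Fin M => (i : ℕ) < k + 1) =
      insert ⟨k, hk⟩ (Finset.univ.filter fun i : Fin M => (i : ℕ) < k) := by
    ext i
    simp only [Finset.mem_filter, Finset.mem_univ, true_and, Finset.mem_insert, Fin.ext_iff]
    omega
  rw [phi, phi, ← Finset.prod_mul_distrib]
  refine Finset.prod_congr rfl fun j _ => ?_
  rw [hs, Finset.prod_insert (by simp), mul_comm]

/-! ### Matrix elements of local operators -/

theorem smul_fermTau (hξ : ∀ j k, Complex.sinh (ξ j - ξ k + η) ≠ 0) (k : Fin M) :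
    fullA η ξ (ξ k) • fermTau η ξ (ξ k) =
      fullT η ξ (ξ k) false false - totalPar * fullT η ξ (ξ k) true true := by
  rw [fermTau, smul_sub, smul_fermT (hξ k), smul_fermT (hξ k)]
  simp

/-- On `N` particles the parity in the fermionic `D` is `(-1)^N`, so `A - D` acts as `A + κ D` with
the twist of the Bethe equations. At an inhomogeneity the vacuum eigenvalue of `D` vanishes and the
eigenvalue is a single product. -/
theorem fermTau_mulVec_fullKet (hξ : ∀ j k, Complex.sinh (ξ j - ξ k + η) ≠ 0)
    (h : IsBetheSolution η ξ v) (k : Fin M) :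
    fermTau η ξ (ξ k) *ᵥ fullKet η ξ v = (∏ j, f η (v j) (ξ k)) • fullKet η ξ v := by
  have ha := fullA_ne_zero η ξ (hξ k)
  have h1 := transfer_mulVec_fullKet η ξ h.sinh_sub_ne_zero (fun j => ((h.regular j).1 k).1)
    h.onShell (fullD_inhomogeneity ξ k)
  have h2 : (totalPar * fullT η ξ (ξ k) true true) *ᵥ fullKet η ξ v =
      (-1 : ℂ) ^ N • (fullT η ξ (ξ k) true true *ᵥ fullKet η ξ v) := by
    rw [totalPar_mul_fullT, Matrix.smul_mulVec, ← Matrix.mulVec_mulVec, totalPar_mulVec_fullKet,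
      Matrix.mulVec_smul]
    simp [grade]
  refine smul_right_injective _ ha ?_
  simp only
  rw [← Matrix.smul_mulVec, smul_fermTau hξ, Matrix.sub_mulVec, h2, smul_smul, ← h1,
    Matrix.add_mulVec, Matrix.smul_mulVec, pow_succ]
  module

theorem fullBra_vecMul_fermTau (hξ : ∀ j k, Complex.sinh (ξ j - ξ k + η) ≠ 0)
    (h : IsBetheSolution η ξ v) (k : Fin M) :
    fullBra η ξ v ᵥ* fermTau η ξ (ξ k) = (∏ j, f η (v j) (ξ k)) • fullBra η ξ v := by
  have ha := fullA_ne_zero η ξ (hξ k)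
  have h1 := fullBra_vecMul_transfer η ξ h.sinh_sub_ne_zero (fun j => ((h.regular j).1 k).1)
    h.onShell (fullD_inhomogeneity ξ k)
  refine smul_right_injective _ ha ?_
  simp only
  rw [← Matrix.vecMul_smul, smul_fermTau hξ, Matrix.vecMul_sub, ← Matrix.vecMul_vecMul,
    fullBra_vecMul_totalPar, Matrix.smul_vecMul, smul_smul, ← h1, Matrix.vecMul_add,
    Matrix.vecMul_smul, pow_succ]
  module

theorem fermV_mulVec_fullKet (hξ : ∀ j k, Complex.sinh (ξ j - ξ k + η) ≠ 0)
    (h : IsBetheSolution η ξ v) (k : ℕ) (hk : k ≤ M) :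
    fermV η ξ k *ᵥ fullKet η ξ v = phi η ξ k v • fullKet η ξ v := by
  induction k with
  | zero => simp [fermV, phi]
  | succ k ih =>
    rw [fermV, dif_pos (Nat.lt_of_succ_le hk), ← Matrix.mulVec_mulVec, fermTau_mulVec_fullKet hξ h, Matrix.mulVec_smul,
      ih (Nat.le_of_succ_le hk), smul_smul, phi_succ η ξ v hk, mul_comm]

theorem fullBra_vecMul_fermV (hξ : ∀ j k, Complex.sinh (ξ j - ξ k + η) ≠ 0)
    (h : IsBetheSolution η ξ v) (k : ℕ) (hk : k ≤ M) :
    fullBra η ξ v ᵥ* fermV η ξ k = phi η ξ k v • fullBra η ξ v := by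
  induction k with
  | zero => simp [fermV, phi]
  | succ k ih =>
    rw [fermV, dif_pos (Nat.lt_of_succ_le hk), ← Matrix.vecMul_vecMul, ih (Nat.le_of_succ_le hk), Matrix.smul_vecMul,
      fullBra_vecMul_fermTau hξ h, smul_smul, phi_succ η ξ v hk]

/-- The matrix elements of the local operators between Bethe vectors in terms of those of the
monodromy matrix. -/
theorem fullBra_dotProduct_fermBlock (hξ : ∀ j k, Complex.sinh (ξ j - ξ k + η) ≠ 0)
    {N' : ℕ} {u : Fin N' → ℂ} (hu : IsBetheSolution η ξ u) (hv : IsBetheSolution η ξ v)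
    (m : Fin M) (p q : Bool) :
    phi η ξ (m + 1) v * (fullBra η ξ u ⬝ᵥ (fermBlock 0 1 m p q *ᵥ fullKet η ξ v)) =
      phi η ξ m u *
        (fullBra η ξ u ⬝ᵥ (fermT η ξ (List.finRange M).reverse (ξ m) p q *ᵥ fullKet η ξ v)) := by
  have h := congrArg (fun X => fullBra η ξ u ⬝ᵥ (X *ᵥ fullKet η ξ v))
    (fermV_mul_fermT η ξ hξ m p q)
  rw [← Matrix.mulVec_mulVec, ← Matrix.mulVec_mulVec, Matrix.dotProduct_mulVec _ (fermV η ξ m),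
    fullBra_vecMul_fermV hξ hu m m.2.le, fermV_mulVec_fullKet hξ hv _ m.2, smul_dotProduct,
    Matrix.mulVec_smul, dotProduct_smul] at h
  exact h.symm

end BetheSolution

/-! ### The form factors of `c_m†` and `c_m`. -/

section FormFactors

variable {M N : ℕ} {η : ℂ} {ξ : Fin M → ℂ}

theorem sinhVandermonde_snoc (u : Fin N → ℂ) (x : ℂ) :
    sinhVandermonde (Fin.snoc u x : Fin (N + 1) → ℂ) =
      sinhVandermonde u * ∏ k, Complex.sinh (u k - x) := by
  have hI : ∀ i : Fin N, Finset.Ioi (Fin.castSucc i) =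
      insert (Fin.last N) ((Finset.Ioi i).map Fin.castSuccEmb) := by
    intro i
    ext j
    refine Fin.lastCases ?_ (fun j => ?_) j
    · simp [Fin.castSucc_lt_last]
    · simp [Fin.le_last]
  rw [sinhVandermonde, sinhVandermonde, Fin.prod_univ_castSucc, ← Finset.prod_mul_distrib]
  have hl : Finset.Ioi (Fin.last N) = ∅ := by
    ext j
    simp [Fin.le_last]
  rw [hl, Finset.prod_empty, mul_one]
  refine Finset.prod_congr rfl fun i _ => ?_
  rw [hI, Finset.prod_insert, Finset.prod_map, mul_comm]
  · simp
  · simp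

theorem slavnovEntry_inhomogeneity (κ : ℂ) (μ : Fin N → ℂ) (x a : ℂ) (j : Fin N)
    (hx : Complex.sinh (μ j - x + η) ≠ 0) :
    slavnovEntry η κ μ x a 0 j = (a * ∏ l, Complex.sinh (μ l - x + η)) * t η (μ j) x := by
  rw [slavnovEntry, t, mul_zero, zero_mul, sub_zero,
    ← Finset.mul_prod_erase Finset.univ (fun l => Complex.sinh (μ l - x + η)) (Finset.mem_univ j)]
  -- If the denominator vanishes, both sides are zero by the convention for division.
  by_cases h : Complex.sinh (μ j - x) = 0
  · simp [h]
  field_simp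

/-- The last column is taken at a zero of `d`, hence proportional to `t`. In the others `a(λ_k)`
splits off, and the twist for `N + 1` particles is `(-1)^(N+2) = (-1)^N`. -/
theorem det_slavnovMatrix_snoc (μ : Fin (N + 1) → ℂ) (lam : Fin N → ℂ) (m : Fin M)
    (hμ : ∀ j, Complex.sinh (μ j - ξ m + η) ≠ 0)
    (hlam : ∀ k m, Complex.sinh (lam k - ξ m + η) ≠ 0) :
    (slavnovMatrix η ((-1) ^ (N + 1 + 1)) (fullA η ξ) (fullD ξ) μ (Fin.snoc lam (ξ m))).det =
      (∏ k, fullA η ξ (lam k)) * (fullA η ξ (ξ m) * ∏ l, Complex.sinh (μ l - ξ m + η)) *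
        (Hminus η ξ m μ lam).det := by
  set w : Fin (N + 1) → ℂ := Fin.snoc (fun k => fullA η ξ (lam k))
    (fullA η ξ (ξ m) * ∏ l, Complex.sinh (μ l - ξ m + η)) with hw
  have hp : ∏ k, w k = (∏ k, fullA η ξ (lam k)) *
      (fullA η ξ (ξ m) * ∏ l, Complex.sinh (μ l - ξ m + η)) := by
    rw [Fin.prod_univ_castSucc]
    simp [hw]
  rw [← hp, ← Matrix.det_mul_row]
  congr 1
  ext j k
  simp only [slavnovMatrix, Matrix.of_apply]
  refine Fin.lastCases ?_ (fun k => ?_) k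
  · rw [Fin.snoc_last, fullD_inhomogeneity, slavnovEntry_inhomogeneity _ _ _ _ _ (hμ j)]
    simp [hw, Hminus]
  · rw [Fin.snoc_castSucc, ← fullA_mul_d η ξ (hlam k), slavnovEntry]
    simp only [hw, Hminus, Matrix.of_apply, Fin.snoc_castSucc]
    rw [pow_succ, pow_succ]
    ring

theorem fullA_smul_dotProduct (hξ : ∀ j k, Complex.sinh (ξ j - ξ k + η) ≠ 0) {N' : ℕ}
    {u : Fin N' → ℂ} {v : Fin N → ℂ} (hu : IsBetheSolution η ξ u) (hv : IsBetheSolution η ξ v)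
    (m : Fin M) (p q : Bool) :
    fullA η ξ (ξ m) * (phi η ξ (m + 1) v *
        (fullBra η ξ u ⬝ᵥ (fermBlock 0 1 m p q *ᵥ fullKet η ξ v))) =
      phi η ξ m u * (fullBra η ξ u ⬝ᵥ
        (((if p = true then totalPar else 1) * fullT η ξ (ξ m) p q) *ᵥ fullKet η ξ v)) := by
  rw [fullBra_dotProduct_fermBlock hξ hu hv, ← smul_fermT (hξ m), Matrix.smul_mulVec,
    dotProduct_smul, smul_eq_mul]
  ring

/-- By the inverse problem `c_m†` is `B(ξ_m)` between eigenvectors, so the ket gains the argument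
`ξ_m`. The sign is that of `N + 1` operators `C`. -/
theorem Fminus_mul (hξ : ∀ j k, Complex.sinh (ξ j - ξ k + η) ≠ 0) {mu : Fin (N + 1) → ℂ}
    {lam : Fin N → ℂ} (hmu : IsBetheSolution η ξ mu) (hlam : IsBetheSolution η ξ lam)
    (m : Fin M) :
    fullA η ξ (ξ m) * (phi η ξ (m + 1) lam *
        ((∏ j, fullA η ξ (mu j)) * (∏ k, fullA η ξ (lam k)) * Fminus η ξ m mu lam)) =
      (-1) ^ (N * (N + 1) / 2) * (phi η ξ m mu * fullScal η ξ mu (Fin.snoc lam (ξ m))) := by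
  have h := fullA_smul_dotProduct hξ hmu hlam m false true
  have hc : (fermBlock 0 1 m false true : FockOp M) = cre m := by
    rw [cre_eq_funit]
    simp [fermBlock]
  rw [hc, if_neg (by simp), one_mul, ← fullKet_snoc] at h
  rw [Fminus, vev_prodC_mul_prodB (fun j m => ((hmu.regular j).1 m).2)
    (fun k m => ((hlam.regular k).1 m).2), fullScal, ← h, Nat.add_sub_cancel, mul_comm (N + 1) N]
  ring

/-- Now `c_m` is `C(ξ_m)`, and the bra gains the argument `ξ_m`. The sign of the `N` operators `C`
and the parity `(-1)^N` in front of `C(ξ_m)` combine to that of `Fminus_mul`, and symmetry of the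
scalar product produces the same number. The ratio `F⁺ / F⁻` is therefore one of eigenvalues `phi`
alone. -/
theorem Fplus_mul (hξ : ∀ j k, Complex.sinh (ξ j - ξ k + η) ≠ 0) {mu : Fin (N + 1) → ℂ}
    {lam : Fin N → ℂ} (hmu : IsBetheSolution η ξ mu) (hlam : IsBetheSolution η ξ lam)
    (m : Fin M) :
    fullA η ξ (ξ m) * (phi η ξ (m + 1) mu *
        ((∏ k, fullA η ξ (lam k)) * (∏ j, fullA η ξ (mu j)) * Fplus η ξ m lam mu)) =
      (-1) ^ (N * (N + 1) / 2) * (phi η ξ m lam * fullScal η ξ mu (Fin.snoc lam (ξ m))) := by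
  have h := fullA_smul_dotProduct hξ hlam hmu m true false
  have hc : (fermBlock 0 1 m true false : FockOp M) = ann m := by
    rw [ann_eq_funit]
    simp [fermBlock]
  rw [hc, if_pos rfl, Matrix.dotProduct_mulVec _ (totalPar * _), ← Matrix.vecMul_vecMul,
    fullBra_vecMul_totalPar, Matrix.smul_vecMul, smul_dotProduct, ← fullBra_snoc] at h
  have hs : (-1 : ℂ) ^ (N * (N + 1) / 2) = (-1) ^ (N * (N - 1) / 2) * (-1) ^ N := by
    rw [← pow_add, ← Finset.sum_range_id, ← Finset.sum_range_succ, Finset.sum_range_id,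
      Nat.add_sub_cancel, mul_comm]
  rw [Fplus, vev_prodC_mul_prodB (fun j m => ((hlam.regular j).1 m).2)
    (fun k m => ((hmu.regular k).1 m).2), fullScal_comm, fullScal, hs]
  rw [smul_eq_mul] at h
  linear_combination ((-1 : ℂ) ^ (N * (N - 1) / 2)) * h

theorem Fplus_eq (hξ : ∀ j k, Complex.sinh (ξ j - ξ k + η) ≠ 0) {mu : Fin (N + 1) → ℂ}
    {lam : Fin N → ℂ} (hmu : IsBetheSolution η ξ mu) (hlam : IsBetheSolution η ξ lam)
    (m : Fin M) :
    Fplus η ξ m lam mu = phi η ξ (m + 1) lam * phi η ξ m lam /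
      (phi η ξ m mu * phi η ξ (m + 1) mu) * Fminus η ξ m mu lam := by
  have h1 := Fminus_mul hξ hmu hlam m
  have h2 := Fplus_mul hξ hmu hlam m
  have ha := fullA_ne_zero η ξ (hξ m)
  have p1 := hmu.phi_ne_zero m
  have p2 := hmu.phi_ne_zero (m + 1)
  have a1 := hmu.prod_fullA_ne_zero
  have a2 := hlam.prod_fullA_ne_zero
  rw [div_mul_eq_mul_div, eq_div_iff (mul_ne_zero p1 p2)]
  refine mul_left_cancel₀ (mul_ne_zero ha (mul_ne_zero a1 a2)) ?_
  linear_combination (phi η ξ m mu) * h2 - (phi η ξ m lam) * h1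

theorem prod_f_eq {lam : Fin N → ℂ} (x : ℂ) : ∏ k, f η (lam k) x =
    (∏ k, Complex.sinh (lam k - x + η)) / ∏ k, Complex.sinh (lam k - x) := by
  rw [← Finset.prod_div_distrib]
  rfl

theorem IsBetheSolution.sinhVandermonde_ne_zero' {v : Fin N → ℂ} (h : IsBetheSolution η ξ v) :
    (∏ j, ∏ k ∈ Finset.Ioi j, Complex.sinh (v k - v j)) ≠ 0 :=
  Finset.prod_ne_zero_iff.2 fun i _ => Finset.prod_ne_zero_iff.2 fun j hj =>
    h.sinh_sub_ne_zero j i (Finset.mem_Ioi.1 hj).ne'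

theorem sinh_eta_ne_zero (hξ : ∀ j k, Complex.sinh (ξ j - ξ k + η) ≠ 0) (m : Fin M) :
    Complex.sinh η ≠ 0 := by
  have := hξ m m
  rwa [sub_self, zero_add] at this

theorem Fminus_eq (hξ : ∀ j k, Complex.sinh (ξ j - ξ k + η) ≠ 0) {mu : Fin (N + 1) → ℂ}
    {lam : Fin N → ℂ} (hmu : IsBetheSolution η ξ mu) (hlam : IsBetheSolution η ξ lam)
    (m : Fin M) (hne : ∀ j k, Complex.sinh (mu j - lam k) ≠ 0) :
    Fminus η ξ m mu lam = (-1 : ℂ) ^ (N * (N + 1) / 2) * (phi η ξ m mu / phi η ξ m lam) *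
      ((∏ j, Complex.sinh (mu j - ξ m + η)) / ∏ k, Complex.sinh (lam k - ξ m + η)) *
      ((Hminus η ξ m mu lam).det / ((∏ j, ∏ k ∈ Finset.Ioi j, Complex.sinh (mu k - mu j)) *
        ∏ a, ∏ b ∈ Finset.Ioi a, Complex.sinh (lam a - lam b))) := by
  have h1 := Fminus_mul hξ hmu hlam m
  have h2 := fullScal_mul η ξ (u := (Fin.snoc lam (ξ m) : Fin (N + 1) → ℂ))
    (sinh_eta_ne_zero hξ m) (fun i j hij => (hmu.regular i).2 j hij.symm) hmu.onShell (by
      intro i j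
      refine Fin.lastCases ?_ (fun j => ?_) j
      · rw [Fin.snoc_last]
        exact ((hmu.regular i).1 m).1
      · rw [Fin.snoc_castSucc]
        exact hne i j)
  rw [sinhVandermonde_snoc, det_slavnovMatrix_snoc mu lam m (fun j => ((hmu.regular j).1 m).2)
    (fun k m => ((hlam.regular k).1 m).2), hmu.prod_fullD] at h2
  have ha := fullA_ne_zero η ξ (hξ m)
  have p1 := hlam.phi_ne_zero m
  have a1 := hmu.prod_fullA_ne_zero
  have a2 := hlam.prod_fullA_ne_zero
  have v1 := hmu.sinhVandermonde_ne_zero'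
  have v2 : sinhVandermonde lam ≠ 0 := sinhVandermonde_ne_zero hlam.sinh_sub_ne_zero
  have s1 : ∏ k, Complex.sinh (lam k - ξ m + η) ≠ 0 :=
    Finset.prod_ne_zero_iff.2 fun k _ => ((hlam.regular k).1 m).2
  have s2 : ∏ k, Complex.sinh (lam k - ξ m) ≠ 0 :=
    Finset.prod_ne_zero_iff.2 fun k _ => ((hlam.regular k).1 m).1
  -- The extra factor of `phi` at `m + 1` is `P / Q`; its denominator `Q` cancels the product `∏
  -- sinh (λ_k - ξ_m)` in the Vandermonde product of `(λ, ξ_m)`.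
  rw [phi_succ η ξ lam m.2, Fin.eta, prod_f_eq] at h1
  change _ = _ * _ * _ * (_ / (_ * sinhVandermonde lam))
  generalize (∏ j, ∏ k ∈ Finset.Ioi j, Complex.sinh (mu k - mu j)) = X at *
  generalize sinhVandermonde lam = Y at *
  generalize (∏ k, Complex.sinh (lam k - ξ m + η)) = P at *
  generalize (∏ k, Complex.sinh (lam k - ξ m)) = Q at *
  generalize (∏ k, fullA η ξ (lam k)) = a at *
  generalize (∏ k, fullA η ξ (mu k)) = b at *
  generalize fullScal η ξ mu (Fin.snoc lam (ξ m)) = S at *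
  generalize (Hminus η ξ m mu lam).det = D at *
  generalize fullA η ξ (ξ m) = c at *
  have hS : S = b * (a * (c * ∏ l, Complex.sinh (mu l - ξ m + η)) * D) / (Y * Q * X) := by
    rw [eq_div_iff (mul_ne_zero (mul_ne_zero v2 s2) v1)]
    exact h2
  rw [hS] at h1
  refine mul_left_cancel₀ (mul_ne_zero (mul_ne_zero ha (mul_ne_zero p1 (div_ne_zero s1 s2)))
    (mul_ne_zero a1 a2)) ?_
  calc _ = c * (phi η ξ m lam * (P / Q) * (b * a * Fminus η ξ m mu lam)) := by ring
    _ = _ := by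
      rw [h1]
      field_simp

end FormFactors

/-- The determinant of a rank-one perturbation. -/
theorem det_add_vecMulVec_row {n R : Type*} [Fintype n] [DecidableEq n] [CommRing R]
    (A : Matrix n n R) (u v : n → R) :
    (A + Matrix.vecMulVec v u).det = A.det + ∑ k, v k * (A.updateRow k u).det := by
  have h : ∀ S : Finset n, (Matrix.of fun i j => A i j + (if i ∈ S then v i else 0) * u j).det =
      A.det + ∑ k ∈ S, v k * (A.updateRow k u).det := by
    intro S
    induction S using Finset.induction_on with
    | empty =>
      simp only [Finset.notMem_empty, if_false, zero_mul, add_zero, Finset.sum_empty]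
      rfl
    | insert k S hk ih =>
      set B : Matrix n n R := Matrix.of fun i j => A i j + (if i ∈ S then v i else 0) * u j with hB
      have h1 : (Matrix.of fun i j => A i j + (if i ∈ insert k S then v i else 0) * u j) =
          B.updateRow k (B k + v k • u) := by
        ext i j
        by_cases hi : i = k
        · subst hi
          simp [hB, hk]
        · simp [hB, hi, Matrix.updateRow_ne]
      have h2 : (B.updateRow k u).det = (A.updateRow k u).det := by
        refine Matrix.det_eq_of_forall_row_eq_smul_add_const (fun i => if i ∈ S then v i else 0) k
          (if_neg hk) fun i j => ?_
        by_cases hi : i = k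
        · subst hi
          simp [hk]
        · simp [hB, hi, Matrix.updateRow_ne]
      rw [h1, Matrix.det_updateRow_add, Matrix.updateRow_eq_self, Matrix.det_updateRow_smul, h2, ih,
        Finset.sum_insert hk]
      ring
  rw [← h Finset.univ]
  congr 1
  ext i j
  simp [Matrix.vecMulVec_apply]

theorem det_add_vecMulVec {n R : Type*} [Fintype n] [DecidableEq n] [CommRing R]
    (A : Matrix n n R) (u v : n → R) :
    (A + Matrix.vecMulVec u v).det = A.det + ∑ k, v k * (A.updateCol k u).det := by
  have h := det_add_vecMulVec_row Aᵀ u v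
  rw [← Matrix.det_transpose, Matrix.transpose_add, Matrix.transpose_vecMulVec, h,
    Matrix.det_transpose]
  congr 1
  refine Finset.sum_congr rfl fun k _ => ?_
  rw [Matrix.updateRow_transpose, Matrix.det_transpose]

/-- The restriction on `μ i - u k + η` was only needed for the residue argument; perturbing `η`
removes it. Bethe roots of two solutions may differ by `η`. -/
theorem sum_slavnovWeight_shift_eq {N : ℕ} (η : ℂ) (μ u : Fin N → ℂ)
    (hμ : ∀ i j, i ≠ j → Complex.sinh (μ i - μ j) ≠ 0)
    (hu : ∀ i j, Complex.sinh (μ i - u j) ≠ 0) (k : Fin N) :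
    ∑ j, slavnovWeight μ u j / Complex.sinh (μ j - u k) *
        ∏ l ∈ Finset.univ.erase j, Complex.sinh (μ l - u k + η) =
      ∏ l ∈ Finset.univ.erase k, Complex.sinh (u l - u k + η) := by
  have h := eq_at_zero_of_eventually_eq
    (x := fun ε => ∑ j, slavnovWeight μ u j / Complex.sinh (μ j - u k) *
        ∏ l ∈ Finset.univ.erase j, Complex.sinh (μ l - u k + (η + ε)))
    (y := fun ε => ∏ l ∈ Finset.univ.erase k, Complex.sinh (u l - u k + (η + ε)))
    (by fun_prop) (by fun_prop) ?_
  · simpa only [add_zero] using h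
  have h1 : ∀ᶠ ε in 𝓝[≠] (0 : ℂ), ∀ i, Complex.sinh (μ i - u k + (η + ε)) ≠ 0 :=
    eventually_all.2 fun i => by
      filter_upwards [eventually_sinh_ne_zero (μ i - u k + η) one_ne_zero] with ε hε
      convert hε using 2
      ring
  filter_upwards [h1] with ε hε
  exact sum_slavnovWeight_shift (η + ε) μ u hμ hu k hε

/-! ### The form factor of `1 - 2 n_m`. -/

section FormFactors

variable {M N : ℕ} {η : ℂ} {ξ : Fin M → ℂ} {mu lam : Fin N → ℂ}

/-- Distinct on-shell Bethe vectors are orthogonal. -/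
theorem det_Hz (hmu : IsBetheSolution η ξ mu) (hlam : IsBetheSolution η ξ lam)
    (hne : ∀ j k, Complex.sinh (mu j - lam k) ≠ 0) (hN : N ≠ 0) : (Hz η ξ mu lam).det = 0 := by
  -- The weighted combination of the rows vanishes because its components are the Bethe equations of
  -- `λ`. The weights are nonzero since no `μ_j` meets a `λ_l`.
  refine Matrix.exists_vecMul_eq_zero_iff.1 ⟨slavnovWeight mu lam, ?_, ?_⟩
  · intro h
    refine div_ne_zero (Finset.prod_ne_zero_iff.2 fun l _ => hne _ l)
      (Finset.prod_ne_zero_iff.2 fun a ha => hmu.sinh_sub_ne_zero _ a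
        (Finset.ne_of_mem_erase ha).symm) (congrFun h ⟨0, Nat.pos_of_ne_zero hN⟩)
  · ext k
    have h1 := sum_slavnovWeight_shift_eq η mu lam hmu.sinh_sub_ne_zero hne k
    have h2 := sum_slavnovWeight_shift_eq (-η) mu lam hmu.sinh_sub_ne_zero hne k
    have h3 := hlam.onShell k
    simp only [← sub_eq_add_neg] at h2
    rw [← fullA_mul_d η ξ fun m => ((hlam.regular k).1 m).2] at h3
    have ha := fullA_ne_zero η ξ fun m => ((hlam.regular k).1 m).2
    have e1 : ∏ l ∈ Finset.univ.erase k, f η (lam l) (lam k) =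
        (∏ l ∈ Finset.univ.erase k, Complex.sinh (lam l - lam k + η)) /
          ∏ l ∈ Finset.univ.erase k, Complex.sinh (lam l - lam k) := Finset.prod_div_distrib ..
    have e2 : ∏ l ∈ Finset.univ.erase k, f η (lam k) (lam l) =
        (∏ l ∈ Finset.univ.erase k, Complex.sinh (lam l - lam k - η)) /
          ∏ l ∈ Finset.univ.erase k, Complex.sinh (lam l - lam k) := by
      rw [← Finset.prod_div_distrib]
      refine Finset.prod_congr rfl fun l _ => ?_
      rw [f, show lam k - lam l + η = -(lam l - lam k - η) by ring, sinh_sub_comm (lam k),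
        Complex.sinh_neg, neg_div_neg_eq]
    have e3 : ∏ l ∈ Finset.univ.erase k, Complex.sinh (lam l - lam k) ≠ 0 :=
      Finset.prod_ne_zero_iff.2 fun l hl => hlam.sinh_sub_ne_zero _ _ (Finset.ne_of_mem_erase hl)
    rw [e1, e2] at h3
    have h4 : ∏ l ∈ Finset.univ.erase k, Complex.sinh (lam l - lam k + η) =
        (-1) ^ (N + 1) * d η ξ (lam k) *
          ∏ l ∈ Finset.univ.erase k, Complex.sinh (lam l - lam k - η) := by
      field_simp at h3
      linear_combination h3
    simp only [Matrix.vecMul, dotProduct, Hz, Matrix.of_apply, Pi.zero_apply]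
    have h5 : Complex.sinh η * (∏ l ∈ Finset.univ.erase k, Complex.sinh (lam l - lam k + η) -
        (-1) ^ (N + 1) * d η ξ (lam k) *
          ∏ l ∈ Finset.univ.erase k, Complex.sinh (lam l - lam k - η)) = 0 := by
      rw [h4, sub_self, mul_zero]
    rw [← h5, ← h1, ← h2, Finset.mul_sum, ← Finset.sum_sub_distrib, Finset.mul_sum]
    refine Finset.sum_congr rfl fun j _ => ?_
    ring

theorem Pz_eq (m : Fin M) : Pz η ξ m mu lam = Matrix.vecMulVec (fun j => t η (mu j) (ξ m))
    fun k => ∏ a, Complex.sinh (lam a - lam k + η) := rfl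

theorem rank_Pz (hξ : ∀ j k, Complex.sinh (ξ j - ξ k + η) ≠ 0) (hmu : IsBetheSolution η ξ mu)
    (hlam : IsBetheSolution η ξ lam) (m : Fin M) (hN : N ≠ 0) : (Pz η ξ m mu lam).rank = 1 := by
  have hη := sinh_eta_ne_zero hξ m
  refine le_antisymm (by rw [Pz_eq]; exact Matrix.rank_vecMulVec_le _ _) ?_
  rw [Nat.one_le_iff_ne_zero]
  intro hr
  have h : Pz η ξ m mu lam = 0 := by
    have h1 := Submodule.finrank_eq_zero.1 hr
    rw [LinearMap.range_eq_bot] at h1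
    ext i j
    simpa using congrFun (LinearMap.congr_fun h1 (Pi.single j 1)) i
  have h0 := congrFun (congrFun h ⟨0, Nat.pos_of_ne_zero hN⟩) ⟨0, Nat.pos_of_ne_zero hN⟩
  refine mul_ne_zero ?_ ?_ h0
  · exact div_ne_zero hη (mul_ne_zero ((hmu.regular _).1 m).1 ((hmu.regular _).1 m).2)
  · refine Finset.prod_ne_zero_iff.2 fun a _ => ?_
    by_cases ha : a = ⟨0, Nat.pos_of_ne_zero hN⟩
    · rw [ha, sub_self, zero_add]
      exact hη
    · exact ((hlam.regular a).2 _ (Ne.symm ha)).2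

/-- The operator is the sum of the diagonal blocks of the graded permutation, so it becomes the
fermionic `A + D` at `ξ m`, which on `N` particles is `(A + κ D) - 2 κ D`. The first part is
diagonal on the ket; the second replaces one `λ_k` by `ξ_m`. -/
theorem Fz_mul (hξ : ∀ j k, Complex.sinh (ξ j - ξ k + η) ≠ 0) (hmu : IsBetheSolution η ξ mu)
    (hlam : IsBetheSolution η ξ lam) (m : Fin M) :
    fullA η ξ (ξ m) * (phi η ξ (m + 1) lam *
        ((∏ j, fullA η ξ (mu j)) * (∏ k, fullA η ξ (lam k)) * Fz η ξ m mu lam)) =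
      (-1) ^ (N * (N - 1) / 2) * (phi η ξ m mu *
        (fullA η ξ (ξ m) * (∏ k, f η (lam k) (ξ m)) * fullScal η ξ mu lam -
          2 * ∑ k, fullA η ξ (lam k) * (g η (lam k) (ξ m) *
            ∏ l ∈ Finset.univ.erase k, f η (lam l) (lam k)) *
              fullScal η ξ mu (Function.update lam k (ξ m)))) := by
  have hA := fullA_smul_dotProduct hξ hmu hlam m false false
  have hD := fullA_smul_dotProduct hξ hmu hlam m true true
  have hsp := fun j => ((hlam.regular j).1 m).1
  have hd := fullD_inhomogeneity ξ m
  have h1 := transfer_mulVec_fullKet η ξ hlam.sinh_sub_ne_zero hsp hlam.onShell hd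
  have h2 := smul_fullT_mulVec_fullKet η ξ hlam.sinh_sub_ne_zero hsp hlam.onShell hd
  have hc : (1 - (2 : ℂ) • num m : FockOp M) =
      fermBlock 0 1 m false false + fermBlock 0 1 m true true := by
    rw [num_eq_funit, ← funit_false_add_funit_true m]
    simp only [fermBlock, Matrix.of_apply]
    module
  rw [if_neg (by simp), one_mul] at hA
  rw [if_pos rfl, Matrix.dotProduct_mulVec _ (totalPar * _), ← Matrix.vecMul_vecMul,
    fullBra_vecMul_totalPar, Matrix.smul_vecMul, smul_dotProduct, ← Matrix.dotProduct_mulVec,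
    smul_eq_mul] at hD
  have h3 := congrArg (fun w => fullBra η ξ mu ⬝ᵥ w) h1
  have h4 := congrArg (fun w => fullBra η ξ mu ⬝ᵥ w) h2
  simp only [Matrix.add_mulVec, Matrix.smul_mulVec, dotProduct_add, dotProduct_smul, dotProduct_sum,
    smul_eq_mul] at h3 h4
  rw [Fz, vev_prodC_mul_prodB (fun j m => ((hmu.regular j).1 m).2)
    (fun k m => ((hlam.regular k).1 m).2), hc, Matrix.add_mulVec, dotProduct_add]
  simp only [fullScal]
  rw [← h4, ← h3]
  rw [pow_succ]
  linear_combination ((-1 : ℂ) ^ (N * (N - 1) / 2)) * (hA + hD)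

theorem slavnovMatrix_eq_mul (hlam : IsBetheSolution η ξ lam) :
    slavnovMatrix η ((-1) ^ (N + 1)) (fullA η ξ) (fullD ξ) mu lam =
      Matrix.of fun j k => fullA η ξ (lam k) * Hz η ξ mu lam j k := by
  ext j k
  simp only [slavnovMatrix, Hz, Matrix.of_apply, slavnovEntry]
  rw [← fullA_mul_d η ξ fun m => ((hlam.regular k).1 m).2]
  ring

theorem det_slavnovMatrix (hlam : IsBetheSolution η ξ lam) :
    (slavnovMatrix η ((-1) ^ (N + 1)) (fullA η ξ) (fullD ξ) mu lam).det =
      (∏ k, fullA η ξ (lam k)) * (Hz η ξ mu lam).det := by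
  rw [slavnovMatrix_eq_mul hlam, Matrix.det_mul_row]

/-- The factor `a(λ_k)` is missing from the determinant because its column is now taken at `ξ_m`;
multiplying by it restores the full product. -/
theorem det_slavnovMatrix_update (hmu : IsBetheSolution η ξ mu) (hlam : IsBetheSolution η ξ lam)
    (m : Fin M) (k : Fin N) :
    fullA η ξ (lam k) * (slavnovMatrix η ((-1) ^ (N + 1)) (fullA η ξ) (fullD ξ) mu
        (Function.update lam k (ξ m))).det =
      (∏ l, fullA η ξ (lam l)) * (fullA η ξ (ξ m) * ∏ l, Complex.sinh (mu l - ξ m + η)) *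
        ((Hz η ξ mu lam).updateCol k fun j => t η (mu j) (ξ m)).det := by
  set w : Fin N → ℂ := Function.update (fun k => fullA η ξ (lam k)) k
    (fullA η ξ (ξ m) * ∏ l, Complex.sinh (mu l - ξ m + η)) with hw
  have h : slavnovMatrix η ((-1) ^ (N + 1)) (fullA η ξ) (fullD ξ) mu
      (Function.update lam k (ξ m)) = Matrix.of fun j l => w l *
        ((Hz η ξ mu lam).updateCol k fun j => t η (mu j) (ξ m)) j l := by
    ext j l
    by_cases hl : l = k
    · subst hl
      simp only [slavnovMatrix, Matrix.of_apply, Function.update_self, hw, Matrix.updateCol_self]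
      rw [fullD_inhomogeneity, slavnovEntry_inhomogeneity _ _ _ _ _ ((hmu.regular j).1 m).2]
    · have := congrFun (congrFun (slavnovMatrix_eq_mul (mu := mu) hlam) j) l
      simp only [slavnovMatrix, Matrix.of_apply, Function.update_of_ne hl, hw,
        Matrix.updateCol_ne hl] at this ⊢
      exact this
  rw [h, Matrix.det_mul_row, Finset.prod_update_of_mem (Finset.mem_univ k),
    ← Finset.mul_prod_erase Finset.univ (fun l => fullA η ξ (lam l)) (Finset.mem_univ k),
    Finset.sdiff_singleton_eq_erase]
  ring

/-- The ratio of Vandermonde products together with `f` and `g` yields `∏ sinh (λ_a - λ_k + η)`,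
whose factor `a = k` is the `sinh η` of `g`. This is the entry of the row vector in the rank-one
matrix `P`. -/
theorem fullScal_update (hη : Complex.sinh η ≠ 0) (hmu : IsBetheSolution η ξ mu)
    (hlam : IsBetheSolution η ξ lam) (hne : ∀ j k, Complex.sinh (mu j - lam k) ≠ 0) (m : Fin M)
    (k : Fin N) :
    fullA η ξ (lam k) * (g η (lam k) (ξ m) * ∏ l ∈ Finset.univ.erase k, f η (lam l) (lam k)) *
        fullScal η ξ mu (Function.update lam k (ξ m)) *
          (sinhVandermonde lam * (∏ j, ∏ k ∈ Finset.Ioi j, Complex.sinh (mu k - mu j)) *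
            ∏ l, Complex.sinh (lam l - ξ m)) =
      (∏ j, fullA η ξ (mu j)) * ((∏ l, fullA η ξ (lam l)) *
        (fullA η ξ (ξ m) * ∏ l, Complex.sinh (mu l - ξ m + η))) *
          ((∏ a, Complex.sinh (lam a - lam k + η)) *
            ((Hz η ξ mu lam).updateCol k fun j => t η (mu j) (ξ m)).det) := by
  have h1 := fullScal_mul η ξ (u := Function.update lam k (ξ m)) hη
    (fun i j hij => (hmu.regular i).2 j hij.symm) hmu.onShell (by
      intro i j
      by_cases hj : j = k
      · subst hj
        rw [Function.update_self]
        exact ((hmu.regular i).1 m).1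
      · rw [Function.update_of_ne hj]
        exact hne i j)
  rw [hmu.prod_fullD] at h1
  have h2 := det_slavnovMatrix_update hmu hlam m k
  have h3 := sinhVandermonde_update lam k (ξ m)
  have e1 : ∏ l ∈ Finset.univ.erase k, f η (lam l) (lam k) =
      (∏ l ∈ Finset.univ.erase k, Complex.sinh (lam l - lam k + η)) /
        ∏ l ∈ Finset.univ.erase k, Complex.sinh (lam l - lam k) := Finset.prod_div_distrib ..
  have e3 : ∏ l ∈ Finset.univ.erase k, Complex.sinh (lam l - lam k) ≠ 0 :=
    Finset.prod_ne_zero_iff.2 fun l hl => hlam.sinh_sub_ne_zero _ _ (Finset.ne_of_mem_erase hl)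
  have e4 := ((hlam.regular k).1 m).1
  rw [e1, g, ← Finset.mul_prod_erase Finset.univ (fun l => Complex.sinh (lam l - ξ m))
    (Finset.mem_univ k), ← Finset.mul_prod_erase Finset.univ
    (fun l => Complex.sinh (lam l - lam k + η)) (Finset.mem_univ k), sub_self, zero_add]
  generalize (∏ j, ∏ k ∈ Finset.Ioi j, Complex.sinh (mu k - mu j)) = X at *
  generalize sinhVandermonde (Function.update lam k (ξ m)) = Y' at *
  generalize sinhVandermonde lam = Y at *
  generalize (∏ l ∈ Finset.univ.erase k, Complex.sinh (lam l - ξ m)) = P at *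
  generalize (∏ l ∈ Finset.univ.erase k, Complex.sinh (lam l - lam k)) = Q at *
  generalize (∏ l ∈ Finset.univ.erase k, Complex.sinh (lam l - lam k + η)) = R at *
  generalize fullScal η ξ mu (Function.update lam k (ξ m)) = S at *
  generalize fullA η ξ (lam k) = a at *
  generalize Complex.sinh (lam k - ξ m) = s at *
  generalize (slavnovMatrix η ((-1) ^ (N + 1)) (fullA η ξ) (fullD ξ) mu
        (Function.update lam k (ξ m))).det = D at *
  calc _ = a * Complex.sinh η * R * S * X * (Y * P) / Q := by field_simp
    _ = a * Complex.sinh η * R * (S * (Y' * X)) := by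
      rw [← h3]
      field_simp
    _ = _ := by
      rw [h1]
      linear_combination ((∏ j, fullA η ξ (mu j)) * Complex.sinh η * R) * h2

theorem Fz_eq (hξ : ∀ j k, Complex.sinh (ξ j - ξ k + η) ≠ 0) (hmu : IsBetheSolution η ξ mu)
    (hlam : IsBetheSolution η ξ lam) (hne : ∀ j k, Complex.sinh (mu j - lam k) ≠ 0) (m : Fin M) :
    Fz η ξ m mu lam = (-1 : ℂ) ^ (N * (N - 1) / 2) * (phi η ξ m mu / phi η ξ m lam) *
      (∏ j, Complex.sinh (mu j - ξ m + η) / Complex.sinh (lam j - ξ m + η)) *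
      ((Hz η ξ mu lam - (2 : ℂ) • Pz η ξ m mu lam).det /
        ∏ j, ∏ k ∈ Finset.Ioi j,
          (Complex.sinh (lam j - lam k) * Complex.sinh (mu k - mu j))) := by
  have hη := sinh_eta_ne_zero hξ m
  have h1 := Fz_mul hξ hmu hlam m
  have h2 := fullScal_mul η ξ hη (fun i j hij => (hmu.regular i).2 j hij.symm) hmu.onShell hne
  rw [hmu.prod_fullD, det_slavnovMatrix hlam] at h2
  have h3 := fun k => fullScal_update hη hmu hlam hne m k
  -- `P` is an outer product, so the determinant is affine in it: its expansion is a sum over single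
  -- replaced columns, as for the scalar products.
  have hdet : (Hz η ξ mu lam - (2 : ℂ) • Pz η ξ m mu lam).det = (Hz η ξ mu lam).det -
      2 * ∑ k, (∏ a, Complex.sinh (lam a - lam k + η)) *
        ((Hz η ξ mu lam).updateCol k fun j => t η (mu j) (ξ m)).det := by
    rw [Pz_eq, sub_eq_add_neg, ← neg_smul, ← Matrix.vecMulVec_smul, det_add_vecMulVec,
      sub_eq_add_neg, ← neg_mul, Finset.mul_sum]
    congr 1
    refine Finset.sum_congr rfl fun k _ => ?_
    rw [Pi.smul_apply, smul_eq_mul, mul_assoc]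
  have hden : (∏ j, ∏ k ∈ Finset.Ioi j,
      (Complex.sinh (lam j - lam k) * Complex.sinh (mu k - mu j))) =
        sinhVandermonde lam * ∏ j, ∏ k ∈ Finset.Ioi j, Complex.sinh (mu k - mu j) := by
    simp only [Finset.prod_mul_distrib]
    rfl
  -- The diagonal part comes with `∏ sinh (λ_j - ξ_m + η)` where the formula has `∏ sinh (μ_j - ξ_m
  -- + η)`. The mismatch is harmless: `det H = 0` by orthogonality, and for `N = 0` both products
  -- are empty.
  have hdet0 : (Hz η ξ mu lam).det * ∏ j, Complex.sinh (mu j - ξ m + η) =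
      (Hz η ξ mu lam).det * ∏ j, Complex.sinh (lam j - ξ m + η) := by
    rcases eq_or_ne N 0 with rfl | hN
    · simp
    · rw [det_Hz hmu hlam hne hN, zero_mul, zero_mul]
  have ha := fullA_ne_zero η ξ (hξ m)
  have p1 := hlam.phi_ne_zero m
  have a1 := hmu.prod_fullA_ne_zero
  have a2 := hlam.prod_fullA_ne_zero
  have v1 := hmu.sinhVandermonde_ne_zero'
  have v2 : sinhVandermonde lam ≠ 0 := sinhVandermonde_ne_zero hlam.sinh_sub_ne_zero
  have s1 : ∏ k, Complex.sinh (lam k - ξ m + η) ≠ 0 :=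
    Finset.prod_ne_zero_iff.2 fun k _ => ((hlam.regular k).1 m).2
  have s2 : ∏ k, Complex.sinh (lam k - ξ m) ≠ 0 :=
    Finset.prod_ne_zero_iff.2 fun k _ => ((hlam.regular k).1 m).1
  have hsum : (∑ k, fullA η ξ (lam k) * (g η (lam k) (ξ m) *
      ∏ l ∈ Finset.univ.erase k, f η (lam l) (lam k)) *
        fullScal η ξ mu (Function.update lam k (ξ m))) *
          (sinhVandermonde lam * (∏ j, ∏ k ∈ Finset.Ioi j, Complex.sinh (mu k - mu j)) *
            ∏ l, Complex.sinh (lam l - ξ m)) =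
      (∏ j, fullA η ξ (mu j)) * ((∏ l, fullA η ξ (lam l)) *
        (fullA η ξ (ξ m) * ∏ l, Complex.sinh (mu l - ξ m + η))) *
          ∑ k, (∏ a, Complex.sinh (lam a - lam k + η)) *
            ((Hz η ξ mu lam).updateCol k fun j => t η (mu j) (ξ m)).det := by
    rw [Finset.sum_mul, Finset.mul_sum]
    exact Finset.sum_congr rfl fun k _ => h3 k
  rw [hdet, hden, Finset.prod_div_distrib]
  rw [phi_succ η ξ lam m.2, Fin.eta, prod_f_eq] at h1
  generalize (∑ k, fullA η ξ (lam k) * (g η (lam k) (ξ m) *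
      ∏ l ∈ Finset.univ.erase k, f η (lam l) (lam k)) *
        fullScal η ξ mu (Function.update lam k (ξ m))) = Z at *
  generalize (∑ k, (∏ a, Complex.sinh (lam a - lam k + η)) *
    ((Hz η ξ mu lam).updateCol k fun j => t η (mu j) (ξ m)).det) = W at *
  generalize (∏ j, ∏ k ∈ Finset.Ioi j, Complex.sinh (mu k - mu j)) = X at *
  generalize sinhVandermonde lam = Y at *
  generalize (∏ k, Complex.sinh (lam k - ξ m + η)) = P at *
  generalize (∏ k, Complex.sinh (lam k - ξ m)) = Q at *
  generalize (∏ k, Complex.sinh (mu k - ξ m + η)) = T at *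
  generalize (∏ k, fullA η ξ (lam k)) = a at *
  generalize (∏ k, fullA η ξ (mu k)) = b at *
  generalize fullScal η ξ mu lam = S at *
  generalize (Hz η ξ mu lam).det = D at *
  generalize fullA η ξ (ξ m) = c at *
  have hS : S = b * (a * D) / (Y * X) := by
    rw [eq_div_iff (mul_ne_zero v2 v1)]
    exact h2
  have hZ : Z = b * (a * (c * T)) * W / (Y * X * Q) := by
    rw [eq_div_iff (mul_ne_zero (mul_ne_zero v2 v1) s2)]
    exact hsum
  rw [hS, hZ] at h1
  refine mul_left_cancel₀ (mul_ne_zero (mul_ne_zero ha (mul_ne_zero p1 (div_ne_zero s1 s2)))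
    (mul_ne_zero a1 a2)) ?_
  calc _ = c * (phi η ξ m lam * (P / Q) * (b * a * Fz η ξ m mu lam)) := by ring
    _ = _ := by
      rw [h1]
      field_simp
      linear_combination (-phi η ξ m mu) * hdet0

end FormFactors

end SpinlessFermion

end

theorem mainTheorem6 {M : ℕ} (η : ℂ) (ξ : Fin M → ℂ)
    (hξ : ∀ j k, Complex.sinh (ξ j - ξ k + η) ≠ 0) (m : Fin M) (N : ℕ) :
    (∀ (mu : Fin (N + 1) → ℂ) (lam : Fin N → ℂ),
      SpinlessFermion.IsBetheSolution η ξ mu → SpinlessFermion.IsBetheSolution η ξ lam →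
      ((∀ j k, Complex.sinh (mu j - lam k) ≠ 0) →
        SpinlessFermion.Fminus η ξ m mu lam =
          (-1 : ℂ) ^ (N * (N + 1) / 2) *
            (SpinlessFermion.phi η ξ (m : ℕ) mu / SpinlessFermion.phi η ξ (m : ℕ) lam) *
            ((∏ j, Complex.sinh (mu j - ξ m + η)) / ∏ k, Complex.sinh (lam k - ξ m + η)) *
            ((SpinlessFermion.Hminus η ξ m mu lam).det /
              ((∏ j, ∏ k ∈ Finset.Ioi j, Complex.sinh (mu k - mu j)) *
                ∏ a, ∏ b ∈ Finset.Ioi a, Complex.sinh (lam a - lam b)))) ∧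
      SpinlessFermion.Fplus η ξ m lam mu =
        SpinlessFermion.phi η ξ ((m : ℕ) + 1) lam * SpinlessFermion.phi η ξ (m : ℕ) lam /
            (SpinlessFermion.phi η ξ (m : ℕ) mu * SpinlessFermion.phi η ξ ((m : ℕ) + 1) mu) *
          SpinlessFermion.Fminus η ξ m mu lam) ∧
    (∀ mu lam : Fin N → ℂ,
      SpinlessFermion.IsBetheSolution η ξ mu → SpinlessFermion.IsBetheSolution η ξ lam →
      (∀ j k, Complex.sinh (mu j - lam k) ≠ 0) →
      SpinlessFermion.Fz η ξ m mu lam =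
          (-1 : ℂ) ^ (N * (N - 1) / 2) *
            (SpinlessFermion.phi η ξ (m : ℕ) mu / SpinlessFermion.phi η ξ (m : ℕ) lam) *
            (∏ j, Complex.sinh (mu j - ξ m + η) / Complex.sinh (lam j - ξ m + η)) *
            ((SpinlessFermion.Hz η ξ mu lam
                - (2 : ℂ) • SpinlessFermion.Pz η ξ m mu lam).det /
              ∏ j, ∏ k ∈ Finset.Ioi j,
                (Complex.sinh (lam j - lam k) * Complex.sinh (mu k - mu j))) ∧
        (N ≠ 0 → (SpinlessFermion.Pz η ξ m mu lam).rank = 1)) := by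
  refine ⟨fun mu lam hmu hlam => ⟨fun hne => ?_, ?_⟩, fun mu lam hmu hlam hne => ⟨?_, ?_⟩⟩
  · exact SpinlessFermion.Fminus_eq hξ hmu hlam m hne
  · exact SpinlessFermion.Fplus_eq hξ hmu hlam m
  · exact SpinlessFermion.Fz_eq hξ hmu hlam hne m
  · exact SpinlessFermion.rank_Pz hξ hmu hlam m
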